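/- **Setting.** Let $P^a,P^b$ be probability measures on a measurable space $\mathcal Y$ and let $\mathcal F$ be a class of (utility) functions $f:\mathcal Y\to\mathbb R$ that is both $P^a$-Donsker and $P^b$-Donsker, i.e. for $P\in\{P^a,P^b\}$ all $f\in\mathcal F$ are measurable with $Pf^2<\infty$ (where $Pf=\int f\,dP$), and the empirical process $\sqrt n(P_n-P)$ of an iid sample from $P$ has bounded sample paths on $\mathcal F$ and converges weakly (with outer expectations) in $\ell^\infty(\mathcal F)$ to a tight Borel limit. Assume also that for every $\delta>0$ and $P\in\{P^a,P^b\}$ the class $\mathcal F_\delta=\{f-g: f,g\in\mathcal F,\ \rho_P(f-g)<\delta\}$, $\rho_P(h)=\{P(h-Ph)^2\}^{1/2}$, is $P$-measurable: $(x_1,\dots,x_n)\mapsto\sup_{h\in\mathcal F_\delta}|\sum_i e_ih(x_i)|$ is measurable for the completion of $P^n$, for all $n$ and $e\in\mathbb R^n$. Let $Y^a_1,Y^a_2,\dots$ be iid from $P^a$ and, independently, $Y^b_1,Y^b_2,\dots$ iid from $P^b$. Samples of sizes $n_a,n_b\to\infty$ with $n_a/n_b\to\lambda$ are observed, with empirical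 measures $P^a_{n_a},P^b_{n_b}$. Let $$\sigma_f^2=P^af^2-(P^af)^2+\lambda\,[P^bf^2-(P^bf)^2],\qquad f\in\mathcal F,$$ be bounded away from zero uniformly over $\mathcal F$, and let $\hat\sigma_f$ be estimators (which may depend on the data and on the bootstrap draws) with $\sup_{f\in\mathcal F}|\hat\sigma_f-\sigma_f|\to0$ in (outer) probability. *Bootstrap weights.* For each of the two samples and each sample size $n$ let a law of exchangeable nonnegative weights $(\tilde W_{n1},\dots,\tilde W_{nn})$ with average $\bar W_n$ be given such that $\sup_n\int_0^\infty\sqrt{\Pr(|\tilde W_{n1}-\bar W_n|>x)}\,dx<\infty$, $n^{-1/2}\,\mathbb E\max_{i\le n}|\tilde W_{ni}-\bar W_n|\to0$, and $n^{-1}\sum_{i=1}^n(\tilde W_{ni}-\bar W_n)^2\to c^2$ in probability, with the same $c>0$ for both samples. The bootstrap uses $R$ replications, $R\to\infty$ as $n_a,n_b\to\infty$: in replication $r$, weights $\tilde W^{a,(r)}\in\mathbb R^{n_a}$, $\tilde W^{b,(r)}\in\mathbb R^{n_b}$ (averages $\bar W^{a,(r)},\bar W^{b,(r)}$) are drawn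 from these laws, all draws being independent of each other and of the data. Put $$\tilde T^{(r)}_f=\frac{\sqrt{n_a}}{c\,\hat\sigma_f}\Bigl[\tfrac1{n_a}\sum_{i=1}^{n_a}(\tilde W^{a,(r)}_i-\bar W^{a,(r)})f(Y^a_i)-\tfrac1{n_b}\sum_{j=1}^{n_b}(\tilde W^{b,(r)}_j-\bar W^{b,(r)})f(Y^b_j)\Bigr].$$ For $\mathcal S\subseteq\mathcal F$ let $\tilde T^{\mathcal S\vee}_{1-\alpha}$ be the sample $(1-\alpha)$-quantile of $\sup_{f\in\mathcal S}\tilde T^{(r)}_f$, $r=1,\dots,R$. *Stepdown procedure for $H_{0f}:P^af\le P^bf$, $f\in\mathcal F$.* Given test statistics $t_f$, let $\hat K^{(0)}=\mathcal F$. For $i=0,1,2,\dots$ reject every $H_{0f}$, $f\in\hat K^{(i)}$, with $t_f>\tilde T^{\hat K^{(i)}\vee}_{1-\alpha}$ (the critical value is recomputed from the same bootstrap draws), and let $\hat K^{(i+1)}$ be the set of $f$ with $H_{0f}$ not yet rejected; stop when $\hat K^{(i+1)}$ is empty or equal to $\hat K^{(i)}$. **Proposition.** Let $0<\alpha<1$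 and $\mathcal F_T=\{f\in\mathcal F:P^af\le P^bf\}$. The stepdown procedure has strong control of asymptotic familywise error rate at level $\alpha$: whatever $\mathcal F_T$ is, $$\limsup_{n_a,n_b\to\infty}\Pr\bigl(H_{0f}\text{ is rejected for some }f\in\mathcal F_T\bigr)\le\alpha ,$$ where $\Pr$ is read as outer probability if the event is not measurable. This holds both for the statistics $t_f=\sqrt{n_a}\,[(P^a_{n_a}-P^b_{n_b})f-(P^a-P^b)f]/\hat\sigma_f$ and for the zero-centred $t$-statistics $t_f=\sqrt{n_a}\,(P^a_{n_a}-P^b_{n_b})f/\hat\sigma_f$. -/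

import Mathlib

open MeasureTheory ProbabilityTheory Filter Topology
open scoped ENNReal BoundedContinuousFunction

/-! ### Weak convergence of possibly non-measurable maps, and Donsker classes -/

/-- The outer expectation `E^* Z`: the infimum of the expectations of the integrable majorants
of `Z`. (Only used for bounded `Z`.) -/
noncomputable def outerExpectation {Ω : Type*} [MeasurableSpace Ω] (μ : Measure Ω)
    (Z : Ω → ℝ) : ℝ :=
  sInf {r : ℝ | ∃ U : Ω → ℝ, Integrable U μ ∧ (∀ ω, Z ω ≤ U ω) ∧ r = ∫ ω, U ω ∂μ}

/-- Weak convergence (in the sense of Hoffmann-Jørgensen) of arbitrary maps `X n : Ω n → E` to a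
Borel law `L` on `E`: `E^* h (X n) → ∫ h dL` for every bounded continuous `h`. -/
def OuterWeakConverges {Ω : ℕ → Type*} [∀ n, MeasurableSpace (Ω n)] {E : Type*}
    [TopologicalSpace E] [MeasurableSpace E] (μ : ∀ n, Measure (Ω n)) (X : ∀ n, Ω n → E)
    (L : Measure E) : Prop :=
  ∀ h : E →ᵇ ℝ, Tendsto (fun n => outerExpectation (μ n) (fun ω => h (X n ω))) atTop
    (𝓝 (∫ z, h z ∂L))

/-- The space `ℓ^∞(F)` of bounded real functions on `F`, with the supremum norm. -/
abbrev LInfty {𝒴 : Type*} (F : Set (𝒴 → ℝ)) : Type _ := lp (fun _ : F => ℝ) ∞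

/-- `ℓ^∞(F)` carries its Borel sigma-algebra. -/
noncomputable instance LInfty.instMeasurableSpace {𝒴 : Type*} (F : Set (𝒴 → ℝ)) :
    MeasurableSpace (LInfty F) := borel _

/-- The class `F` is `P`-Donsker: it consists of measurable, square-integrable functions, the
empirical process `f ↦ √n (P_n f - P f)` has bounded sample paths, and it converges weakly in
`ℓ^∞(F)` to a tight Borel law. (The sample of size `n` lives on the `n`-fold product space.) -/
def IsDonsker {𝒴 : Type*} [MeasurableSpace 𝒴] (F : Set (𝒴 → ℝ)) (P : Measure 𝒴) : Prop :=
  (∀ f ∈ F, Measurable f ∧ MemLp f 2 P) ∧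
  ∃ G : ∀ n : ℕ, (Fin n → 𝒴) → LInfty F,
    (∀ (n : ℕ) (x : Fin n → 𝒴) (f : F),
      G n x f = √(n : ℝ) * ((∑ i, f.1 (x i)) / n - ∫ y, f.1 y ∂P)) ∧
    ∃ L : Measure (LInfty F), IsProbabilityMeasure L ∧ IsTightMeasureSet {L} ∧
      OuterWeakConverges (fun n => Measure.pi (fun _ : Fin n => P)) G L

/-- A `P`-measurable class of functions: for all `n` and `e ∈ ℝⁿ`, the map
`x ↦ sup_g |∑ i, e i * g (x i)|` is measurable on the completion of the `n`-fold product of `P`. -/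
def IsMeasurableClass {𝒴 : Type*} [MeasurableSpace 𝒴] (H : Set (𝒴 → ℝ)) (P : Measure 𝒴) : Prop :=
  ∀ (n : ℕ) (e : Fin n → ℝ),
    AEMeasurable (fun x : Fin n → 𝒴 => ⨆ g ∈ H, ‖∑ i, e i * g (x i)‖ₑ)
      (Measure.pi (fun _ : Fin n => P))

/-- The class `F_δ` of differences `f - g` with `ρ_P(f - g) < δ`, where
`ρ_P(f) = (P (f - P f)²)^{1/2}`. -/
noncomputable def smallDifferences {𝒴 : Type*} [MeasurableSpace 𝒴] (F : Set (𝒴 → ℝ))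
    (P : Measure 𝒴) (δ : ℝ) : Set (𝒴 → ℝ) :=
  {h | ∃ f ∈ F, ∃ g ∈ F, h = f - g ∧ √(∫ y, (h y - ∫ z, h z ∂P) ^ 2 ∂P) < δ}

/-! ### Exchangeable bootstrap weights -/

/-- The average of a weight vector. -/
noncomputable def weightMean {n : ℕ} (w : Fin n → ℝ) : ℝ := (∑ i, w i) / n

/-- `Q n` is the law of the bootstrap weights `(W_{n1}, …, W_{nn})` for a sample of size `n`. -/
structure IsBootstrapWeightLaw (Q : ∀ n : ℕ, Measure (Fin n → ℝ)) (c : ℝ) : Prop where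
  isProbability : ∀ n, IsProbabilityMeasure (Q n)
  nonneg : ∀ n, ∀ᵐ w ∂(Q n), ∀ i, 0 ≤ w i
  exchangeable : ∀ (n : ℕ) (σ : Equiv.Perm (Fin n)), (Q n).map (fun w i => w (σ i)) = Q n
  /-- `sup_n ∫_0^∞ P(|W_{n1} - W̄_n| > x)^{1/2} dx < ∞` -/
  norm_two_one : ∃ C : ℝ≥0∞, C < ∞ ∧ ∀ (n : ℕ) (i : Fin n),
    ∫⁻ x in Set.Ioi (0 : ℝ), (Q n {w | x < |w i - weightMean w|}) ^ (1 / 2 : ℝ) ≤ C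
  /-- `n^{-1/2} E max_i |W_{ni} - W̄_n| → 0` -/
  max_negligible : Tendsto
    (fun n : ℕ => (∫⁻ w, ⨆ i, ‖w i - weightMean w‖ₑ ∂(Q n)) / ENNReal.ofReal √(n : ℝ))
    atTop (𝓝 0)
  c_pos : 0 < c
  /-- `n^{-1} ∑_i (W_{ni} - W̄_n)² → c²` in probability -/
  variance_tendsto : ∀ ε : ℝ, 0 < ε → Tendsto
    (fun n : ℕ => Q n {w | ε < |(∑ i, (w i - weightMean w) ^ 2) / n - c ^ 2|}) atTop (𝓝 0)

/-! ### Statistics -/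

/-- `P_n f`, the average of `f` over the first `n` observations. -/
noncomputable def empMean {𝒴 : Type*} (n : ℕ) (y : ℕ → 𝒴) (f : 𝒴 → ℝ) : ℝ :=
  (∑ i : Fin n, f (y i)) / n

/-- The weighted bootstrap average `n⁻¹ ∑ i, w i * f (y i)`. -/
noncomputable def bootMean {𝒴 : Type*} {n : ℕ} (w : Fin n → ℝ) (y : ℕ → 𝒴) (f : 𝒴 → ℝ) : ℝ :=
  (∑ i : Fin n, w i * f (y i)) / n

/-- The bootstrap process
`√n_a [(P̃_a - P̃_b) - (W̄_a P_{n_a} - W̄_b P_{n_b})] f / c`. -/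
noncomputable def bootProcess {𝒴 : Type*} {na nb : ℕ} (c : ℝ) (ya yb : ℕ → 𝒴)
    (wa : Fin na → ℝ) (wb : Fin nb → ℝ) (f : 𝒴 → ℝ) : ℝ :=
  √(na : ℝ) * ((bootMean wa ya f - bootMean wb yb f)
    - (weightMean wa * empMean na ya f - weightMean wb * empMean nb yb f)) / c

/-- The `t`-statistic centred at the true difference:
`√n_a [(P_{n_a} - P_{n_b}) f - (P_a - P_b) f] / s f`. -/
noncomputable def centeredTStat {𝒴 : Type*} [MeasurableSpace 𝒴] (Pa Pb : Measure 𝒴)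
    (na nb : ℕ) (ya yb : ℕ → 𝒴) (s : (𝒴 → ℝ) → ℝ) (f : 𝒴 → ℝ) : ℝ :=
  √(na : ℝ) * ((empMean na ya f - empMean nb yb f) - (∫ y, f y ∂Pa - ∫ y, f y ∂Pb)) / s f

/-- The `t`-statistic centred at zero: `√n_a (P_{n_a} - P_{n_b}) f / s f`. -/
noncomputable def tStat {𝒴 : Type*} (na nb : ℕ) (ya yb : ℕ → 𝒴) (s : (𝒴 → ℝ) → ℝ)
    (f : 𝒴 → ℝ) : ℝ :=
  √(na : ℝ) * (empMean na ya f - empMean nb yb f) / s f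

/-- `σ_f`: the standard deviation at `f` of the Gaussian limit of
`√n_a [(P_{n_a} - P_{n_b}) - (P_a - P_b)]` when `n_a / n_b → lam`. -/
noncomputable def limitSD {𝒴 : Type*} [MeasurableSpace 𝒴] (Pa Pb : Measure 𝒴) (lam : ℝ)
    (f : 𝒴 → ℝ) : ℝ :=
  √((∫ y, f y ^ 2 ∂Pa - (∫ y, f y ∂Pa) ^ 2) + lam * (∫ y, f y ^ 2 ∂Pb - (∫ y, f y ∂Pb) ^ 2))

/-! ### The stepdown procedure -/

/-- The sample `p`-quantile of `v 0, …, v (R - 1)`: the infimum of the `t` for which at least a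
fraction `p` of the values are at most `t`. -/
noncomputable def sampleQuantile {R : ℕ} (p : ℝ) (v : Fin R → EReal) : EReal :=
  sInf {t : EReal | p * R ≤ (({r : Fin R | v r ≤ t}.ncard : ℕ) : ℝ)}

/-- The bootstrap critical value for the set `S` of hypotheses: the sample `(1 - α)`-quantile over
the bootstrap replications `r` of `sup_{f ∈ S} T̃_f^{(r)}`, where `T̃^{(r)} = tb r`. -/
noncomputable def critValue {𝒴 : Type*} {R : ℕ} (α : ℝ) (tb : Fin R → (𝒴 → ℝ) → ℝ)
    (S : Set (𝒴 → ℝ)) : EReal :=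
  sampleQuantile (1 - α) (fun r => ⨆ f ∈ S, (tb r f : EReal))

/-- `notRejected F α tb t i` is the set of the hypotheses in `F` not yet rejected before
iteration `i` of the stepdown procedure with test statistics `t` and bootstrap statistics `tb`.
In iteration `i` the critical value is recomputed over this set, with the same draws. -/
noncomputable def notRejected {𝒴 : Type*} {R : ℕ} (F : Set (𝒴 → ℝ)) (α : ℝ)
    (tb : Fin R → (𝒴 → ℝ) → ℝ) (t : (𝒴 → ℝ) → ℝ) : ℕ → Set (𝒴 → ℝ)
  | 0 => F
  | i + 1 => {f ∈ notRejected F α tb t i |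
      ¬ critValue α tb (notRejected F α tb t i) < (t f : EReal)}

/-- The hypotheses rejected by the stepdown procedure, in some iteration. The rule "stop when the
set of hypotheses not yet rejected is empty or unchanged" is built in: from then on, further
iterations leave that set as it is. -/
noncomputable def stepdownRejects {𝒴 : Type*} {R : ℕ} (F : Set (𝒴 → ℝ)) (α : ℝ)
    (tb : Fin R → (𝒴 → ℝ) → ℝ) (t : (𝒴 → ℝ) → ℝ) : Set (𝒴 → ℝ) :=
  {f ∈ F | ∃ i, f ∉ notRejected F α tb t i}

/-- The set of the `f ∈ F` whose null hypothesis `P_a f ≤ P_b f` is true. -/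
def trueNulls {𝒴 : Type*} [MeasurableSpace 𝒴] (F : Set (𝒴 → ℝ)) (Pa Pb : Measure 𝒴) :
    Set (𝒴 → ℝ) :=
  {f ∈ F | ∫ y, f y ∂Pa ≤ ∫ y, f y ∂Pb}

/-! Let S be the set of true hypotheses, and consider the first iteration that rejects a member of
S. Until then all of S is still under test, and critical values increase with the set of hypotheses,
so some f in S has t_f above the critical value of S itself. This reduces the familywise error to a
single-step test on S. For f in S with a positive σ̂_f, t_f is at most Z_f / σ̂_f, where Z is the
centred two-sample empirical process: with the first centring this is an equality, with the second
it is P^a f ≤ P^b f.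

The claim is one-sided, so a lower bound on the critical value suffices. The supremum over S of the
bootstrap statistics dominates their maximum over any finite subset, hence the bootstrap process is
needed at finitely many functions only, and its equicontinuity plays no role. Only Z must be
controlled on all of S. Tightness of the Donsker limits gives a finite partition of F on whose cells
Z_f / σ_f oscillates by at most ε with high probability (`exists_coloring_twoSampleEmp`).

At finitely many standardized functions both processes converge to the same Gaussian vector. For the
bootstrap, Lévy's theorem is applied unconditionally to two independent draws on common data
(`tendsto_integral_exp_bootSum`). With the weights frozen and the data integrated out, the
characteristic function is a product and the conditions on the weights are those of Lindeberg;
exchangeability makes the two centred weight vectors asymptotically orthogonal. The draws are thus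
independent in the limit, so E φ(B¹)φ(B²) → 0 for centred φ, and Chebyshev's inequality shows that
the average of φ(Bʳ) over the replications vanishes in probability. This replaces a conditional
limit theorem.

Finally, quantiles have to be compared up to errors of order ε, which needs anti-concentration of
the Gaussian maximum. Since the partition depends on ε, the bound must be free of the number of
cells. In `measure_max_mem_Ioc_mul_le` the constant depends on an upper bound C for the quantile
only, and C comes from the boundedness in probability of Z over the whole of F. The constants can
therefore be chosen in the order C, ε, partition. -/

lemma exists_fin_coloring {α κ : Type*} (φ : α → κ) (h : (Set.range φ).Finite) :
    ∃ (N : ℕ) (π : α → Fin N), Function.Surjective π ∧ ∀ a b, π a = π b → φ a = φ b := by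
  have := h.to_subtype
  obtain ⟨N, ⟨e⟩⟩ := Finite.exists_equiv_fin (Set.range φ)
  refine ⟨N, fun a => e ⟨φ a, a, rfl⟩, fun i => ?_,
    fun a b hab => congrArg Subtype.val (e.injective hab)⟩
  obtain ⟨⟨_, a, rfl⟩, ha⟩ := e.surjective i
  exact ⟨a, ha⟩

/-! ### Asymptotic equicontinuity of the empirical process of a Donsker class -/

section Equicontinuity

variable {𝒴 : Type*} [MeasurableSpace 𝒴]

/-- The empirical process `√n (P_n f - P f)`. -/
noncomputable def empDeviation (P : Measure 𝒴) (n : ℕ) (x : Fin n → 𝒴) (f : 𝒴 → ℝ) : ℝ :=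
  √(n : ℝ) * ((∑ i, f (x i)) / n - ∫ y, f y ∂P)

/-- The standard deviation `(P (h - P h)²)^{1/2}`. -/
noncomputable def stdDev (P : Measure 𝒴) (h : 𝒴 → ℝ) : ℝ :=
  √(∫ y, (h y - ∫ z, h z ∂P) ^ 2 ∂P)

/-- Markov's inequality, applied to a nearly optimal integrable majorant. -/
lemma measure_one_le_of_outerExpectation_lt {Ω : Type*} [MeasurableSpace Ω] {μ : Measure Ω}
    [IsProbabilityMeasure μ] {Z : Ω → ℝ} (h0 : ∀ ω, 0 ≤ Z ω) (h1 : ∀ ω, Z ω ≤ 1) {r : ℝ}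
    (h : outerExpectation μ Z < r) : μ {ω | 1 ≤ Z ω} ≤ ENNReal.ofReal r := by
  have hne : {r : ℝ | ∃ U : Ω → ℝ, Integrable U μ ∧ (∀ ω, Z ω ≤ U ω) ∧
      r = ∫ ω, U ω ∂μ}.Nonempty := ⟨_, fun _ => 1, integrable_const _, h1, rfl⟩
  obtain ⟨_, ⟨U, hU, hZU, rfl⟩, hr⟩ := exists_lt_of_csInf_lt hne h
  have hm := mul_meas_ge_le_integral_of_nonneg (.of_forall fun ω => (h0 ω).trans (hZU ω)) hU 1
  rw [one_mul] at hm
  calc μ {ω | 1 ≤ Z ω} ≤ μ {ω | 1 ≤ U ω} := measure_mono fun ω hω => le_trans hω (hZU ω)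
    _ = ENNReal.ofReal (μ.real {ω | 1 ≤ U ω}) := by simp
    _ ≤ ENNReal.ofReal r := ENNReal.ofReal_le_ofReal (hm.trans hr.le)

/-- The empirical process is close to a compact set with high outer probability, hence close in
supremum norm to one of finitely many bounded functions on F. A cell consists of the f at which all
these functions take nearly the same values. No semimetric on F is involved. -/
lemma IsDonsker.exists_coloring {F : Set (𝒴 → ℝ)} {P : Measure 𝒴} [IsProbabilityMeasure P]
    (hF : IsDonsker F P) {ε η : ℝ} (hε : 0 < ε) (hη : 0 < η) :
    ∃ (N : ℕ) (π : F → Fin N), ∀ᶠ n in atTop, Measure.pi (fun _ => P)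
      {x : Fin n → 𝒴 | ∃ f g : F, π f = π g ∧ ε < |empDeviation P n x f - empDeviation P n x g|} ≤
        ENNReal.ofReal η := by
  obtain ⟨-, G, hG, L, hL, hLt, hconv⟩ := hF
  have : BorelSpace (LInfty F) := ⟨rfl⟩
  obtain ⟨K₀, hK₀, hLK₀⟩ := isTightMeasureSet_iff_exists_isCompact_measure_compl_le.1 hLt
    (ENNReal.ofReal (η / 2)) (by simpa using hη)
  -- The point 0 makes the set nonempty; `Metric.infDist` to the empty set would be identically 0.
  let K : Set (LInfty F) := insert 0 K₀
  have hK : IsCompact K := hK₀.insert 0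
  have hKne : K.Nonempty := ⟨0, by simp [K]⟩
  have hLK : L Kᶜ ≤ ENNReal.ofReal (η / 2) :=
    (measure_mono (Set.compl_subset_compl.2 (Set.subset_insert _ _))).trans (hLK₀ L rfl)
  -- The process is within 2r of a centre, at f and at g, and the centre varies by less than 2r on a
  -- cell: 6r in all.
  set r : ℝ := ε / 6 with hr
  have hr0 : 0 < r := by positivity
  -- A continuous test function that is 0 on K and 1 at distance at least r from K. Weak convergence
  -- bounds its outer expectation, hence the outer probability of being that far away.
  let h : LInfty F →ᵇ ℝ := BoundedContinuousFunction.ofNormedAddCommGroup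
    (fun z => min 1 (Metric.infDist z K / r))
    (continuous_const.min ((Metric.continuous_infDist_pt K).div_const r)) 1 fun z => by
      rw [Real.norm_eq_abs, abs_of_nonneg (le_min zero_le_one
        (div_nonneg Metric.infDist_nonneg hr0.le))]
      exact min_le_left _ _
  have hh : ∀ z, h z = min 1 (Metric.infDist z K / r) := fun z => rfl
  have hh0 : ∀ z, 0 ≤ h z := fun z => le_min zero_le_one
    (div_nonneg Metric.infDist_nonneg hr0.le)
  have hh1 : ∀ z, h z ≤ 1 := fun z => min_le_left _ _
  have hint : ∫ z, h z ∂L ≤ η / 2 := by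
    have hKm : MeasurableSet Kᶜ := hK.isClosed.measurableSet.compl
    calc ∫ z, h z ∂L ≤ ∫ z, Kᶜ.indicator 1 z ∂L := by
          refine integral_mono (h.integrable L) ((integrable_const (1 : ℝ)).indicator hKm)
            fun z => ?_
          by_cases hz : z ∈ K
          · simp [hh, hz, Metric.infDist_zero_of_mem hz]
          · simpa [hz] using hh1 z
      _ = L.real Kᶜ := by rw [integral_indicator_one hKm]
      _ ≤ η / 2 := ENNReal.toReal_le_of_le_ofReal (by positivity) hLK
  obtain ⟨T, hTK, hTf, hKT⟩ := hK.finite_cover_balls hr0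
  have := hTf.fintype
  let φ : F → T → ℤ := fun f w => ⌊w.1 f / (2 * r)⌋
  have hφ : (Set.range φ).Finite := by
    refine Set.Finite.subset (Set.Finite.pi' fun w : T =>
      Set.finite_Icc ⌊-‖w.1‖ / (2 * r)⌋ ⌊‖w.1‖ / (2 * r)⌋) ?_
    rintro _ ⟨f, rfl⟩ w
    have hw := abs_le.1 ((Real.norm_eq_abs _).symm.le.trans
      (lp.norm_apply_le_norm ENNReal.top_ne_zero w.1 f))
    exact ⟨Int.floor_le_floor (by gcongr; exact hw.1), Int.floor_le_floor (by gcongr; exact hw.2)⟩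
  obtain ⟨N, π, -, hπ⟩ := exists_fin_coloring φ hφ
  refine ⟨N, π, ?_⟩
  filter_upwards [(hconv h).eventually (gt_mem_nhds (hint.trans_lt (half_lt_self hη)))] with n hn
  refine (measure_mono ?_).trans (measure_one_le_of_outerExpectation_lt (fun x => hh0 _)
    (fun x => hh1 _) hn)
  rintro x ⟨f, g, hfg, hlt⟩
  by_contra hc
  simp only [Set.mem_ofPred_eq, hh, le_min_iff, le_refl, true_and, not_le] at hc
  rw [div_lt_one hr0] at hc
  obtain ⟨z, hzK, hz⟩ := (Metric.infDist_lt_iff hKne).1 hc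
  obtain ⟨w, hwT, hzw⟩ := Set.mem_iUnion₂.1 (hKT hzK)
  have hdist : ‖G n x - w‖ < 2 * r := by
    rw [← dist_eq_norm]
    have := dist_triangle (G n x) z w
    have h2 : dist z w < r := hzw
    linarith
  have hcoord : ∀ f : F, |G n x f - w f| < 2 * r := fun f =>
    (lp.norm_apply_le_norm ENNReal.top_ne_zero (G n x - w) f).trans_lt hdist
  have hfl : |w f / (2 * r) - w g / (2 * r)| < 1 :=
    Int.abs_sub_lt_one_of_floor_eq_floor (congrFun (hπ f g hfg) ⟨w, hwT⟩)
  have hwfg : |w f - w g| < 2 * r := by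
    rw [← sub_div, abs_div, abs_of_pos (show 0 < 2 * r by positivity),
      div_lt_one (by positivity)] at hfl
    exact hfl
  have e1 : ∀ f : F, G n x f = empDeviation P n x f := fun f => hG n x f
  rw [← e1, ← e1] at hlt
  have h3 := hcoord f
  have h4 := hcoord g
  rw [abs_lt] at h3 h4 hwfg
  rcases lt_abs.1 hlt with h5 | h5 <;> linarith [h3.1, h3.2, h4.1, h4.2, hwfg.1, hwfg.2]

lemma stdDev_eq {P : Measure 𝒴} {h : 𝒴 → ℝ} (hh : AEMeasurable h P) :
    stdDev P h = √(Var[h; P]) := by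
  rw [variance_eq_integral hh, stdDev]

lemma measure_lt_abs_empDeviation_le {P : Measure 𝒴} [IsProbabilityMeasure P] {h : 𝒴 → ℝ}
    (hh : MemLp h 2 P) {n : ℕ} (hn : 0 < n) {ε : ℝ} (hε : 0 < ε) :
    Measure.pi (fun _ => P) {x : Fin n → 𝒴 | ε < |empDeviation P n x h|} ≤
      ENNReal.ofReal (stdDev P h ^ 2 / ε ^ 2) := by
  let S : (Fin n → 𝒴) → ℝ := ∑ i, fun x => h (x i)
  have hmem : ∀ i : Fin n, MemLp (fun x : Fin n → 𝒴 => h (x i)) 2 (Measure.pi fun _ => P) :=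
    fun i => hh.comp_measurePreserving (measurePreserving_eval _ i)
  have hS : MemLp S 2 (Measure.pi fun _ => P) := memLp_finsetSum' _ fun i _ => hmem i
  have hvar : Var[S; Measure.pi fun _ => P] = n * Var[h; P] := by
    have := variance_sum_pi (μ := fun _ : Fin n => P) (X := fun _ => h) fun _ => hh
    simpa [S] using this
  have hmean : ∫ x, S x ∂(Measure.pi fun _ => P) = n * ∫ y, h y ∂P := by
    have : ∀ i : Fin n, ∫ x : Fin n → 𝒴, h (x i) ∂(Measure.pi fun _ => P) = ∫ y, h y ∂P :=
      fun i => by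
        have hm := measurePreserving_eval (fun _ : Fin n => P) i
        conv_rhs => rw [← hm.map_eq]
        rw [integral_map hm.aemeasurable]
        rw [hm.map_eq]
        exact hh.aestronglyMeasurable
    simp only [S, Finset.sum_apply]
    rw [integral_finsetSum _ fun i _ => (hmem i).integrable (by norm_num)]
    simp [this]
  have hn' : (0 : ℝ) < n := by exact_mod_cast hn
  have hsub : {x : Fin n → 𝒴 | ε < |empDeviation P n x h|} ⊆
      {x | √n * ε ≤ |S x - ∫ x, S x ∂(Measure.pi fun _ => P)|} := by
    intro x hx
    have h1 : S x - ∫ x, S x ∂(Measure.pi fun _ => P) = √n * empDeviation P n x h := by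
      rw [hmean, empDeviation, ← mul_assoc, Real.mul_self_sqrt hn'.le]
      simp only [S, Finset.sum_apply]
      field_simp
    simp only [Set.mem_ofPred_eq] at hx ⊢
    rw [h1, abs_mul, abs_of_nonneg (Real.sqrt_nonneg _)]
    gcongr
  refine (measure_mono hsub).trans ((meas_ge_le_variance_div_sq hS (by positivity)).trans ?_)
  rw [hvar, stdDev_eq hh.aestronglyMeasurable.aemeasurable, Real.sq_sqrt (variance_nonneg _ _),
    mul_pow, Real.sq_sqrt hn'.le, mul_div_mul_left _ _ hn'.ne']

lemma IsDonsker.memLp {F : Set (𝒴 → ℝ)} {P : Measure 𝒴} (hF : IsDonsker F P) {f : 𝒴 → ℝ}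
    (hf : f ∈ F) : MemLp f 2 P := (hF.1 f hf).2

/-! ### Averages of bootstrap weights -/

lemma sum_sub_weightMean {n : ℕ} (w : Fin n → ℝ) : ∑ i, (w i - weightMean w) = 0 := by
  rcases Nat.eq_zero_or_pos n with rfl | hn
  · simp
  · simp [weightMean, Finset.sum_sub_distrib]
    field_simp
    simp

lemma measurable_sub_weightMean (n : ℕ) :
    Measurable fun (w : Fin n → ℝ) i => w i - weightMean w := by
  unfold weightMean
  fun_prop

lemma weightMean_comp_perm {n : ℕ} (w : Fin n → ℝ) (σ : Equiv.Perm (Fin n)) :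
    weightMean (fun i => w (σ i)) = weightMean w := by
  unfold weightMean
  rw [Equiv.sum_comp σ w]

end Equicontinuity

/-! ### Characteristic functions of weighted sums -/

section CharFun

variable {𝒴 : Type*} [MeasurableSpace 𝒴]

/-- The remainder is cubic near 0 and quadratic at infinity; in this form it is integrable under
second moments alone and is small after rescaling. -/
lemma norm_exp_mul_I_sub_taylor_le (x : ℝ) :
    ‖Complex.exp (x * Complex.I) - (1 + x * Complex.I - x ^ 2 / 2)‖ ≤ 4 * (x ^ 2 * min 1 |x|) := by
  rcases le_or_gt |x| 1 with hx | hx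
  · have h := Complex.exp_bound (x := x * Complex.I) (by simpa using hx) (n := 3) (by norm_num)
    have h2 : ∑ m ∈ Finset.range 3, (x * Complex.I) ^ m / (m.factorial : ℂ) =
        1 + x * Complex.I - x ^ 2 / 2 := by
      simp [Finset.sum_range_succ, mul_pow, Nat.factorial]
      ring
    rw [h2] at h
    refine h.trans ?_
    rw [min_eq_right hx]
    have h3 : ‖(x : ℂ) * Complex.I‖ = |x| := by simp
    have h4 : |x| ^ 3 = x ^ 2 * |x| := by rw [pow_succ, sq_abs]
    rw [h3, h4]
    have h5 : 0 ≤ x ^ 2 * |x| := by positivity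
    norm_num [Nat.factorial]
    linarith
  · rw [min_eq_left hx.le]
    have h1 : ‖Complex.exp (x * Complex.I)‖ = 1 := Complex.norm_exp_ofReal_mul_I x
    have h2 : ‖(1 : ℂ) + x * Complex.I - x ^ 2 / 2‖ ≤ 1 + |x| + x ^ 2 / 2 := by
      refine (norm_sub_le _ _).trans (add_le_add ((norm_add_le _ _).trans ?_) ?_)
      · simp
      · simp
    have h3 : |x| ≤ x ^ 2 := by rw [← sq_abs]; nlinarith
    have h4 := norm_sub_le (Complex.exp (x * Complex.I)) (1 + x * Complex.I - x ^ 2 / 2)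
    linarith

lemma norm_prod_sub_prod_le {ι : Type*} (s : Finset ι) {z w : ι → ℂ} (hz : ∀ i ∈ s, ‖z i‖ ≤ 1)
    (hw : ∀ i ∈ s, ‖w i‖ ≤ 1) : ‖∏ i ∈ s, z i - ∏ i ∈ s, w i‖ ≤ ∑ i ∈ s, ‖z i - w i‖ := by
  classical
  induction s using Finset.induction_on with
  | empty => simp
  | insert a s ha ih =>
    rw [Finset.prod_insert ha, Finset.prod_insert ha, Finset.sum_insert ha]
    have h1 : z a * ∏ i ∈ s, z i - w a * ∏ i ∈ s, w i =
        (z a - w a) * ∏ i ∈ s, z i + w a * (∏ i ∈ s, z i - ∏ i ∈ s, w i) := by ring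
    rw [h1]
    refine (norm_add_le _ _).trans (add_le_add ?_ ?_)
    · rw [norm_mul]
      refine mul_le_of_le_one_right (norm_nonneg _) ?_
      rw [norm_prod]
      exact Finset.prod_le_one (fun _ _ => norm_nonneg _)
        fun i hi => hz i (Finset.mem_insert_of_mem hi)
    · rw [norm_mul]
      exact (mul_le_of_le_one_left (norm_nonneg _) (hw a (Finset.mem_insert_self _ _))).trans
        (ih (fun i hi => hz i (Finset.mem_insert_of_mem hi))
          fun i hi => hw i (Finset.mem_insert_of_mem hi))

lemma abs_exp_neg_sub_le {q : ℝ} (hq : 0 ≤ q) : |Real.exp (-q) - (1 - q)| ≤ q ^ 2 := by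
  have h1 := Real.add_one_le_exp (-q)
  rw [abs_of_nonneg (by linarith)]
  rcases le_or_gt q 1 with h | h
  · have h2 := Real.abs_exp_sub_one_sub_id_le (x := -q) (by rwa [abs_neg, abs_of_nonneg hq])
    have h3 := (abs_le.1 h2).2
    nlinarith
  · have : Real.exp (-q) ≤ 1 := Real.exp_le_one_iff.2 (by linarith)
    nlinarith

variable {P : Measure 𝒴} [IsProbabilityMeasure P]

lemma integrable_exp_mul_I {X : Type*} [MeasurableSpace X] {μ : Measure X} [IsFiniteMeasure μ]
    {v : X → ℝ} (hv : AEMeasurable v μ) :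
    Integrable (fun x => Complex.exp (v x * Complex.I)) μ :=
  Integrable.of_bound (by fun_prop) 1 (.of_forall fun x => (Complex.norm_exp_ofReal_mul_I _).le)

lemma norm_integral_exp_mul_I_le {X : Type*} [MeasurableSpace X] {μ : Measure X}
    [IsProbabilityMeasure μ] (v : X → ℝ) : ‖∫ x, Complex.exp (v x * Complex.I) ∂μ‖ ≤ 1 := by
  refine (norm_integral_le_of_norm_le_const (C := 1) (.of_forall fun x => ?_)).trans (by simp)
  exact (Complex.norm_exp_ofReal_mul_I _).le

lemma norm_integral_exp_sub_le {v : 𝒴 → ℝ} (hv : MemLp v 2 P) (h0 : ∫ y, v y ∂P = 0) :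
    ‖∫ y, Complex.exp (v y * Complex.I) ∂P - Complex.exp (-(∫ y, v y ^ 2 ∂P) / 2)‖ ≤
      4 * ∫ y, v y ^ 2 * min 1 |v y| ∂P + (∫ y, v y ^ 2 ∂P) ^ 2 / 4 := by
  have hv1 : Integrable v P := hv.integrable (by norm_num)
  have hv2 : Integrable (fun y => v y ^ 2) P := hv.integrable_sq
  have hvm := hv.aestronglyMeasurable.aemeasurable
  have hi1 : Integrable (fun y => (v y : ℂ) * Complex.I) P := hv1.ofReal.mul_const _
  have hi2 : Integrable (fun y => (v y : ℂ) ^ 2 / 2) P := by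
    have := (hv2.ofReal (𝕜 := ℂ)).div_const 2
    simpa using this
  have hi3 : Integrable (fun y => 1 + (v y : ℂ) * Complex.I - (v y : ℂ) ^ 2 / 2) P :=
    ((integrable_const _).add hi1).sub hi2
  have hT : ∫ y, (1 + (v y : ℂ) * Complex.I - (v y : ℂ) ^ 2 / 2) ∂P =
      1 - ((∫ y, v y ^ 2 ∂P : ℝ) : ℂ) / 2 := by
    rw [integral_sub ((integrable_const _).fun_add hi1) hi2, integral_add (integrable_const _) hi1,
      integral_mul_const, integral_complex_ofReal, h0, integral_div]
    have : ∫ y, (v y : ℂ) ^ 2 ∂P = ((∫ y, v y ^ 2 ∂P : ℝ) : ℂ) := by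
      rw [← integral_complex_ofReal]; simp
    simp [this]
  have hmin : Integrable (fun y => v y ^ 2 * min 1 |v y|) P := by
    refine hv2.mono' (by fun_prop) (.of_forall fun y => ?_)
    rw [Real.norm_eq_abs, abs_of_nonneg (by positivity)]
    exact mul_le_of_le_one_right (sq_nonneg _) (min_le_left _ _)
  have h1 : ‖∫ y, Complex.exp (v y * Complex.I) ∂P - (1 - ((∫ y, v y ^ 2 ∂P : ℝ) : ℂ) / 2)‖ ≤
      4 * ∫ y, v y ^ 2 * min 1 |v y| ∂P := by
    rw [← hT, ← integral_sub (integrable_exp_mul_I hvm) hi3,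
      ← integral_const_mul]
    exact norm_integral_le_of_norm_le (hmin.const_mul 4)
      (.of_forall fun y => norm_exp_mul_I_sub_taylor_le _)
  have h2 : ‖(1 - ((∫ y, v y ^ 2 ∂P : ℝ) : ℂ) / 2) -
      Complex.exp (-(∫ y, v y ^ 2 ∂P : ℝ) / 2)‖ ≤ (∫ y, v y ^ 2 ∂P) ^ 2 / 4 := by
    have hq : 0 ≤ (∫ y, v y ^ 2 ∂P) / 2 := by positivity
    have := abs_exp_neg_sub_le hq
    rw [norm_sub_rev]
    have h3 : Complex.exp (-(∫ y, v y ^ 2 ∂P : ℝ) / 2) - (1 - ((∫ y, v y ^ 2 ∂P : ℝ) : ℂ) / 2) =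
        ((Real.exp (-((∫ y, v y ^ 2 ∂P) / 2)) - (1 - (∫ y, v y ^ 2 ∂P) / 2) : ℝ) : ℂ) := by
      push_cast; ring_nf
    rw [h3, Complex.norm_real, Real.norm_eq_abs]
    refine this.trans (le_of_eq (by ring))
  exact (norm_sub_le_norm_sub_add_norm_sub _ _ _).trans (add_le_add h1 h2)

/-- A uniform Lindeberg estimate. The error is relative to a² + b², so that over an array of
coefficients it adds up to ε times the sum of squares, provided that the largest coefficient is
small. -/
lemma exists_norm_integral_exp_sub_le {g h : 𝒴 → ℝ} (hg : MemLp g 2 P) (hh : MemLp h 2 P)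
    (hg0 : ∫ y, g y ∂P = 0) (hh0 : ∫ y, h y ∂P = 0) {ε : ℝ} (hε : 0 < ε) :
    ∃ r : ℝ, 0 < r ∧ ∀ a b : ℝ, |a| ≤ r → |b| ≤ r →
      ‖∫ y, Complex.exp ((a * g y + b * h y : ℝ) * Complex.I) ∂P -
        Complex.exp (-(∫ y, (a * g y + b * h y) ^ 2 ∂P) / 2)‖ ≤ ε * (a ^ 2 + b ^ 2) := by
  -- The envelope satisfies |a g + b h| ≤ r G, so all errors are governed by `κ` below, which tends
  -- to 0 with r by dominated convergence with the integrable bound G².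
  let G : 𝒴 → ℝ := fun y => |g y| + |h y|
  have hG : MemLp G 2 P := hg.abs.add hh.abs
  have hG2 : Integrable (fun y => G y ^ 2) P := hG.integrable_sq
  have hGm : AEMeasurable G P := hG.aestronglyMeasurable.aemeasurable
  have hG0 : ∀ y, 0 ≤ G y := fun y => by positivity
  let κ : ℝ → ℝ := fun r => 4 * ∫ y, G y ^ 2 * min 1 (r * G y) ∂P +
    r ^ 2 * (∫ y, G y ^ 2 ∂P) ^ 2
  have hκ : Tendsto κ (𝓝[>] 0) (𝓝 0) := by
    have h1 : Tendsto (fun r => ∫ y, G y ^ 2 * min 1 (r * G y) ∂P) (𝓝[>] 0)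
        (𝓝 (∫ y, G y ^ 2 * min 1 (0 * G y) ∂P)) := by
      refine tendsto_integral_filter_of_dominated_convergence (fun y => G y ^ 2)
        (.of_forall fun r => by fun_prop) ?_ hG2 (.of_forall fun y => ?_)
      · filter_upwards [self_mem_nhdsWithin] with r hr
        refine .of_forall fun y => ?_
        have : 0 ≤ r * G y := mul_nonneg (le_of_lt hr) (hG0 y)
        rw [Real.norm_eq_abs, abs_of_nonneg (by positivity)]
        exact mul_le_of_le_one_right (sq_nonneg _) (min_le_left _ _)
      · have hc : Continuous fun r : ℝ => G y ^ 2 * min 1 (r * G y) := by fun_prop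
        exact hc.continuousAt.mono_left nhdsWithin_le_nhds
    have h2 : Tendsto (fun r : ℝ => r ^ 2 * (∫ y, G y ^ 2 ∂P) ^ 2) (𝓝[>] 0)
        (𝓝 (0 ^ 2 * (∫ y, G y ^ 2 ∂P) ^ 2)) := by
      have hc : Continuous fun r : ℝ => r ^ 2 * (∫ y, G y ^ 2 ∂P) ^ 2 := by fun_prop
      exact hc.continuousAt.mono_left nhdsWithin_le_nhds
    have := (h1.const_mul 4).add h2
    simpa using this
  obtain ⟨r, hr, hr0⟩ := ((hκ.eventually (gt_mem_nhds hε)).and self_mem_nhdsWithin).exists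
  have hr0 : 0 < r := hr0
  refine ⟨r, hr0, fun a b ha hb => ?_⟩
  have hv : MemLp (fun y => a * g y + b * h y) 2 P := (hg.const_mul a).add (hh.const_mul b)
  have hv0 : ∫ y, (a * g y + b * h y) ∂P = 0 := by
    rw [integral_add ((hg.integrable (by norm_num)).const_mul a)
      ((hh.integrable (by norm_num)).const_mul b), integral_const_mul, integral_const_mul, hg0, hh0]
    simp
  have hvabs : ∀ y, |a * g y + b * h y| ≤ r * G y := fun y => by
    calc |a * g y + b * h y| ≤ |a| * |g y| + |b| * |h y| := by
          rw [← abs_mul, ← abs_mul]; exact abs_add_le _ _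
      _ ≤ r * |g y| + r * |h y| := by gcongr
      _ = r * G y := by simp only [G]; ring
  have hvsq : ∀ y, (a * g y + b * h y) ^ 2 ≤ (a ^ 2 + b ^ 2) * G y ^ 2 := fun y => by
    have h1 : G y ^ 2 = g y ^ 2 + h y ^ 2 + 2 * (|g y| * |h y|) := by
      simp only [G]; rw [add_sq, sq_abs, sq_abs]; ring
    have h2 : 0 ≤ |g y| * |h y| := by positivity
    nlinarith [sq_nonneg (a * h y - b * g y), mul_nonneg (add_nonneg (sq_nonneg a) (sq_nonneg b)) h2]
  have hGmin : Integrable (fun y => G y ^ 2 * min 1 (r * G y)) P := by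
    refine hG2.mono' (by fun_prop) (.of_forall fun y => ?_)
    have : 0 ≤ r * G y := mul_nonneg hr0.le (hG0 y)
    rw [Real.norm_eq_abs, abs_of_nonneg (by positivity)]
    exact mul_le_of_le_one_right (sq_nonneg _) (min_le_left _ _)
  have hi1 : ∫ y, (a * g y + b * h y) ^ 2 * min 1 |a * g y + b * h y| ∂P ≤
      (a ^ 2 + b ^ 2) * ∫ y, G y ^ 2 * min 1 (r * G y) ∂P := by
    rw [← integral_const_mul]
    refine integral_mono_of_nonneg (.of_forall fun y => by positivity) (hGmin.const_mul _)
      (.of_forall fun y => ?_)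
    dsimp only
    rw [← mul_assoc]
    have := hvabs y
    exact mul_le_mul (hvsq y) (min_le_min le_rfl this) (by positivity) (by positivity)
  have hi2 : ∫ y, (a * g y + b * h y) ^ 2 ∂P ≤ (a ^ 2 + b ^ 2) * ∫ y, G y ^ 2 ∂P := by
    rw [← integral_const_mul]
    exact integral_mono hv.integrable_sq (hG2.const_mul _) hvsq
  have hab : a ^ 2 + b ^ 2 ≤ 2 * r ^ 2 := by
    have h1 := sq_le_sq' (abs_le.1 ha).1 (abs_le.1 ha).2
    have h2 := sq_le_sq' (abs_le.1 hb).1 (abs_le.1 hb).2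
    linarith
  have hI : 0 ≤ ∫ y, G y ^ 2 ∂P := integral_nonneg fun y => sq_nonneg _
  have hq0 : 0 ≤ ∫ y, (a * g y + b * h y) ^ 2 ∂P := integral_nonneg fun y => sq_nonneg _
  refine (norm_integral_exp_sub_le hv hv0).trans ?_
  have hsq : (∫ y, (a * g y + b * h y) ^ 2 ∂P) ^ 2 / 4 ≤
      (a ^ 2 + b ^ 2) * (r ^ 2 * (∫ y, G y ^ 2 ∂P) ^ 2) := by
    have h1 : (∫ y, (a * g y + b * h y) ^ 2 ∂P) ^ 2 ≤ ((a ^ 2 + b ^ 2) * ∫ y, G y ^ 2 ∂P) ^ 2 :=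
      pow_le_pow_left₀ hq0 hi2 2
    have h2 : ((a ^ 2 + b ^ 2) * ∫ y, G y ^ 2 ∂P) ^ 2 ≤
        (a ^ 2 + b ^ 2) * (2 * r ^ 2) * (∫ y, G y ^ 2 ∂P) ^ 2 := by
      rw [mul_pow, sq (a ^ 2 + b ^ 2)]
      gcongr
    have h3 : 0 ≤ (a ^ 2 + b ^ 2) * (r ^ 2 * (∫ y, G y ^ 2 ∂P) ^ 2) := by positivity
    linarith
  calc _ ≤ 4 * ((a ^ 2 + b ^ 2) * ∫ y, G y ^ 2 * min 1 (r * G y) ∂P) +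
        (a ^ 2 + b ^ 2) * (r ^ 2 * (∫ y, G y ^ 2 ∂P) ^ 2) := by gcongr
    _ = (a ^ 2 + b ^ 2) * κ r := by simp only [κ]; ring
    _ ≤ ε * (a ^ 2 + b ^ 2) := by
      rw [mul_comm]
      gcongr

/-- Independence of the observations factorizes both sides, and a telescoping sum compares the
products. Two coefficient vectors are carried along because two bootstrap draws act on the same
observations. -/
lemma exists_norm_integral_exp_sum_sub_le {g h : 𝒴 → ℝ} (hg : MemLp g 2 P) (hh : MemLp h 2 P)
    (hg0 : ∫ y, g y ∂P = 0) (hh0 : ∫ y, h y ∂P = 0) {ε : ℝ} (hε : 0 < ε) :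
    ∃ r : ℝ, 0 < r ∧ ∀ (n : ℕ) (a b : Fin n → ℝ), (∀ i, |a i| ≤ r) → (∀ i, |b i| ≤ r) →
      ‖∫ x : Fin n → 𝒴, Complex.exp ((∑ i, (a i * g (x i) + b i * h (x i)) : ℝ) * Complex.I)
          ∂(Measure.pi fun _ => P) -
        Complex.exp (-((∑ i, a i ^ 2) * ∫ y, g y ^ 2 ∂P + 2 * (∑ i, a i * b i) * ∫ y, g y * h y ∂P +
          (∑ i, b i ^ 2) * ∫ y, h y ^ 2 ∂P : ℝ) / 2)‖ ≤ ε * ∑ i, (a i ^ 2 + b i ^ 2) := by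
  obtain ⟨r, hr, H⟩ := exists_norm_integral_exp_sub_le hg hh hg0 hh0 hε
  refine ⟨r, hr, fun n a b ha hb => ?_⟩
  have h1 : ∫ x : Fin n → 𝒴, Complex.exp ((∑ i, (a i * g (x i) + b i * h (x i)) : ℝ) * Complex.I)
      ∂(Measure.pi fun _ => P) =
      ∏ i, ∫ y, Complex.exp ((a i * g y + b i * h y : ℝ) * Complex.I) ∂P := by
    rw [← integral_fintype_prod_eq_prod
      (f := fun i y => Complex.exp ((a i * g y + b i * h y : ℝ) * Complex.I))]
    refine integral_congr_ae (.of_forall fun x => ?_)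
    dsimp only
    rw [← Complex.exp_sum, ← Finset.sum_mul]
    push_cast
    rfl
  have hgg := hg.integrable_sq
  have hhh := hh.integrable_sq
  have hgh : Integrable (fun y => g y * h y) P := hg.integrable_mul hh
  have hq : ∀ i, ∫ y, (a i * g y + b i * h y) ^ 2 ∂P = a i ^ 2 * ∫ y, g y ^ 2 ∂P +
      2 * (a i * b i) * ∫ y, g y * h y ∂P + b i ^ 2 * ∫ y, h y ^ 2 ∂P := by
    intro i
    rw [← integral_const_mul, ← integral_const_mul, ← integral_const_mul,
      ← integral_add (hgg.const_mul _) (hgh.const_mul _),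
      ← integral_add ((hgg.const_mul _).fun_add (hgh.const_mul _)) (hhh.const_mul _)]
    exact integral_congr_ae (.of_forall fun y => by dsimp only; ring)
  have h2 : Complex.exp (-((∑ i, a i ^ 2) * ∫ y, g y ^ 2 ∂P +
      2 * (∑ i, a i * b i) * ∫ y, g y * h y ∂P +
      (∑ i, b i ^ 2) * ∫ y, h y ^ 2 ∂P : ℝ) / 2) =
      ∏ i, Complex.exp (-(∫ y, (a i * g y + b i * h y) ^ 2 ∂P : ℝ) / 2) := by
    rw [← Complex.exp_sum]
    congr 1
    rw [← Finset.sum_div, Finset.sum_neg_distrib, ← Complex.ofReal_sum]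
    simp_rw [hq, Finset.sum_add_distrib, ← Finset.sum_mul, ← Finset.mul_sum]
  rw [h1, h2, Finset.mul_sum]
  refine (norm_prod_sub_prod_le _ (fun i _ => norm_integral_exp_mul_I_le _) fun i _ => ?_).trans
    (Finset.sum_le_sum fun i _ => H (a i) (b i) (ha i) (hb i))
  rw [← Complex.ofReal_neg, ← Complex.ofReal_ofNat, ← Complex.ofReal_div, ← Complex.ofReal_exp,
    Complex.norm_real, Real.norm_eq_abs, abs_of_nonneg (Real.exp_nonneg _)]
  refine Real.exp_le_one_iff.2 ?_
  have : 0 ≤ ∫ y, (a i * g y + b i * h y) ^ 2 ∂P := integral_nonneg fun y => sq_nonneg _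
  linarith

end CharFun

/-! ### The central limit theorem for the empirical process at one function -/

section EmpiricalCharFun

variable {𝒴 : Type*} [MeasurableSpace 𝒴] {P : Measure 𝒴}

lemma sq_stdDev (h : 𝒴 → ℝ) : stdDev P h ^ 2 = ∫ y, (h y - ∫ z, h z ∂P) ^ 2 ∂P :=
  Real.sq_sqrt (integral_nonneg fun _ => sq_nonneg _)

lemma empDeviation_eq_sum {n : ℕ} (hn : 0 < n) (x : Fin n → 𝒴) (h : 𝒴 → ℝ) :
    empDeviation P n x h = ∑ i, (√n)⁻¹ * (h (x i) - ∫ z, h z ∂P) := by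
  have hn' : (0 : ℝ) < n := by exact_mod_cast hn
  have hs : √(n : ℝ) ≠ 0 := by positivity
  rw [empDeviation, ← Finset.mul_sum, Finset.sum_sub_distrib]
  simp only [Finset.sum_const, Finset.card_univ, Fintype.card_fin, nsmul_eq_mul]
  have h2 : √(n : ℝ) * √n = n := Real.mul_self_sqrt hn'.le
  field_simp
  rw [sq, h2]

variable [IsProbabilityMeasure P]

/-- The case of constant coefficients s_k / √n and no second function. The convergent multiplier s_k
serves to absorb the ratio √(n_a / n_b) of the two samples. -/
lemma tendsto_integral_exp_empDeviation {h : 𝒴 → ℝ} (hh : MemLp h 2 P) {ν : ℕ → ℕ}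
    (hν : Tendsto ν atTop atTop) {s : ℕ → ℝ} {S : ℝ} (hs : Tendsto s atTop (𝓝 S)) :
    Tendsto (fun k => ∫ x : Fin (ν k) → 𝒴,
      Complex.exp ((s k * empDeviation P (ν k) x h : ℝ) * Complex.I) ∂(Measure.pi fun _ => P)) atTop
      (𝓝 (Complex.exp (-(S ^ 2 * stdDev P h ^ 2 : ℝ) / 2))) := by
  have hh0 : MemLp (fun y => h y - ∫ z, h z ∂P) 2 P := hh.sub (memLp_const _)
  have hmean : ∫ y, (h y - ∫ z, h z ∂P) ∂P = 0 := by
    rw [integral_sub (hh.integrable (by norm_num)) (integrable_const _)]; simp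
  have hlim : Tendsto (fun k => Complex.exp (-(s k ^ 2 * stdDev P h ^ 2 : ℝ) / 2)) atTop
      (𝓝 (Complex.exp (-(S ^ 2 * stdDev P h ^ 2 : ℝ) / 2))) := by
    have hc : Continuous fun s : ℝ => Complex.exp (-(s ^ 2 * stdDev P h ^ 2 : ℝ) / 2) := by
      fun_prop
    exact (hc.tendsto S).comp hs
  refine (tendsto_iff_of_dist ?_).2 hlim
  rw [Metric.tendsto_nhds]
  intro ε hε
  obtain ⟨r, hr, H⟩ := exists_norm_integral_exp_sum_sub_le hh0 (MemLp.zero (p := 2) (μ := P)) hmean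
    (by simp) (ε := ε / (2 * (S ^ 2 + 1))) (by positivity)
  have hs2 : ∀ᶠ k in atTop, s k ^ 2 < S ^ 2 + 1 :=
    (hs.pow 2).eventually (gt_mem_nhds (by linarith))
  have hsmall : ∀ᶠ k in atTop, |s k * (√(ν k : ℝ))⁻¹| < r := by
    have h1 : Tendsto (fun k => |s k * (√(ν k : ℝ))⁻¹|) atTop (𝓝 |S * 0|) :=
      (hs.mul (tendsto_inv_atTop_zero.comp (Real.tendsto_sqrt_atTop.comp
        (tendsto_natCast_atTop_atTop.comp hν)))).abs
    exact h1.eventually (gt_mem_nhds (by simpa using hr))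
  filter_upwards [hs2, hsmall, hν.eventually_gt_atTop 0] with k hk1 hk2 hk3
  have hn' : (0 : ℝ) < ν k := by exact_mod_cast hk3
  have h1 := H (ν k) (fun _ => s k * (√(ν k : ℝ))⁻¹) (fun _ => 0) (fun _ => hk2.le)
    (fun _ => by simpa using hr.le)
  have h2 : ∑ _i : Fin (ν k), (s k * (√(ν k : ℝ))⁻¹) ^ 2 = s k ^ 2 := by
    rw [Finset.sum_const, Finset.card_univ, Fintype.card_fin, nsmul_eq_mul, mul_pow, inv_pow,
      Real.sq_sqrt hn'.le]
    field_simp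
  have h3 : ∀ x : Fin (ν k) → 𝒴, s k * empDeviation P (ν k) x h =
      ∑ i, (s k * (√(ν k : ℝ))⁻¹ * (h (x i) - ∫ z, h z ∂P) +
        0 * (0 : 𝒴 → ℝ) (x i)) := fun x => by
    rw [empDeviation_eq_sum hk3, Finset.mul_sum]
    simp [mul_assoc]
  rw [Real.dist_0_eq_abs, abs_of_nonneg dist_nonneg, dist_eq_norm]
  simp_rw [h3]
  simp only [h2, ← sq_stdDev, Finset.sum_add_distrib] at h1
  have h4 : ε / (2 * (S ^ 2 + 1)) * (s k ^ 2 + ∑ _i : Fin (ν k), (0 : ℝ) ^ 2) < ε := by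
    simp only [ne_eq, OfNat.ofNat_ne_zero, not_false_eq_true, zero_pow, Finset.sum_const_zero,
      add_zero]
    rw [div_mul_eq_mul_div, div_lt_iff₀ (by positivity)]
    nlinarith [sq_nonneg S]
  simp only [Finset.sum_add_distrib]
  refine lt_of_le_of_lt (le_trans (le_of_eq ?_) h1) h4
  simp

end EmpiricalCharFun

/-! ### Two independent vectors of exchangeable weights -/

section Weights

variable {Q : ∀ n : ℕ, Measure (Fin n → ℝ)} {c : ℝ}

lemma IsBootstrapWeightLaw.setIntegral_perm (hQ : IsBootstrapWeightLaw Q c) {n : ℕ}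
    {D : Set (Fin n → ℝ)} (hD : MeasurableSet D)
    (hDσ : ∀ (σ : Equiv.Perm (Fin n)) w, (fun i => w (σ i)) ∈ D ↔ w ∈ D)
    (σ : Equiv.Perm (Fin n)) (i j : Fin n) :
    ∫ w in D, (w (σ i) - weightMean w) * (w (σ j) - weightMean w) ∂(Q n) =
      ∫ w in D, (w i - weightMean w) * (w j - weightMean w) ∂(Q n) := by
  have hm : Measurable fun (w : Fin n → ℝ) i => w (σ i) := by fun_prop
  have hF : Measurable fun w : Fin n → ℝ => (w i - weightMean w) * (w j - weightMean w) :=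
    ((measurable_pi_apply i).comp (measurable_sub_weightMean n)).mul
      ((measurable_pi_apply j).comp (measurable_sub_weightMean n))
  conv_rhs => rw [← hQ.exchangeable n σ]
  rw [setIntegral_map hD hF.aestronglyMeasurable hm.aemeasurable]
  have : (fun (w : Fin n → ℝ) i => w (σ i)) ⁻¹' D = D := by
    ext w; exact hDσ σ w
  rw [this]
  simp_rw [weightMean_comp_perm]

/-- Exchangeability leaves the centred weights only two distinct second moments, and their zero sum
ties these together. Hence a linear combination with a fixed vector u of zero sum has second moment
proportional to ∑ u_i², of order n, while the event asks for a square of order n². -/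
lemma IsBootstrapWeightLaw.measure_cross_le (hQ : IsBootstrapWeightLaw Q c) {n : ℕ} (hn : 2 ≤ n)
    {K : ℝ} {u : Fin n → ℝ} (hu0 : ∑ i, u i = 0) (hu : (∑ i, u i ^ 2) / n ≤ K) {ε : ℝ}
    (hε : 0 < ε) :
    Q n {w | (∑ i, (w i - weightMean w) ^ 2) / n ≤ K ∧
        ε < |(∑ i, u i * (w i - weightMean w)) / n|} ≤
      ENNReal.ofReal (2 * K ^ 2 / (n * ε ^ 2)) := by
  classical
  have := hQ.isProbability n
  have hn0 : (0 : ℝ) < n := by exact_mod_cast (by omega : 0 < n)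
  have hn2 : (2 : ℝ) ≤ n := by exact_mod_cast hn
  let ξ : (Fin n → ℝ) → Fin n → ℝ := fun w i => w i - weightMean w
  have hξ : ∀ i, Measurable fun w => ξ w i := fun i =>
    (measurable_pi_apply i).comp (measurable_sub_weightMean n)
  -- On this set all products of centred weights are bounded, hence integrable; being invariant
  -- under permutations, it preserves exchangeability.
  let D : Set (Fin n → ℝ) := {w | (∑ i, ξ w i ^ 2) / n ≤ K}
  have hD : MeasurableSet D :=
    measurableSet_le ((Finset.measurable_sum _ fun i _ => (hξ i).pow_const 2).div_const _)
      measurable_const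
  have hDσ : ∀ (σ : Equiv.Perm (Fin n)) w, (fun i => w (σ i)) ∈ D ↔ w ∈ D := fun σ w => by
    simp only [D, ξ, Set.mem_ofPred_eq, weightMean_comp_perm]
    rw [Equiv.sum_comp σ fun i => (w i - weightMean w) ^ 2]
  have hDsum : ∀ w ∈ D, ∑ i, ξ w i ^ 2 ≤ n * K := fun w hw => by
    rwa [mul_comm, ← div_le_iff₀ hn0]
  have hK : 0 ≤ K := le_trans (by positivity) hu
  let m : Fin n → Fin n → ℝ := fun i j => ∫ w in D, ξ w i * ξ w j ∂(Q n)
  have hint : ∀ i j, Integrable (fun w => ξ w i * ξ w j) ((Q n).restrict D) := fun i j => by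
    refine Integrable.of_bound ((hξ i).mul (hξ j)).aestronglyMeasurable (n * K) ?_
    refine (ae_restrict_iff' hD).2 (.of_forall fun w hw => ?_)
    have h1 : ξ w i ^ 2 ≤ n * K :=
      (Finset.single_le_sum (f := fun i => ξ w i ^ 2) (fun _ _ => sq_nonneg _)
        (Finset.mem_univ i)).trans (hDsum w hw)
    have h2 : ξ w j ^ 2 ≤ n * K :=
      (Finset.single_le_sum (f := fun i => ξ w i ^ 2) (fun _ _ => sq_nonneg _)
        (Finset.mem_univ j)).trans (hDsum w hw)
    rw [Real.norm_eq_abs, abs_le]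
    constructor <;> nlinarith [sq_nonneg (ξ w i + ξ w j), sq_nonneg (ξ w i - ξ w j)]
  have hperm : ∀ (σ : Equiv.Perm (Fin n)) i j, m (σ i) (σ j) = m i j :=
    fun σ i j => hQ.setIntegral_perm hD hDσ σ i j
  have hrow : ∀ i, ∑ j, m i j = 0 := fun i => by
    simp only [m]
    rw [← integral_finsetSum _ fun j _ => hint i j]
    simp only [← Finset.mul_sum]
    have : ∀ w, ∑ j, ξ w j = 0 := fun w => sum_sub_weightMean w
    simp [this]
  let i₀ : Fin n := ⟨0, by omega⟩
  set γ : ℝ := m i₀ i₀ with hγ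
  have hdiag : ∀ i, m i i = γ := fun i => by
    have := hperm (Equiv.swap i i₀) i i
    rw [Equiv.swap_apply_left] at this
    exact this.symm
  have hγ0 : 0 ≤ γ := integral_nonneg fun w => mul_self_nonneg _
  have hγK : γ ≤ K := by
    have h1 : ∑ i, m i i ≤ n * K := by
      simp only [m]
      rw [← integral_finsetSum _ fun i _ => hint i i]
      calc ∫ w in D, ∑ i, ξ w i * ξ w i ∂(Q n) ≤ ∫ _ in D, n * K ∂(Q n) := by
            refine setIntegral_mono_on (integrable_finsetSum _ fun i _ => hint i i)
              (integrable_const _) hD fun w hw => ?_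
            simpa [sq] using hDsum w hw
        _ ≤ n * K := by
            rw [setIntegral_const, smul_eq_mul]
            exact mul_le_of_le_one_left (by positivity) measureReal_le_one
    simp only [hdiag, Finset.sum_const, Finset.card_univ, Fintype.card_fin, nsmul_eq_mul] at h1
    exact le_of_mul_le_mul_left h1 hn0
  -- Each row of the moment matrix sums to zero because the centred weights do, and its n − 1
  -- off-diagonal entries coincide.
  have hoff : ∀ i j, i ≠ j → m i j = -γ / (n - 1) := fun i j hij => by
    have h1 : ∀ j', j' ≠ i → m i j' = m i j := fun j' hj' => by
      have := hperm (Equiv.swap j j') i j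
      rwa [Equiv.swap_apply_of_ne_of_ne hij hj'.symm, Equiv.swap_apply_left] at this
    have h2 := hrow i
    rw [← Finset.add_sum_erase _ _ (Finset.mem_univ i), hdiag,
      Finset.sum_congr rfl fun j' hj' => h1 j' (Finset.ne_of_mem_erase hj')] at h2
    simp only [Finset.sum_const, Finset.card_erase_of_mem (Finset.mem_univ i), Finset.card_univ,
      Fintype.card_fin, nsmul_eq_mul, Nat.cast_sub (show 1 ≤ n by omega), Nat.cast_one] at h2
    rw [eq_div_iff (by linarith)]
    linarith
  set β : ℝ := -γ / (n - 1) with hβ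
  have hβγ : γ - β ≤ 2 * K := by
    have : γ / (n - 1) ≤ γ := div_le_self hγ0 (by linarith)
    rw [hβ, neg_div]
    linarith
  -- The moment matrix is (γ − β) times the identity plus a constant matrix β, and the latter
  -- annihilates vectors of zero sum.
  have hquad : ∫ w in D, (∑ i, u i * ξ w i) ^ 2 ∂(Q n) = (γ - β) * ∑ i, u i ^ 2 := by
    have h1 : ∀ w, (∑ i, u i * ξ w i) ^ 2 = ∑ i, ∑ j, u i * u j * (ξ w i * ξ w j) := fun w => by
      rw [sq, Finset.sum_mul_sum]
      exact Finset.sum_congr rfl fun i _ => Finset.sum_congr rfl fun j _ => by ring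
    simp_rw [h1]
    rw [integral_finsetSum _ fun i _ => integrable_finsetSum _ fun j _ => (hint i j).const_mul _]
    simp_rw [integral_finsetSum Finset.univ fun j _ => (hint _ j).const_mul _, integral_const_mul]
    have h2 : ∀ i j, m i j = β + if i = j then γ - β else 0 := fun i j => by
      by_cases h : i = j
      · subst h; simp [hdiag]
      · simp [h, hoff i j h]
    have h3 : ∑ i, ∑ j, u i * u j * m i j = (γ - β) * ∑ i, u i ^ 2 + β * (∑ i, u i) ^ 2 := by
      simp_rw [h2, mul_add, Finset.sum_add_distrib, mul_ite, mul_zero, Finset.sum_ite_eq,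
        Finset.mem_univ, if_true]
      rw [sq (∑ i, u i), Finset.sum_mul_sum, Finset.mul_sum, Finset.mul_sum, add_comm]
      congr 1
      · exact Finset.sum_congr rfl fun i _ => by ring
      · refine Finset.sum_congr rfl fun i _ => ?_
        rw [Finset.mul_sum]
        exact Finset.sum_congr rfl fun j _ => by ring
    rw [hu0] at h3
    simpa using h3
  have hU : ∑ i, u i ^ 2 ≤ n * K := by rwa [mul_comm, ← div_le_iff₀ hn0]
  have hle : ∫ w in D, (∑ i, u i * ξ w i) ^ 2 ∂(Q n) ≤ 2 * K ^ 2 * n := by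
    rw [hquad]
    calc _ ≤ 2 * K * (n * K) := by
          refine mul_le_mul hβγ hU (by positivity) (by positivity)
      _ = _ := by ring
  have hsqint : Integrable (fun w => (∑ i, u i * ξ w i) ^ 2) ((Q n).restrict D) := by
    have h1 : ∀ w, (∑ i, u i * ξ w i) ^ 2 = ∑ i, ∑ j, u i * u j * (ξ w i * ξ w j) := fun w => by
      rw [sq, Finset.sum_mul_sum]
      exact Finset.sum_congr rfl fun i _ => Finset.sum_congr rfl fun j _ => by ring
    simp_rw [h1]
    exact integrable_finsetSum _ fun i _ => integrable_finsetSum _ fun j _ => (hint i j).const_mul _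
  have hmarkov := mul_meas_ge_le_integral_of_nonneg (μ := (Q n).restrict D)
    (.of_forall fun w => sq_nonneg (∑ i, u i * ξ w i)) hsqint ((n * ε) ^ 2)
  have hmset : MeasurableSet {w | (n * ε) ^ 2 ≤ (∑ i, u i * ξ w i) ^ 2} :=
    measurableSet_le measurable_const
      ((Finset.measurable_sum _ fun i _ => (hξ i).const_mul _).pow_const 2)
  have hreal : ((Q n).restrict D).real {w | (n * ε) ^ 2 ≤ (∑ i, u i * ξ w i) ^ 2} ≤
      2 * K ^ 2 / (n * ε ^ 2) := by
    rw [le_div_iff₀ (by positivity)]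
    have h1 := hmarkov.trans hle
    have h2 : (n * ε) ^ 2 = n * (n * ε ^ 2) := by ring
    rw [h2] at h1 ⊢
    nlinarith
  calc _ ≤ (Q n) ({w | (n * ε) ^ 2 ≤ (∑ i, u i * ξ w i) ^ 2} ∩ D) := by
        refine measure_mono fun w hw => ⟨?_, hw.1⟩
        have h1 : ε < |(∑ i, u i * ξ w i) / n| := hw.2
        rw [abs_div, abs_of_pos hn0, lt_div_iff₀ hn0] at h1
        show (n * ε) ^ 2 ≤ (∑ i, u i * ξ w i) ^ 2
        rw [← sq_abs (∑ i, u i * ξ w i)]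
        exact pow_le_pow_left₀ (by positivity) (by linarith) 2
    _ = ENNReal.ofReal (((Q n).restrict D).real {w | (n * ε) ^ 2 ≤ (∑ i, u i * ξ w i) ^ 2}) := by
        rw [ofReal_measureReal, Measure.restrict_apply hmset]
    _ ≤ _ := ENNReal.ofReal_le_ofReal hreal

lemma prod_measure_preimage_fst_le {X Y : Type*} [MeasurableSpace X] [MeasurableSpace Y]
    (μ : Measure X) (ν : Measure Y) [SFinite μ] [IsProbabilityMeasure ν] (s : Set X) :
    (μ.prod ν) (Prod.fst ⁻¹' s) ≤ μ s := by
  refine (Measure.le_map_apply measurable_fst.aemeasurable s).trans (le_of_eq ?_)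
  rw [measurePreserving_fst.map_eq]

lemma prod_measure_preimage_snd_le {X Y : Type*} [MeasurableSpace X] [MeasurableSpace Y]
    (μ : Measure X) (ν : Measure Y) [IsProbabilityMeasure μ] [SFinite ν] (s : Set Y) :
    (μ.prod ν) (Prod.snd ⁻¹' s) ≤ ν s := by
  refine (Measure.le_map_apply measurable_snd.aemeasurable s).trans (le_of_eq ?_)
  rw [measurePreserving_snd.map_eq]

/-- By Fubini, the first draw can be frozen and takes the role of u in `measure_cross_le`.
Convergence of the weight variances makes the truncation at K = c² + 1 harmless for both draws. -/
lemma IsBootstrapWeightLaw.tendsto_cross (hQ : IsBootstrapWeightLaw Q c) {ε : ℝ} (hε : 0 < ε) :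
    Tendsto (fun n => ((Q n).prod (Q n)) {p | ε <
      |(∑ i, (p.1 i - weightMean p.1) * (p.2 i - weightMean p.2)) / n|}) atTop (𝓝 0) := by
  let K : ℝ := c ^ 2 + 1
  have hV := hQ.variance_tendsto 1 one_pos
  have hlim : Tendsto (fun n : ℕ => Q n {w | 1 < |(∑ i, (w i - weightMean w) ^ 2) / n - c ^ 2|} +
      Q n {w | 1 < |(∑ i, (w i - weightMean w) ^ 2) / n - c ^ 2|} +
      ENNReal.ofReal (2 * K ^ 2 / (n * ε ^ 2))) atTop (𝓝 0) := by
    have h1 : Tendsto (fun n : ℕ => 2 * K ^ 2 / ((n : ℝ) * ε ^ 2)) atTop (𝓝 0) :=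
      tendsto_const_nhds.div_atTop
        (tendsto_natCast_atTop_atTop.atTop_mul_const (by positivity))
    have h2 := (hV.add hV).add (ENNReal.tendsto_ofReal h1)
    simpa using h2
  refine tendsto_of_tendsto_of_tendsto_of_le_of_le' tendsto_const_nhds hlim
    (.of_forall fun _ => zero_le) ?_
  filter_upwards [eventually_ge_atTop 2] with n hn
  have := hQ.isProbability n
  let ξ : (Fin n → ℝ) → Fin n → ℝ := fun w i => w i - weightMean w
  have hξ : ∀ i, Measurable fun w => ξ w i := fun i =>
    (measurable_pi_apply i).comp (measurable_sub_weightMean n)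
  let E : Set (Fin n → ℝ) := {w | 1 < |(∑ i, ξ w i ^ 2) / n - c ^ 2|}
  have hE : ∀ w, w ∉ E → (∑ i, ξ w i ^ 2) / n ≤ K := fun w hw => by
    have h1 : |(∑ i, ξ w i ^ 2) / n - c ^ 2| ≤ 1 := not_lt.1 hw
    have := (abs_le.1 h1).2
    simp only [K]; linarith
  let V : (Fin n → ℝ) → ℝ := fun w => (∑ i, ξ w i ^ 2) / n
  have hVm : Measurable V :=
    (Finset.measurable_sum _ fun i _ => (hξ i).pow_const 2).div_const _
  let A : Set ((Fin n → ℝ) × (Fin n → ℝ)) := {p | V p.1 ≤ K ∧ V p.2 ≤ K ∧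
    ε < |(∑ i, ξ p.1 i * ξ p.2 i) / n|}
  have hA : MeasurableSet A := by
    have h1 : Measurable fun p : (Fin n → ℝ) × (Fin n → ℝ) =>
        |(∑ i, ξ p.1 i * ξ p.2 i) / n| :=
      Measurable.abs (Measurable.div_const (Finset.measurable_sum _ fun i _ =>
        ((hξ i).comp measurable_fst).mul ((hξ i).comp measurable_snd)) _)
    exact (measurableSet_le (hVm.comp measurable_fst) measurable_const).inter
      ((measurableSet_le (hVm.comp measurable_snd) measurable_const).inter
      (measurableSet_lt measurable_const h1))
  have hAle : ((Q n).prod (Q n)) A ≤ ENNReal.ofReal (2 * K ^ 2 / (n * ε ^ 2)) := by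
    rw [Measure.prod_apply hA]
    refine (lintegral_mono (g := fun _ => ENNReal.ofReal (2 * K ^ 2 / (n * ε ^ 2)))
      fun w => ?_).trans (by simp)
    by_cases hw : V w ≤ K
    · refine (measure_mono fun w' hw' => ?_).trans
        (hQ.measure_cross_le hn (sum_sub_weightMean w) hw hε)
      exact hw'.2
    · have : Prod.mk w ⁻¹' A = ∅ := by
        ext w'
        simp only [Set.mem_preimage, Set.mem_empty_iff_false, iff_false]
        exact fun h => hw h.1
      simp [this]
  calc _ ≤ ((Q n).prod (Q n)) ((Prod.fst ⁻¹' E ∪ Prod.snd ⁻¹' E) ∪ A) := by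
        refine measure_mono fun p hp => ?_
        by_cases h1 : p.1 ∈ E
        · exact Or.inl (Or.inl h1)
        by_cases h2 : p.2 ∈ E
        · exact Or.inl (Or.inr h2)
        exact Or.inr ⟨hE _ h1, hE _ h2, hp⟩
    _ ≤ _ := by
        refine (measure_union_le _ _).trans (add_le_add ((measure_union_le _ _).trans
          (add_le_add (prod_measure_preimage_fst_le _ _ _) (prod_measure_preimage_snd_le _ _ _)))
          hAle)

lemma IsBootstrapWeightLaw.tendsto_max (hQ : IsBootstrapWeightLaw Q c) {r : ℝ} (hr : 0 < r) :
    Tendsto (fun n => Q n {w | ∃ i, r * √n < |w i - weightMean w|}) atTop (𝓝 0) := by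
  have h := ENNReal.Tendsto.const_mul (a := (ENNReal.ofReal r)⁻¹) hQ.max_negligible
    (Or.inr (by simpa using hr))
  rw [mul_zero] at h
  refine tendsto_of_tendsto_of_tendsto_of_le_of_le' tendsto_const_nhds h
    (.of_forall fun _ => zero_le) ?_
  filter_upwards [eventually_gt_atTop 0] with n hn
  have hn0 : (0 : ℝ) < n := by exact_mod_cast hn
  have hm : Measurable fun w : Fin n → ℝ => ⨆ i, ‖w i - weightMean w‖ₑ := .iSup fun i =>
    ((measurable_pi_apply i).comp (measurable_sub_weightMean n)).enorm
  have hrn : ENNReal.ofReal (r * √n) ≠ 0 := by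
    rw [Ne, ENNReal.ofReal_eq_zero, not_le]; positivity
  calc _ ≤ Q n {w | ENNReal.ofReal (r * √n) ≤ ⨆ i, ‖w i - weightMean w‖ₑ} := by
        refine measure_mono ?_
        rintro w ⟨i, hi⟩
        refine le_trans ?_ (le_iSup (fun i => ‖w i - weightMean w‖ₑ) i)
        rw [Real.enorm_eq_ofReal_abs]
        exact ENNReal.ofReal_le_ofReal hi.le
    _ ≤ (∫⁻ w, ⨆ i, ‖w i - weightMean w‖ₑ ∂(Q n)) / ENNReal.ofReal (r * √n) :=
        meas_ge_le_lintegral_div hm.aemeasurable hrn ENNReal.ofReal_ne_top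
    _ = _ := by
        rw [ENNReal.ofReal_mul hr.le, div_eq_mul_inv, div_eq_mul_inv,
          ENNReal.mul_inv (Or.inr ENNReal.ofReal_ne_top) (Or.inl ENNReal.ofReal_ne_top)]
        ring

end Weights

/-! ### The joint limit of the bootstrap sums of two draws -/

section BootstrapCharFun

variable {𝒴 : Type*}

/-- The centred and rescaled bootstrap sum `n^{-1/2} ∑ i, (w i - w̄) g (x i)`. -/
noncomputable def bootSum {n : ℕ} (w : Fin n → ℝ) (x : Fin n → 𝒴) (g : 𝒴 → ℝ) : ℝ :=
  (√(n : ℝ))⁻¹ * ∑ i, (w i - weightMean w) * g (x i)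

/-- Centred weights annihilate constants, so g may be assumed to have mean zero under P. -/
lemma bootSum_sub_const {n : ℕ} (w : Fin n → ℝ) (x : Fin n → 𝒴) (g : 𝒴 → ℝ) (m : ℝ) :
    bootSum w x (fun y => g y - m) = bootSum w x g := by
  simp only [bootSum, mul_sub, Finset.sum_sub_distrib]
  rw [← Finset.sum_mul, sum_sub_weightMean]
  simp

/-- On the exceptional set the integrand differs from L by at most 2; as that set may fail to be
measurable, its measurable hull is used. -/
lemma norm_integral_sub_le_of_measure {X : Type*} [MeasurableSpace X] {μ : Measure X}
    [IsProbabilityMeasure μ] {f : X → ℂ} (hf : AEStronglyMeasurable f μ) (hf1 : ∀ x, ‖f x‖ ≤ 1)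
    {L : ℂ} (hL : ‖L‖ ≤ 1) {ε : ℝ} (hε0 : 0 ≤ ε) {A : Set X} (hA : ∀ x ∉ A, ‖f x - L‖ ≤ ε)
    {η : ℝ} (hη : 0 ≤ η) (hμA : μ A ≤ ENNReal.ofReal η) : ‖∫ x, f x ∂μ - L‖ ≤ ε + 2 * η := by
  let B := toMeasurable μ A
  have hBm : MeasurableSet B := measurableSet_toMeasurable μ A
  have hint : Integrable f μ := Integrable.of_bound hf 1 (.of_forall hf1)
  have h2 : ∫ x, f x ∂μ - L = ∫ x, (f x - L) ∂μ := by
    rw [integral_sub hint (integrable_const _)]; simp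
  have hε : μ.real B ≤ η := by
    rw [measureReal_def, measure_toMeasurable]
    exact ENNReal.toReal_le_of_le_ofReal hη hμA
  rw [h2]
  refine (norm_integral_le_of_norm_le (g := fun x => ε + B.indicator (fun _ => 2) x)
    ((integrable_const _).add ((integrable_const _).indicator hBm))
    (.of_forall fun x => ?_)).trans ?_
  · by_cases hx : x ∈ B
    · rw [Set.indicator_of_mem hx]
      have := (norm_sub_le (f x) L).trans (add_le_add (hf1 x) hL)
      linarith
    · rw [Set.indicator_of_notMem hx, add_zero]
      exact hA x fun h => hx (subset_toMeasurable μ A h)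
  · rw [integral_add (integrable_const _) ((integrable_const _).indicator hBm),
      integral_indicator_const _ hBm]
    simp only [integral_const, probReal_univ, smul_eq_mul, one_mul]
    linarith

variable [MeasurableSpace 𝒴]

lemma measurable_bootSum {n : ℕ} {g : 𝒴 → ℝ} (hg : Measurable g) :
    Measurable fun p : (Fin n → ℝ) × (Fin n → 𝒴) => bootSum p.1 p.2 g := by
  unfold bootSum
  refine (Finset.measurable_sum _ fun i _ => ?_).const_mul _
  exact ((measurable_pi_apply i).comp ((measurable_sub_weightMean n).comp measurable_fst)).mul
    (hg.comp ((measurable_pi_apply i).comp measurable_snd))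

/-- The data are integrated out first. For frozen weights the sum is a sum of independent terms,
Lindeberg's condition is the negligibility of the largest weight, and the variance depends only on
the averages of ξ₁², ξ₂² and ξ₁ξ₂. These tend in probability to c², c² and 0; the vanishing cross
term is what splits the limit into a function of g and one of h. -/
theorem tendsto_integral_exp_bootSum {P : Measure 𝒴} [IsProbabilityMeasure P]
    {Q : ∀ n : ℕ, Measure (Fin n → ℝ)} {c : ℝ} (hQ : IsBootstrapWeightLaw Q c) {g h : 𝒴 → ℝ}
    (hgm : Measurable g) (hhm : Measurable h) (hg : MemLp g 2 P) (hh : MemLp h 2 P) {ν : ℕ → ℕ}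
    (hν : Tendsto ν atTop atTop) {s : ℕ → ℝ} {S : ℝ} (hs : Tendsto s atTop (𝓝 S)) :
    Tendsto (fun k => ∫ p : ((Fin (ν k) → ℝ) × (Fin (ν k) → ℝ)) × (Fin (ν k) → 𝒴),
      Complex.exp ((s k * (bootSum p.1.1 p.2 g + bootSum p.1.2 p.2 h) : ℝ) * Complex.I)
        ∂(((Q (ν k)).prod (Q (ν k))).prod (Measure.pi fun _ => P))) atTop
      (𝓝 (Complex.exp (-(S ^ 2 * (c ^ 2 * (stdDev P g ^ 2 + stdDev P h ^ 2)) : ℝ) / 2))) := by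
  let g₀ : 𝒴 → ℝ := fun y => g y - ∫ z, g z ∂P
  let h₀ : 𝒴 → ℝ := fun y => h y - ∫ z, h z ∂P
  have hg₀ : MemLp g₀ 2 P := hg.sub (memLp_const _)
  have hh₀ : MemLp h₀ 2 P := hh.sub (memLp_const _)
  have hg₀m : ∫ y, g₀ y ∂P = 0 := by
    simp only [g₀]
    rw [integral_sub (hg.integrable (by norm_num)) (integrable_const _)]; simp
  have hh₀m : ∫ y, h₀ y ∂P = 0 := by
    simp only [h₀]
    rw [integral_sub (hh.integrable (by norm_num)) (integrable_const _)]; simp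
  set L : ℂ := Complex.exp (-(S ^ 2 * (c ^ 2 * (stdDev P g ^ 2 + stdDev P h ^ 2)) : ℝ) / 2) with hL
  have hexp1 : ∀ q : ℝ, 0 ≤ q → ‖Complex.exp (-(q : ℝ) / 2)‖ ≤ 1 := fun q hq => by
    rw [← Complex.ofReal_neg, ← Complex.ofReal_ofNat, ← Complex.ofReal_div, ← Complex.ofReal_exp,
      Complex.norm_real, Real.norm_eq_abs, abs_of_nonneg (Real.exp_nonneg _)]
    exact Real.exp_le_one_iff.2 (by linarith)
  have hL1 : ‖L‖ ≤ 1 := hexp1 _ (by positivity)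
  let C : ℝ := ∫ y, g₀ y * h₀ y ∂P
  -- The Gaussian characteristic function for frozen weights, as a continuous function of the
  -- multiplier and of the three averages just mentioned.
  let Φ : ℝ × ℝ × ℝ × ℝ → ℂ := fun q => Complex.exp (-(q.1 ^ 2 * (q.2.1 * stdDev P g ^ 2 +
    2 * q.2.2.2 * C + q.2.2.1 * stdDev P h ^ 2) : ℝ) / 2)
  have hΦ : Continuous Φ := by fun_prop
  have hΦL : Φ (S, c ^ 2, c ^ 2, 0) = L := by
    simp only [Φ, L]; congr 3; push_cast; ring
  rw [Metric.tendsto_nhds]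
  intro ε hε
  obtain ⟨ρ, hρ, hΦρ⟩ := Metric.continuousAt_iff.1 (hΦ.continuousAt (x := (S, c ^ 2, c ^ 2, 0)))
    (ε / 4) (by positivity)
  let ρ' : ℝ := min (ρ / 2) 1
  have hρ' : 0 < ρ' := by positivity
  let B : ℝ := (S ^ 2 + 1) * (2 * (c ^ 2 + 1))
  have hB : 0 < B := by positivity
  obtain ⟨r, hr, H⟩ := exists_norm_integral_exp_sum_sub_le hg₀ hh₀ hg₀m hh₀m
    (ε := ε / (4 * B)) (by positivity)
  let r' : ℝ := r / (|S| + 1)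
  have hr' : 0 < r' := by positivity
  -- The exceptional weights have mass at most 5η (two events for each draw and the cross term),
  -- which costs 2 · 5η = ε / 4 beyond the error ε / 2 elsewhere.
  let η : ℝ := ε / 40
  have hη : 0 < η := by positivity
  have hηpos : (0 : ℝ≥0∞) < ENNReal.ofReal η := by simpa using hη
  have hsS : ∀ᶠ k in atTop, |s k - S| < ρ' := by
    have := (tendsto_iff_dist_tendsto_zero.1 hs).eventually (gt_mem_nhds hρ')
    simpa [Real.dist_eq] using this
  have hs2 : ∀ᶠ k in atTop, s k ^ 2 < S ^ 2 + 1 :=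
    (hs.pow 2).eventually (gt_mem_nhds (by linarith))
  have hsabs : ∀ᶠ k in atTop, |s k| < |S| + 1 := hs.abs.eventually (gt_mem_nhds (by linarith))
  filter_upwards [hsS, hs2, hsabs, hν.eventually_gt_atTop 0,
    hν.eventually ((hQ.tendsto_max hr').eventually (gt_mem_nhds hηpos)),
    hν.eventually ((hQ.variance_tendsto (ρ' / 2) (by positivity)).eventually (gt_mem_nhds hηpos)),
    hν.eventually ((hQ.tendsto_cross (ε := ρ' / 2) (by positivity)).eventually
      (gt_mem_nhds hηpos))] with k hk1 hk2 hk3 hk4 hmax hvar hcross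
  generalize ν k = n at hk4 hmax hvar hcross ⊢
  generalize s k = t at hk1 hk2 hk3 ⊢
  have := hQ.isProbability n
  have hn0 : (0 : ℝ) < n := by exact_mod_cast hk4
  let ξ : (Fin n → ℝ) → Fin n → ℝ := fun w i => w i - weightMean w
  have hsum : Measurable fun p : ((Fin n → ℝ) × (Fin n → ℝ)) × (Fin n → 𝒴) =>
      t * (bootSum p.1.1 p.2 g + bootSum p.1.2 p.2 h) :=
    (((measurable_bootSum hgm).comp (measurable_fst.fst.prodMk measurable_snd)).add
      ((measurable_bootSum hhm).comp (measurable_fst.snd.prodMk measurable_snd))).const_mul t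
  have hint : Integrable (fun p : ((Fin n → ℝ) × (Fin n → ℝ)) × (Fin n → 𝒴) =>
      Complex.exp ((t * (bootSum p.1.1 p.2 g + bootSum p.1.2 p.2 h) : ℝ) * Complex.I))
      (((Q n).prod (Q n)).prod (Measure.pi fun _ => P)) := integrable_exp_mul_I hsum.aemeasurable
  rw [integral_prod _ hint, dist_eq_norm]
  let f : (Fin n → ℝ) × (Fin n → ℝ) → ℂ := fun w => ∫ x : Fin n → 𝒴,
    Complex.exp ((t * (bootSum w.1 x g + bootSum w.2 x h) : ℝ) * Complex.I)
      ∂(Measure.pi fun _ => P)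
  have hfm : AEStronglyMeasurable f ((Q n).prod (Q n)) := hint.1.integral_prod_right'
  let A₁ : Set (Fin n → ℝ) := {w | ∃ i, r' * √n < |w i - weightMean w|}
  let A₂ : Set (Fin n → ℝ) :=
    {w | ρ' / 2 < |(∑ i, (w i - weightMean w) ^ 2) / n - c ^ 2|}
  let A₃ : Set ((Fin n → ℝ) × (Fin n → ℝ)) := {p | ρ' / 2 <
    |(∑ i, (p.1 i - weightMean p.1) * (p.2 i - weightMean p.2)) / n|}
  let A : Set ((Fin n → ℝ) × (Fin n → ℝ)) := (Prod.fst ⁻¹' (A₁ ∪ A₂) ∪ Prod.snd ⁻¹' (A₁ ∪ A₂)) ∪ A₃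
  have hA12 : Q n (A₁ ∪ A₂) ≤ ENNReal.ofReal (2 * η) := by
    refine (measure_union_le _ _).trans ((add_le_add hmax.le hvar.le).trans (le_of_eq ?_))
    rw [← ENNReal.ofReal_add hη.le hη.le]; congr 1; ring
  have hμA : ((Q n).prod (Q n)) A ≤ ENNReal.ofReal (5 * η) := by
    refine (measure_union_le _ _).trans ((add_le_add ((measure_union_le _ _).trans (add_le_add
      ((prod_measure_preimage_fst_le _ _ _).trans hA12)
      ((prod_measure_preimage_snd_le _ _ _).trans hA12))) hcross.le).trans (le_of_eq ?_))
    rw [← ENNReal.ofReal_add (by positivity) (by positivity),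
      ← ENNReal.ofReal_add (by positivity) (by positivity)]
    congr 1; ring
  have hclose : ∀ w ∉ A, ‖f w - L‖ ≤ ε / 2 := by
    intro w hw
    simp only [A, A₁, A₂, A₃, Set.mem_union, Set.mem_preimage, Set.mem_ofPred_eq, not_or,
      not_exists, not_lt] at hw
    obtain ⟨⟨⟨hm1, hv1⟩, hm2, hv2⟩, hc⟩ := hw
    let a : Fin n → ℝ := fun i => t * (√n)⁻¹ * ξ w.1 i
    let b : Fin n → ℝ := fun i => t * (√n)⁻¹ * ξ w.2 i
    have hbd : ∀ x : ℝ, |x| ≤ r' * √n → |t * (√n)⁻¹ * x| ≤ r := fun x hx => by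
      rw [abs_mul, abs_mul, abs_of_pos (show 0 < (√(n : ℝ))⁻¹ by positivity)]
      calc |t| * (√n)⁻¹ * |x| ≤ (|S| + 1) * (√n)⁻¹ * (r' * √n) := by gcongr
        _ = r := by simp only [r']; field_simp
    have hfw : f w = ∫ x : Fin n → 𝒴,
        Complex.exp ((∑ i, (a i * g₀ (x i) + b i * h₀ (x i)) : ℝ) * Complex.I)
          ∂(Measure.pi fun _ => P) := by
      refine integral_congr_ae (.of_forall fun x => ?_)
      dsimp only
      rw [← bootSum_sub_const w.1 x g (∫ z, g z ∂P), ← bootSum_sub_const w.2 x h (∫ z, h z ∂P)]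
      congr 3
      simp only [bootSum, Finset.sum_add_distrib, a, b, ξ, mul_assoc, ← Finset.mul_sum]
      ring
    have hsq : ∀ u v : Fin n → ℝ, ∑ i, (t * (√n)⁻¹ * u i) * (t * (√n)⁻¹ * v i) =
        t ^ 2 * ((∑ i, u i * v i) / n) := fun u v => by
      have : ∀ i, (t * (√n)⁻¹ * u i) * (t * (√n)⁻¹ * v i) =
          t ^ 2 * ((√(n : ℝ))⁻¹) ^ 2 * (u i * v i) := fun i => by ring
      simp_rw [this]
      rw [← Finset.mul_sum, inv_pow, Real.sq_sqrt hn0.le]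
      field_simp
    have hsa : ∑ i, a i ^ 2 = t ^ 2 * ((∑ i, ξ w.1 i ^ 2) / n) := by
      simpa [a, sq] using hsq (ξ w.1) (ξ w.1)
    have hsb : ∑ i, b i ^ 2 = t ^ 2 * ((∑ i, ξ w.2 i ^ 2) / n) := by
      simpa [b, sq] using hsq (ξ w.2) (ξ w.2)
    have hsab : ∑ i, a i * b i = t ^ 2 * ((∑ i, ξ w.1 i * ξ w.2 i) / n) := hsq (ξ w.1) (ξ w.2)
    have h1 := H n a b (fun i => hbd _ (hm1 i)) (fun i => hbd _ (hm2 i))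
    rw [← hfw, Finset.sum_add_distrib, hsa, hsb, hsab] at h1
    set V₁ : ℝ := (∑ i, ξ w.1 i ^ 2) / n
    set V₂ : ℝ := (∑ i, ξ w.2 i ^ 2) / n
    set X : ℝ := (∑ i, ξ w.1 i * ξ w.2 i) / n
    have hv1' : |V₁ - c ^ 2| ≤ ρ' / 2 := hv1
    have hv2' : |V₂ - c ^ 2| ≤ ρ' / 2 := hv2
    have hc' : |X| ≤ ρ' / 2 := hc
    have hρ1 : ρ' ≤ 1 := min_le_right _ _
    have hρ2 : ρ' ≤ ρ / 2 := min_le_left _ _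
    have h2 : Complex.exp (-(t ^ 2 * V₁ * ∫ y, g₀ y ^ 2 ∂P + 2 * (t ^ 2 * X) *
        ∫ y, g₀ y * h₀ y ∂P + t ^ 2 * V₂ * ∫ y, h₀ y ^ 2 ∂P : ℝ) / 2) = Φ (t, V₁, V₂, X) := by
      simp only [Φ, sq_stdDev, C, g₀, h₀]
      congr 3
      push_cast
      ring
    rw [h2] at h1
    have h3 : dist (Φ (t, V₁, V₂, X)) (Φ (S, c ^ 2, c ^ 2, 0)) < ε / 4 := by
      refine hΦρ ?_
      simp only [Prod.dist_eq, Real.dist_eq, sub_zero, sup_lt_iff]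
      refine ⟨?_, ?_, ?_, ?_⟩ <;> linarith
    rw [hΦL, dist_eq_norm] at h3
    have h4 : ε / (4 * B) * (t ^ 2 * V₁ + t ^ 2 * V₂) ≤ ε / 4 := by
      have hV1 := (abs_le.1 hv1').2
      have hV2 := (abs_le.1 hv2').2
      have hV1n : 0 ≤ V₁ := by positivity
      have hV2n : 0 ≤ V₂ := by positivity
      have h5 : t ^ 2 * V₁ + t ^ 2 * V₂ ≤ B := by
        rw [← mul_add]
        refine mul_le_mul hk2.le (by linarith) (by positivity) (by positivity)
      calc _ ≤ ε / (4 * B) * B := by gcongr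
        _ = ε / 4 := by field_simp
    calc ‖f w - L‖ ≤ ‖f w - Φ (t, V₁, V₂, X)‖ + ‖Φ (t, V₁, V₂, X) - L‖ :=
          norm_sub_le_norm_sub_add_norm_sub _ _ _
      _ ≤ ε / 4 + ε / 4 := add_le_add (h1.trans h4) h3.le
      _ = ε / 2 := by ring
  have hfinal := norm_integral_sub_le_of_measure hfm (fun w => norm_integral_exp_mul_I_le _) hL1
    (by positivity) hclose (η := 5 * η) (by positivity) hμA
  refine hfinal.trans_lt ?_
  simp only [η]
  linarith

end BootstrapCharFun

/-! ### Anti-concentration of the maximum of a Gaussian vector -/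

section Anticoncentration

lemma gaussianReal_zero_one_Ioc_le (a b : ℝ) :
    gaussianReal 0 1 (Set.Ioc a b) ≤ ENNReal.ofReal (b - a) := by
  rw [gaussianReal_apply 0 one_ne_zero]
  calc ∫⁻ x in Set.Ioc a b, gaussianPDF 0 1 x ≤ ∫⁻ _ in Set.Ioc a b, 1 := by
        refine lintegral_mono fun x => ?_
        rw [gaussianPDF, ENNReal.ofReal_le_one, gaussianPDFReal]
        refine mul_le_one₀ (inv_le_one_of_one_le₀ ?_) (Real.exp_nonneg _)
          (Real.exp_le_one_iff.2 ?_)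
        · rw [Real.one_le_sqrt]
          have := Real.pi_gt_three
          simp only [NNReal.coe_one]
          linarith
        · simp only [NNReal.coe_one, neg_div]
          have : 0 ≤ (x - 0) ^ 2 / (2 * 1) := by positivity
          linarith
    _ = _ := by simp

variable {ι : Type*} [Fintype ι] [LinearOrder ι]

/-- Split according to the index j of the maximum. In terms of the residuals X_i − s_i X_j, which
are independent of X_j, the event says that they are at most (1 − s_i) X_j, and this becomes more
likely as X_j grows because s_i ≤ 1. So the maximum has a nondecreasing density ∑ G_j with respect
to the standard normal law. Its value at b times the normal mass beyond b is at most 1, while the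
mass of (a, b] is at most that value times b − a. The number of coordinates never enters. -/
lemma measure_max_mem_Ioc_mul_le {E : Type*} [MeasurableSpace E] {ν : Measure E}
    [IsProbabilityMeasure ν] {X : ι → E → ℝ} (hX : ∀ j, Measurable (X j))
    (hlaw : ∀ j, ν.map (X j) = gaussianReal 0 1)
    (hind : ∀ j, ∃ s : ι → ℝ, (∀ i, s i ≤ 1) ∧
      IndepFun (X j) (fun x i => X i x - s i * X j x) ν) (a b : ℝ) :
    ν {x | (∀ j, X j x ≤ b) ∧ ∃ j, a < X j x} * gaussianReal 0 1 (Set.Ioi b) ≤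
      ENNReal.ofReal (b - a) := by
  choose s hs1 hs using hind
  set γ : Measure ℝ := gaussianReal 0 1 with hγ
  -- Ties go to the smallest index, so that these events are disjoint.
  let A : ι → Set E := fun j => {x | ∀ i, (i < j → X i x < X j x) ∧ X i x ≤ X j x}
  let V : ι → E → ι → ℝ := fun j x i => X i x - s j i * X j x
  let B : ι → ℝ → Set (ι → ℝ) := fun j t =>
    {v | ∀ i, (i < j → v i < (1 - s j i) * t) ∧ v i ≤ (1 - s j i) * t}
  let G : ι → ℝ → ℝ≥0∞ := fun j t => (ν.map (V j)) (B j t)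
  have hV : ∀ j, Measurable (V j) := fun j => by fun_prop
  have hG : ∀ j t t', t ≤ t' → G j t ≤ G j t' := fun j t t' h => by
    refine measure_mono fun v hv i => ?_
    have h1 : (1 - s j i) * t ≤ (1 - s j i) * t' :=
      mul_le_mul_of_nonneg_left h (by linarith [hs1 j i])
    exact ⟨fun hi => ((hv i).1 hi).trans_le h1, (hv i).2.trans h1⟩
  have hApp : ∀ j (I : Set ℝ), MeasurableSet I → ν (A j ∩ X j ⁻¹' I) = ∫⁻ t in I, G j t ∂γ := by
    intro j I hI
    let D : Set (ℝ × (ι → ℝ)) := {p | p.1 ∈ I ∧ p.2 ∈ B j p.1}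
    have hD : MeasurableSet D := by
      have : D = (Prod.fst ⁻¹' I) ∩ ⋂ i, ({p : ℝ × (ι → ℝ) | i < j → p.2 i < (1 - s j i) * p.1} ∩
          {p : ℝ × (ι → ℝ) | p.2 i ≤ (1 - s j i) * p.1}) := by
        ext p; simp [D, B]
      rw [this]
      refine (measurable_fst hI).inter (MeasurableSet.iInter fun i => ?_)
      refine MeasurableSet.inter ?_ (measurableSet_le (by fun_prop) (by fun_prop))
      by_cases hij : i < j
      · simp only [hij, forall_true_left]
        exact measurableSet_lt (by fun_prop) (by fun_prop)
      · simp [hij]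
    have h1 := (indepFun_iff_map_prod_eq_prod_map_map (hX j).aemeasurable
      (hV j).aemeasurable).1 (hs j)
    have h2 : A j ∩ X j ⁻¹' I = (fun x => (X j x, V j x)) ⁻¹' D := by
      ext x
      simp only [A, D, B, V, Set.mem_inter_iff, Set.mem_preimage, Set.mem_ofPred_eq, and_comm]
      refine and_congr_right fun _ => forall_congr' fun i => ?_
      have e : ∀ y z σ : ℝ, (y - σ * z < (1 - σ) * z ↔ y < z) ∧
          (y - σ * z ≤ (1 - σ) * z ↔ y ≤ z) := fun y z σ => by
        constructor <;> constructor <;> intro h <;> linarith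
      rw [(e _ _ _).1, (e _ _ _).2]
    rw [h2, ← Measure.map_apply ((hX j).prodMk (hV j)) hD]
    have : ν.map (fun x => (X j x, V j x)) = γ.prod (ν.map (V j)) := by rw [h1, hlaw j]
    have hpm : IsProbabilityMeasure (ν.map (V j)) :=
      Measure.isProbabilityMeasure_map (hV j).aemeasurable
    rw [this, Measure.prod_apply hD, ← lintegral_indicator hI]
    refine lintegral_congr fun t => ?_
    by_cases ht : t ∈ I
    · rw [Set.indicator_of_mem ht]
      congr 1
      ext v
      simp [D, ht]
    · rw [Set.indicator_of_notMem ht]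
      have : Prod.mk t ⁻¹' D = ∅ := by ext v; simp [D, ht]
      rw [this, measure_empty]
  have hAm : ∀ j (I : Set ℝ), MeasurableSet I → MeasurableSet (A j ∩ X j ⁻¹' I) := by
    intro j I hI
    refine MeasurableSet.inter ?_ (hX j hI)
    have : A j = ⋂ i, ({x | i < j → X i x < X j x} ∩ {x | X i x ≤ X j x}) := by
      ext x; simp [A]
    rw [this]
    refine MeasurableSet.iInter fun i => MeasurableSet.inter ?_ (measurableSet_le (hX i) (hX j))
    by_cases hij : i < j
    · simp only [hij, forall_true_left]
      exact measurableSet_lt (hX i) (hX j)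
    · simp [hij]
  have hdisj : Pairwise (Function.onFun Disjoint A) := by
    intro j k hjk
    refine Set.disjoint_left.2 fun x hxj hxk => ?_
    rcases lt_or_gt_of_ne hjk with h | h
    · exact absurd ((hxk j).1 h) (not_lt.2 (hxj k).2)
    · exact absurd ((hxj k).1 h) (not_lt.2 (hxk j).2)
  have hupper : ν {x | (∀ j, X j x ≤ b) ∧ ∃ j, a < X j x} ≤
      ∑ j, G j b * γ (Set.Ioc a b) := by
    calc _ ≤ ν (⋃ j, A j ∩ X j ⁻¹' Set.Ioc a b) := by
          refine measure_mono ?_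
          rintro x ⟨hxb, k, hk⟩
          let Smax : Finset ι := Finset.univ.filter fun j => ∀ i, X i x ≤ X j x
          have hne : Smax.Nonempty := by
            obtain ⟨j, -, hj⟩ := Finset.exists_max_image Finset.univ (fun j => X j x)
              ⟨k, Finset.mem_univ k⟩
            exact ⟨j, by simp only [Smax, Finset.mem_filter_univ]; exact fun i => hj i (Finset.mem_univ i)⟩
          have hmin := Smax.min'_mem hne
          set j := Smax.min' hne
          have hj : ∀ i, X i x ≤ X j x := by simpa [Smax] using hmin
          refine Set.mem_iUnion.2 ⟨j, fun i => ⟨fun hij => ?_, hj i⟩, hk.trans_le (hj k), hxb j⟩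
          by_contra hc
          have : i ∈ Smax := by
            simp only [Smax, Finset.mem_filter_univ]
            exact fun i' => (hj i').trans (not_lt.1 hc)
          exact absurd (Smax.min'_le i this) (not_le.2 hij)
      _ ≤ ∑ j, ν (A j ∩ X j ⁻¹' Set.Ioc a b) := measure_iUnion_fintype_le _ _
      _ ≤ _ := by
          refine Finset.sum_le_sum fun j _ => ?_
          rw [hApp j _ measurableSet_Ioc]
          calc ∫⁻ t in Set.Ioc a b, G j t ∂γ ≤ ∫⁻ _ in Set.Ioc a b, G j b ∂γ :=
                setLIntegral_mono measurable_const fun t ht => hG j _ _ ht.2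
            _ = _ := by rw [setLIntegral_const]
  have hlower : ∑ j, G j b * γ (Set.Ioi b) ≤ 1 := by
    calc ∑ j, G j b * γ (Set.Ioi b) ≤ ∑ j, ν (A j ∩ X j ⁻¹' Set.Ioi b) := by
          refine Finset.sum_le_sum fun j _ => ?_
          rw [hApp j _ measurableSet_Ioi, ← setLIntegral_const]
          refine lintegral_mono_ae ?_
          filter_upwards [ae_restrict_mem measurableSet_Ioi] with t ht
          exact hG j _ _ (le_of_lt ht)
      _ = ν (⋃ j, A j ∩ X j ⁻¹' Set.Ioi b) := by
          rw [measure_iUnion (fun j k hjk => (hdisj hjk).mono Set.inter_subset_left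
            Set.inter_subset_left) (fun j => hAm j _ measurableSet_Ioi), tsum_fintype]
      _ ≤ 1 := prob_le_one
  calc _ ≤ (∑ j, G j b * γ (Set.Ioc a b)) * γ (Set.Ioi b) := by gcongr
    _ = (∑ j, G j b * γ (Set.Ioi b)) * γ (Set.Ioc a b) := by
        rw [← Finset.sum_mul, ← Finset.sum_mul]; ring
    _ ≤ 1 * γ (Set.Ioc a b) := by gcongr
    _ ≤ _ := by rw [one_mul]; exact gaussianReal_zero_one_Ioc_le a b

/-- With unit variances the regression coefficient on X_j is the covariance, at most 1 because
Var(X_i − X_j) ≥ 0. The residuals are uncorrelated with X_j, hence independent of it by joint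
normality. -/
lemma multivariateGaussian_max_mem_Ioc_mul_le {S : Matrix ι ι ℝ} (hS : S.PosSemidef)
    (hS1 : ∀ i, S i i = 1) (a b : ℝ) :
    multivariateGaussian 0 S {x | (∀ j, x j ≤ b) ∧ ∃ j, a < x j} *
      gaussianReal 0 1 (Set.Ioi b) ≤ ENNReal.ofReal (b - a) := by
  set ν := multivariateGaussian (0 : EuclideanSpace ℝ ι) S with hν
  have hL2 : ∀ i, MemLp (fun x : EuclideanSpace ℝ ι => x i) 2 ν := fun i => by
    have h := IsGaussian.hasGaussianLaw_id (μ := ν)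
    exact (h.map (EuclideanSpace.proj i : EuclideanSpace ℝ ι →L[ℝ] ℝ)).memLp_two
  have hcov := fun i j => covariance_eval_multivariateGaussian (μ := 0) hS i j
  have hle : ∀ i j, S i j ≤ 1 := fun i j => by
    have h1 : 0 ≤ Var[(fun x : EuclideanSpace ℝ ι => x i) - (fun x => x j); ν] :=
      variance_nonneg _ _
    rw [variance_sub (hL2 i) (hL2 j), variance_eval_multivariateGaussian hS,
      variance_eval_multivariateGaussian hS, hcov, hS1, hS1] at h1
    linarith
  refine measure_max_mem_Ioc_mul_le (X := fun j (x : EuclideanSpace ℝ ι) => x j)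
    (fun j => by fun_prop) (fun j => ?_) (fun j => ⟨fun i => S i j, fun i => hle i j, ?_⟩) a b
  · have := (measurePreserving_eval_multivariateGaussian (μ := 0) hS (i := j)).map_eq
    rw [this, hS1]; simp
  · have hg : HasGaussianLaw (fun x : EuclideanSpace ℝ ι =>
        (fun _ : Unit => x j, fun i => x i - S i j * x j)) ν := by
      have h := IsGaussian.hasGaussianLaw_id (μ := ν)
      exact h.map ((ContinuousLinearMap.pi fun _ : Unit =>
        (EuclideanSpace.proj j : EuclideanSpace ℝ ι →L[ℝ] ℝ)).prod
        (ContinuousLinearMap.pi fun i => (EuclideanSpace.proj i : EuclideanSpace ℝ ι →L[ℝ] ℝ) -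
          S i j • (EuclideanSpace.proj j : EuclideanSpace ℝ ι →L[ℝ] ℝ)))
    have h2 := HasGaussianLaw.indepFun_of_covariance_eval (X := fun (_ : Unit)
      (x : EuclideanSpace ℝ ι) => x j) (Y := fun i x => x i - S i j * x j) hg fun _ i => by
        have : cov[fun x : EuclideanSpace ℝ ι => x j, fun x => x i - S i j * x j; ν] =
            S j i - S i j * S j j := by
          rw [← hcov j i, ← hcov j j, ← covariance_const_mul_right]
          exact covariance_sub_right (hL2 j) (hL2 i) ((hL2 j).const_mul _)
        rw [this, hS1, mul_one]
        have := hS.isHermitian.apply i j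
        simp at this
        linarith
    exact h2.comp (φ := fun u : Unit → ℝ => u ()) (measurable_pi_apply ()) measurable_id

end Anticoncentration

/-! ### The two-sample processes -/

section TwoSample

variable {𝒴 : Type*}

/-- The two-sample bootstrap process `bootProcess`, as a function of the finite samples. -/
noncomputable def twoSampleBoot {na nb : ℕ} (c : ℝ) (xa : Fin na → 𝒴) (xb : Fin nb → 𝒴)
    (wa : Fin na → ℝ) (wb : Fin nb → ℝ) (g : 𝒴 → ℝ) : ℝ :=
  (bootSum wa xa g - √(na / nb : ℝ) * bootSum wb xb g) / c

lemma bootSum_eq_sqrt_mul {n : ℕ} (hn : 0 < n) (w : Fin n → ℝ) (y : ℕ → 𝒴) (g : 𝒴 → ℝ) :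
    bootSum w (fun i => y i) g = √(n : ℝ) * (bootMean w y g - weightMean w * empMean n y g) := by
  have hn' : (0 : ℝ) < n := by exact_mod_cast hn
  have h : √(n : ℝ) * √n = n := Real.mul_self_sqrt hn'.le
  have h0 : √(n : ℝ) ≠ 0 := (Real.sqrt_pos.2 hn').ne'
  simp only [bootSum, bootMean, empMean, sub_mul, Finset.sum_sub_distrib]
  rw [← Finset.mul_sum, inv_mul_eq_div, div_eq_iff h0, mul_right_comm, h]
  field_simp

lemma bootProcess_eq_twoSampleBoot {na nb : ℕ} (ha : 0 < na) (hb : 0 < nb) (c : ℝ) (ya yb : ℕ → 𝒴)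
    (wa : Fin na → ℝ) (wb : Fin nb → ℝ) (g : 𝒴 → ℝ) :
    bootProcess c ya yb wa wb g =
      twoSampleBoot c (fun i => ya i) (fun i => yb i) wa wb g := by
  have hb' : (0 : ℝ) < nb := by exact_mod_cast hb
  have h0 : √(nb : ℝ) ≠ 0 := (Real.sqrt_pos.2 hb').ne'
  rw [bootProcess, twoSampleBoot, bootSum_eq_sqrt_mul ha, bootSum_eq_sqrt_mul hb,
    Real.sqrt_div (Nat.cast_nonneg na)]
  congr 1
  field_simp
  ring

variable [MeasurableSpace 𝒴]

/-- The centred two-sample empirical process, as a function of the finite samples. -/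
noncomputable def twoSampleEmp (Pa Pb : Measure 𝒴) {na nb : ℕ} (xa : Fin na → 𝒴)
    (xb : Fin nb → 𝒴) (g : 𝒴 → ℝ) : ℝ :=
  empDeviation Pa na xa g - √(na / nb : ℝ) * empDeviation Pb nb xb g

lemma centeredTStat_eq_twoSampleEmp (Pa Pb : Measure 𝒴) {na nb : ℕ} (hb : 0 < nb)
    (ya yb : ℕ → 𝒴) (s : (𝒴 → ℝ) → ℝ) (g : 𝒴 → ℝ) :
    centeredTStat Pa Pb na nb ya yb s g =
      twoSampleEmp Pa Pb (na := na) (nb := nb) (fun i => ya i) (fun i => yb i) g / s g := by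
  have hb' : (0 : ℝ) < nb := by exact_mod_cast hb
  have h0 : √(nb : ℝ) ≠ 0 := (Real.sqrt_pos.2 hb').ne'
  rw [centeredTStat, twoSampleEmp, Real.sqrt_div (Nat.cast_nonneg na)]
  simp only [empDeviation, empMean]
  congr 1
  field_simp
  ring

lemma measurable_twoSampleEmp (Pa Pb : Measure 𝒴) {na nb : ℕ} {g : 𝒴 → ℝ} (hg : Measurable g) :
    Measurable fun p : (Fin na → 𝒴) × (Fin nb → 𝒴) => twoSampleEmp Pa Pb p.1 p.2 g := by
  unfold twoSampleEmp empDeviation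
  fun_prop

/-- The variance of the limit of the two-sample processes at `g`. -/
noncomputable def limitVar (Pa Pb : Measure 𝒴) (lam : ℝ) (g : 𝒴 → ℝ) : ℝ :=
  stdDev Pa g ^ 2 + lam * stdDev Pb g ^ 2

variable {Pa Pb : Measure 𝒴} [IsProbabilityMeasure Pa] [IsProbabilityMeasure Pb]

lemma sq_stdDev_eq_variance {P : Measure 𝒴} {g : 𝒴 → ℝ} (hg : AEMeasurable g P) :
    stdDev P g ^ 2 = Var[g; P] := by
  rw [stdDev_eq hg, Real.sq_sqrt (variance_nonneg _ _)]

lemma sq_limitSD {lam : ℝ} (hlam : 0 ≤ lam) {g : 𝒴 → ℝ} (hga : MemLp g 2 Pa)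
    (hgb : MemLp g 2 Pb) : limitSD Pa Pb lam g ^ 2 = limitVar Pa Pb lam g := by
  have h : ∀ (P : Measure 𝒴) [IsProbabilityMeasure P], MemLp g 2 P →
      ∫ y, g y ^ 2 ∂P - (∫ y, g y ∂P) ^ 2 = stdDev P g ^ 2 := fun P _ hg => by
    rw [sq_stdDev_eq_variance hg.1.aemeasurable, variance_eq_sub hg]
    rfl
  rw [limitSD, h Pa hga, h Pb hgb, limitVar, Real.sq_sqrt (by positivity)]

variable {na nb : ℕ → ℕ} {lam : ℝ}

lemma tendsto_integral_exp_twoSampleEmp (hna : Tendsto na atTop atTop)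
    (hnb : Tendsto nb atTop atTop)
    (hlam : Tendsto (fun k => (na k : ℝ) / (nb k : ℝ)) atTop (𝓝 lam)) (hlam0 : 0 ≤ lam)
    {g : 𝒴 → ℝ} (hga : MemLp g 2 Pa) (hgb : MemLp g 2 Pb) :
    Tendsto (fun k => ∫ p : (Fin (na k) → 𝒴) × (Fin (nb k) → 𝒴),
      Complex.exp ((twoSampleEmp Pa Pb p.1 p.2 g : ℝ) * Complex.I)
        ∂((Measure.pi fun _ => Pa).prod (Measure.pi fun _ => Pb))) atTop
      (𝓝 (Complex.exp (-(limitVar Pa Pb lam g : ℝ) / 2))) := by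
  have ha := tendsto_integral_exp_empDeviation hga hna (s := fun _ => 1) tendsto_const_nhds
  have hb := tendsto_integral_exp_empDeviation hgb hnb
    (s := fun k => -√((na k : ℝ) / (nb k : ℝ))) hlam.sqrt.neg
  refine ((ha.mul hb).congr fun k => ?_).trans (le_of_eq ?_)
  · rw [← integral_prod_mul]
    refine integral_congr_ae (.of_forall fun p => ?_)
    dsimp only
    rw [← Complex.exp_add, twoSampleEmp]
    congr 1
    push_cast
    ring
  · rw [← Complex.exp_add]
    congr 2
    rw [neg_sq, Real.sq_sqrt hlam0, limitVar]
    push_cast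
    ring

/-- The law of two independent bootstrap draws for each of the samples, and of the data. -/
noncomputable def bootModel (Pa Pb : Measure 𝒴) {na nb : ℕ} (Qa : Measure (Fin na → ℝ))
    (Qb : Measure (Fin nb → ℝ)) :
    Measure ((((Fin na → ℝ) × (Fin na → ℝ)) × ((Fin nb → ℝ) × (Fin nb → ℝ))) ×
      ((Fin na → 𝒴) × (Fin nb → 𝒴))) :=
  ((Qa.prod Qa).prod (Qb.prod Qb)).prod
    ((Measure.pi fun _ => Pa).prod (Measure.pi fun _ => Pb))

instance {na nb : ℕ} (Qa : Measure (Fin na → ℝ)) (Qb : Measure (Fin nb → ℝ))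
    [IsProbabilityMeasure Qa] [IsProbabilityMeasure Qb] :
    IsProbabilityMeasure (bootModel Pa Pb Qa Qb) := by
  unfold bootModel; infer_instance

/-- The model lists all weights before all data; Fubini regroups it by sample, and the
characteristic function factorizes. -/
lemma integral_prod_mul_prod_prod {A B X Y : Type*} [MeasurableSpace A] [MeasurableSpace B]
    [MeasurableSpace X] [MeasurableSpace Y] {α : Measure A} {β : Measure B} {ξ : Measure X}
    {η : Measure Y} [IsProbabilityMeasure α] [IsProbabilityMeasure β] [IsProbabilityMeasure ξ]
    [IsProbabilityMeasure η] {u : A × X → ℝ} {v : B × Y → ℝ} (hu : Measurable u)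
    (hv : Measurable v) :
    ∫ p, Complex.exp ((u (p.1.1, p.2.1) + v (p.1.2, p.2.2) : ℝ) * Complex.I)
        ∂((α.prod β).prod (ξ.prod η)) =
      (∫ p, Complex.exp ((u p : ℝ) * Complex.I) ∂(α.prod ξ)) *
        ∫ p, Complex.exp ((v p : ℝ) * Complex.I) ∂(β.prod η) := by
  have h1 : Measurable fun p : (A × B) × (X × Y) => u (p.1.1, p.2.1) + v (p.1.2, p.2.2) :=
    (hu.comp (measurable_fst.fst.prodMk measurable_snd.fst)).add
      (hv.comp (measurable_fst.snd.prodMk measurable_snd.snd))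
  rw [integral_prod _ (integrable_exp_mul_I h1.aemeasurable),
    integral_prod _ (integrable_exp_mul_I hu.aemeasurable),
    integral_prod _ (integrable_exp_mul_I hv.aemeasurable), ← integral_prod_mul]
  refine integral_congr_ae (.of_forall fun p => ?_)
  dsimp only
  rw [← integral_prod_mul]
  refine integral_congr_ae (.of_forall fun q => ?_)
  dsimp only
  rw [← Complex.exp_add]
  congr 1
  push_cast
  ring

lemma tendsto_integral_exp_twoSampleBoot {Qa Qb : ∀ n : ℕ, Measure (Fin n → ℝ)} {c : ℝ}
    (hQa : IsBootstrapWeightLaw Qa c) (hQb : IsBootstrapWeightLaw Qb c)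
    (hna : Tendsto na atTop atTop) (hnb : Tendsto nb atTop atTop)
    (hlam : Tendsto (fun k => (na k : ℝ) / (nb k : ℝ)) atTop (𝓝 lam)) (hlam0 : 0 ≤ lam)
    {g h : 𝒴 → ℝ} (hgm : Measurable g) (hhm : Measurable h) (hga : MemLp g 2 Pa)
    (hgb : MemLp g 2 Pb) (hha : MemLp h 2 Pa) (hhb : MemLp h 2 Pb) :
    Tendsto (fun k => ∫ p, Complex.exp ((twoSampleBoot c p.2.1 p.2.2 p.1.1.1 p.1.2.1 g +
      twoSampleBoot c p.2.1 p.2.2 p.1.1.2 p.1.2.2 h : ℝ) * Complex.I)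
        ∂(bootModel Pa Pb (Qa (na k)) (Qb (nb k)))) atTop
      (𝓝 (Complex.exp (-(limitVar Pa Pb lam g : ℝ) / 2) *
        Complex.exp (-(limitVar Pa Pb lam h : ℝ) / 2))) := by
  have hc := hQa.c_pos
  have := hQa.isProbability
  have := hQb.isProbability
  have ha := tendsto_integral_exp_bootSum hQa hgm hhm hga hha hna (s := fun _ => c⁻¹)
    tendsto_const_nhds
  have hb := tendsto_integral_exp_bootSum hQb hgm hhm hgb hhb hnb
    (s := fun k => -√((na k : ℝ) / (nb k : ℝ)) * c⁻¹) (hlam.sqrt.neg.mul_const _)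
  refine ((ha.mul hb).congr fun k => ?_).trans (le_of_eq ?_)
  · rw [← integral_prod_mul_prod_prod, bootModel]
    · refine integral_congr_ae (.of_forall fun p => ?_)
      dsimp only [twoSampleBoot]
      congr 3
      ring
    · exact (((measurable_bootSum hgm).comp (measurable_fst.fst.prodMk measurable_snd)).add
        ((measurable_bootSum hhm).comp (measurable_fst.snd.prodMk measurable_snd))).const_mul _
    · exact (((measurable_bootSum hgm).comp (measurable_fst.fst.prodMk measurable_snd)).add
        ((measurable_bootSum hhm).comp (measurable_fst.snd.prodMk measurable_snd))).const_mul _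
  · rw [← Complex.exp_add, ← Complex.exp_add]
    congr 2
    rw [mul_pow, neg_sq, Real.sq_sqrt hlam0, limitVar, limitVar]
    have : c⁻¹ ^ 2 * c ^ 2 = 1 := by field_simp
    have h1 : ∀ x : ℝ, c⁻¹ ^ 2 * (c ^ 2 * x) = x := fun x => by rw [← mul_assoc, this, one_mul]
    rw [h1, mul_assoc lam, h1]
    push_cast
    ring

end TwoSample

/-! ### Finite-dimensional limits -/

section Levy

/-- Lévy's continuity theorem, for maps on varying probability spaces. -/
lemma tendsto_integral_of_tendsto_charFun {E : Type*} [NormedAddCommGroup E]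
    [InnerProductSpace ℝ E] [FiniteDimensional ℝ E] [MeasurableSpace E] [BorelSpace E]
    {Ω : ℕ → Type*} [∀ k, MeasurableSpace (Ω k)] {m : ∀ k, Measure (Ω k)}
    [∀ k, IsProbabilityMeasure (m k)] {X : ∀ k, Ω k → E} (hX : ∀ k, Measurable (X k))
    {ν : Measure E} [IsProbabilityMeasure ν]
    (h : ∀ t : E, Tendsto (fun k => ∫ ω, Complex.exp ((inner ℝ (X k ω) t : ℝ) * Complex.I) ∂(m k))
      atTop (𝓝 (charFun ν t))) (f : E →ᵇ ℝ) :
    Tendsto (fun k => ∫ ω, f (X k ω) ∂(m k)) atTop (𝓝 (∫ x, f x ∂ν)) := by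
  let M : ℕ → ProbabilityMeasure E := fun k =>
    ⟨(m k).map (X k), Measure.isProbabilityMeasure_map (hX k).aemeasurable⟩
  have hM : Tendsto M atTop (𝓝 ⟨ν, inferInstance⟩) := by
    refine ProbabilityMeasure.tendsto_of_tendsto_charFun fun t => ?_
    refine (h t).congr fun k => ?_
    simp only [M, ProbabilityMeasure.coe_mk, charFun]
    rw [integral_map (hX k).aemeasurable]
    exact Continuous.aestronglyMeasurable (by fun_prop)
  have h2 := (ProbabilityMeasure.tendsto_iff_forall_integral_tendsto.1 hM) f
  refine h2.congr fun k => ?_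
  simp only [M, ProbabilityMeasure.coe_mk]
  rw [integral_map (hX k).aemeasurable f.continuous.aestronglyMeasurable]

end Levy

/-! ### Gaussian limits of both processes at finitely many functions -/

section FiniteDimensional

variable {𝒴 : Type*} [MeasurableSpace 𝒴] {Pa Pb : Measure 𝒴} [IsProbabilityMeasure Pa]
  [IsProbabilityMeasure Pb] {ι : Type*} [Fintype ι]

/-- The linear combination `∑ j, t j * g j`. -/
def linComb (t : ι → ℝ) (g : ι → 𝒴 → ℝ) : 𝒴 → ℝ := fun y => ∑ j, t j * g j y

lemma measurable_linComb {g : ι → 𝒴 → ℝ} (hg : ∀ j, Measurable (g j)) (t : ι → ℝ) :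
    Measurable (linComb t g) :=
  Finset.measurable_sum _ fun j _ => (hg j).const_mul _

lemma memLp_linComb {P : Measure 𝒴} {g : ι → 𝒴 → ℝ} (hg : ∀ j, MemLp (g j) 2 P) (t : ι → ℝ) :
    MemLp (linComb t g) 2 P :=
  memLp_finsetSum _ fun j _ => (hg j).const_mul _

lemma empDeviation_linComb {P : Measure 𝒴} [IsProbabilityMeasure P] {g : ι → 𝒴 → ℝ}
    (hg : ∀ j, MemLp (g j) 2 P) (t : ι → ℝ) (n : ℕ) (x : Fin n → 𝒴) :
    empDeviation P n x (linComb t g) = ∑ j, t j * empDeviation P n x (g j) := by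
  simp only [empDeviation, linComb]
  rw [integral_finsetSum _ fun j _ => ((hg j).integrable (by norm_num)).const_mul _,
    Finset.sum_comm, Finset.sum_div, ← Finset.sum_sub_distrib, Finset.mul_sum]
  refine Finset.sum_congr rfl fun j _ => ?_
  rw [integral_const_mul, ← Finset.mul_sum]
  ring

lemma twoSampleEmp_linComb {g : ι → 𝒴 → ℝ} (hga : ∀ j, MemLp (g j) 2 Pa)
    (hgb : ∀ j, MemLp (g j) 2 Pb) (t : ι → ℝ) {na nb : ℕ} (xa : Fin na → 𝒴) (xb : Fin nb → 𝒴) :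
    twoSampleEmp Pa Pb xa xb (linComb t g) = ∑ j, t j * twoSampleEmp Pa Pb xa xb (g j) := by
  simp only [twoSampleEmp, empDeviation_linComb hga, empDeviation_linComb hgb, mul_sub,
    Finset.sum_sub_distrib, Finset.mul_sum]
  congr 1
  exact Finset.sum_congr rfl fun j _ => by ring

omit [MeasurableSpace 𝒴] in
lemma bootSum_linComb (g : ι → 𝒴 → ℝ) (t : ι → ℝ) {n : ℕ} (w : Fin n → ℝ) (x : Fin n → 𝒴) :
    bootSum w x (linComb t g) = ∑ j, t j * bootSum w x (g j) := by
  simp only [bootSum, linComb, Finset.mul_sum]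
  rw [Finset.sum_comm]
  exact Finset.sum_congr rfl fun j _ => Finset.sum_congr rfl fun i _ => by ring

omit [MeasurableSpace 𝒴] in
lemma twoSampleBoot_linComb (g : ι → 𝒴 → ℝ) (t : ι → ℝ) {na nb : ℕ} (c : ℝ)
    (xa : Fin na → 𝒴) (xb : Fin nb → 𝒴) (wa : Fin na → ℝ) (wb : Fin nb → ℝ) :
    twoSampleBoot c xa xb wa wb (linComb t g) =
      ∑ j, t j * twoSampleBoot c xa xb wa wb (g j) := by
  simp only [twoSampleBoot, bootSum_linComb, Finset.mul_sum, ← Finset.sum_sub_distrib,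
    Finset.sum_div]
  exact Finset.sum_congr rfl fun j _ => by ring

/-- The covariance matrix of the limit of the two-sample processes at `g j`, `j : ι`. -/
noncomputable def limitCov (Pa Pb : Measure 𝒴) (lam : ℝ) (g : ι → 𝒴 → ℝ) : Matrix ι ι ℝ :=
  Matrix.of fun i j => cov[g i, g j; Pa] + lam * cov[g i, g j; Pb]

lemma sq_stdDev_linComb {P : Measure 𝒴} [IsProbabilityMeasure P] {g : ι → 𝒴 → ℝ}
    (hg : ∀ j, MemLp (g j) 2 P) (t : ι → ℝ) :
    stdDev P (linComb t g) ^ 2 = ∑ i, ∑ j, t i * t j * cov[g i, g j; P] := by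
  rw [sq_stdDev_eq_variance (memLp_linComb hg t).1.aemeasurable,
    ← covariance_self (memLp_linComb hg t).1.aemeasurable]
  unfold linComb
  rw [covariance_fun_sum_fun_sum (fun j => (hg j).const_mul _) (fun j => (hg j).const_mul _)]
  refine Finset.sum_congr rfl fun i _ => Finset.sum_congr rfl fun j _ => ?_
  rw [covariance_const_mul_left, covariance_const_mul_right]
  ring

lemma dotProduct_limitCov_mulVec (lam : ℝ) {g : ι → 𝒴 → ℝ} (hga : ∀ j, MemLp (g j) 2 Pa)
    (hgb : ∀ j, MemLp (g j) 2 Pb) (t : ι → ℝ) :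
    t ⬝ᵥ (limitCov Pa Pb lam g).mulVec t = limitVar Pa Pb lam (linComb t g) := by
  rw [limitVar, sq_stdDev_linComb hga, sq_stdDev_linComb hgb, Finset.mul_sum,
    ← Finset.sum_add_distrib, dotProduct]
  refine Finset.sum_congr rfl fun i _ => ?_
  rw [Finset.mul_sum, ← Finset.sum_add_distrib, Matrix.mulVec, dotProduct, Finset.mul_sum]
  refine Finset.sum_congr rfl fun j _ => ?_
  rw [limitCov, Matrix.of_apply]
  ring

lemma posSemidef_limitCov {lam : ℝ} (hlam : 0 ≤ lam) {g : ι → 𝒴 → ℝ}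
    (hga : ∀ j, MemLp (g j) 2 Pa) (hgb : ∀ j, MemLp (g j) 2 Pb) :
    (limitCov Pa Pb lam g).PosSemidef := by
  refine Matrix.PosSemidef.of_dotProduct_mulVec_nonneg ?_ fun t => ?_
  · ext i j
    simp only [limitCov, Matrix.conjTranspose_apply, Matrix.of_apply, star_trivial]
    rw [covariance_comm, covariance_comm (g i) (g j) (μ := Pb)]
  · rw [star_trivial, dotProduct_limitCov_mulVec lam hga hgb, limitVar]
    positivity

omit [IsProbabilityMeasure Pa] [IsProbabilityMeasure Pb] [Fintype ι] in
lemma limitCov_apply_self {lam : ℝ} {g : ι → 𝒴 → ℝ} (hga : ∀ j, MemLp (g j) 2 Pa)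
    (hgb : ∀ j, MemLp (g j) 2 Pb) (j : ι) :
    limitCov Pa Pb lam g j j = limitVar Pa Pb lam (g j) := by
  rw [limitCov, Matrix.of_apply, covariance_self (hga j).1.aemeasurable,
    covariance_self (hgb j).1.aemeasurable, limitVar,
    sq_stdDev_eq_variance (hga j).1.aemeasurable, sq_stdDev_eq_variance (hgb j).1.aemeasurable]

variable [DecidableEq ι]

/-- The limit law of the two-sample processes at `g j`, `j : ι`. -/
noncomputable def limitLaw (Pa Pb : Measure 𝒴) (lam : ℝ) (g : ι → 𝒴 → ℝ) :
    Measure (EuclideanSpace ℝ ι) :=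
  multivariateGaussian 0 (limitCov Pa Pb lam g)

instance (Pa Pb : Measure 𝒴) (lam : ℝ) (g : ι → 𝒴 → ℝ) :
    IsProbabilityMeasure (limitLaw Pa Pb lam g) := by
  unfold limitLaw; infer_instance

lemma charFun_limitLaw {lam : ℝ} (hlam : 0 ≤ lam) {g : ι → 𝒴 → ℝ}
    (hga : ∀ j, MemLp (g j) 2 Pa) (hgb : ∀ j, MemLp (g j) 2 Pb) (t : EuclideanSpace ℝ ι) :
    charFun (limitLaw Pa Pb lam g) t =
      Complex.exp (-(limitVar Pa Pb lam (linComb t g) : ℝ) / 2) := by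
  rw [limitLaw, charFun_multivariateGaussian (posSemidef_limitCov hlam hga hgb),
    dotProduct_limitCov_mulVec lam hga hgb]
  congr 1
  simp
  ring

variable {na nb : ℕ → ℕ} {lam : ℝ}

lemma tendsto_integral_twoSampleEmp (hna : Tendsto na atTop atTop)
    (hnb : Tendsto nb atTop atTop)
    (hlam : Tendsto (fun k => (na k : ℝ) / (nb k : ℝ)) atTop (𝓝 lam)) (hlam0 : 0 ≤ lam)
    {g : ι → 𝒴 → ℝ} (hgm : ∀ j, Measurable (g j)) (hga : ∀ j, MemLp (g j) 2 Pa)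
    (hgb : ∀ j, MemLp (g j) 2 Pb) (f : EuclideanSpace ℝ ι →ᵇ ℝ) :
    Tendsto (fun k => ∫ p : (Fin (na k) → 𝒴) × (Fin (nb k) → 𝒴),
      f (WithLp.toLp 2 fun j => twoSampleEmp Pa Pb p.1 p.2 (g j))
        ∂((Measure.pi fun _ => Pa).prod (Measure.pi fun _ => Pb))) atTop
      (𝓝 (∫ x, f x ∂(limitLaw Pa Pb lam g))) := by
  refine tendsto_integral_of_tendsto_charFun (Ω := fun k => (Fin (na k) → 𝒴) × (Fin (nb k) → 𝒴))
    (m := fun k => (Measure.pi fun _ => Pa).prod (Measure.pi fun _ => Pb))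
    (X := fun k p => WithLp.toLp 2 fun j => twoSampleEmp Pa Pb p.1 p.2 (g j)) (fun k => ?_)
    (fun t => ?_) f
  · exact (WithLp.measurable_toLp 2 _).comp
      (measurable_pi_lambda _ fun j => measurable_twoSampleEmp Pa Pb (hgm j))
  · rw [charFun_limitLaw hlam0 hga hgb]
    refine (tendsto_integral_exp_twoSampleEmp hna hnb hlam hlam0 (memLp_linComb hga t)
      (memLp_linComb hgb t)).congr fun k => ?_
    refine integral_congr_ae (.of_forall fun p => ?_)
    dsimp only
    rw [twoSampleEmp_linComb hga hgb, PiLp.inner_apply]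
    rfl

omit [DecidableEq ι] in
lemma measurable_twoSampleBoot_fst {na nb : ℕ} (c : ℝ) {g : 𝒴 → ℝ} (hg : Measurable g) :
    Measurable fun p : (((Fin na → ℝ) × (Fin na → ℝ)) × ((Fin nb → ℝ) × (Fin nb → ℝ))) ×
      ((Fin na → 𝒴) × (Fin nb → 𝒴)) => twoSampleBoot c p.2.1 p.2.2 p.1.1.1 p.1.2.1 g :=
  (((measurable_bootSum hg).comp (measurable_fst.fst.fst.prodMk measurable_snd.fst)).sub
    (((measurable_bootSum hg).comp
      (measurable_fst.snd.fst.prodMk measurable_snd.snd)).const_mul _)).div_const _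

omit [DecidableEq ι] in
lemma measurable_twoSampleBoot_snd {na nb : ℕ} (c : ℝ) {g : 𝒴 → ℝ} (hg : Measurable g) :
    Measurable fun p : (((Fin na → ℝ) × (Fin na → ℝ)) × ((Fin nb → ℝ) × (Fin nb → ℝ))) ×
      ((Fin na → 𝒴) × (Fin nb → 𝒴)) => twoSampleBoot c p.2.1 p.2.2 p.1.1.2 p.1.2.2 g :=
  (((measurable_bootSum hg).comp (measurable_fst.fst.snd.prodMk measurable_snd.fst)).sub
    (((measurable_bootSum hg).comp
      (measurable_fst.snd.snd.prodMk measurable_snd.snd)).const_mul _)).div_const _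

/-- The two draws form one vector in the Hilbert space `WithLp 2 (E × E)`, and its characteristic
function converges to that of ν ⊗ ν. Testing against f ⊗ f gives the square: draws that share their
data are uncorrelated in the limit. -/
lemma tendsto_integral_twoSampleBoot {Qa Qb : ∀ n : ℕ, Measure (Fin n → ℝ)} {c : ℝ}
    (hQa : IsBootstrapWeightLaw Qa c) (hQb : IsBootstrapWeightLaw Qb c)
    (hna : Tendsto na atTop atTop) (hnb : Tendsto nb atTop atTop)
    (hlam : Tendsto (fun k => (na k : ℝ) / (nb k : ℝ)) atTop (𝓝 lam)) (hlam0 : 0 ≤ lam)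
    {g : ι → 𝒴 → ℝ} (hgm : ∀ j, Measurable (g j)) (hga : ∀ j, MemLp (g j) 2 Pa)
    (hgb : ∀ j, MemLp (g j) 2 Pb) (f : EuclideanSpace ℝ ι →ᵇ ℝ) :
    Tendsto (fun k => ∫ p,
      f (WithLp.toLp 2 fun j => twoSampleBoot c p.2.1 p.2.2 p.1.1.1 p.1.2.1 (g j)) *
      f (WithLp.toLp 2 fun j => twoSampleBoot c p.2.1 p.2.2 p.1.1.2 p.1.2.2 (g j))
        ∂(bootModel Pa Pb (Qa (na k)) (Qb (nb k)))) atTop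
      (𝓝 ((∫ x, f x ∂(limitLaw Pa Pb lam g)) ^ 2)) := by
  have := hQa.isProbability
  have := hQb.isProbability
  set ν := limitLaw Pa Pb lam g with hν
  let E := EuclideanSpace ℝ ι
  let f₂ : WithLp 2 (E × E) →ᵇ ℝ :=
    f.compContinuous ⟨fun x => x.fst, by fun_prop⟩ *
    f.compContinuous ⟨fun x => x.snd, by fun_prop⟩
  have hνν : IsProbabilityMeasure ((ν.prod ν).map (WithLp.toLp 2)) :=
    Measure.isProbabilityMeasure_map (WithLp.measurable_toLp 2 _).aemeasurable
  have hm1 : ∀ k, Measurable fun p : (((Fin (na k) → ℝ) × (Fin (na k) → ℝ)) ×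
      ((Fin (nb k) → ℝ) × (Fin (nb k) → ℝ))) × ((Fin (na k) → 𝒴) × (Fin (nb k) → 𝒴)) =>
      (WithLp.toLp 2 fun j => twoSampleBoot c p.2.1 p.2.2 p.1.1.1 p.1.2.1 (g j) : E) := fun k =>
    (WithLp.measurable_toLp 2 _).comp
      (measurable_pi_lambda _ fun j => measurable_twoSampleBoot_fst c (hgm j))
  have hm2 : ∀ k, Measurable fun p : (((Fin (na k) → ℝ) × (Fin (na k) → ℝ)) ×
      ((Fin (nb k) → ℝ) × (Fin (nb k) → ℝ))) × ((Fin (na k) → 𝒴) × (Fin (nb k) → 𝒴)) =>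
      (WithLp.toLp 2 fun j => twoSampleBoot c p.2.1 p.2.2 p.1.1.2 p.1.2.2 (g j) : E) := fun k =>
    (WithLp.measurable_toLp 2 _).comp
      (measurable_pi_lambda _ fun j => measurable_twoSampleBoot_snd c (hgm j))
  have key := tendsto_integral_of_tendsto_charFun
    (m := fun k => bootModel Pa Pb (Qa (na k)) (Qb (nb k)))
    (X := fun k p => (WithLp.toLp 2
      ((WithLp.toLp 2 fun j => twoSampleBoot c p.2.1 p.2.2 p.1.1.1 p.1.2.1 (g j)),
      (WithLp.toLp 2 fun j => twoSampleBoot c p.2.1 p.2.2 p.1.1.2 p.1.2.2 (g j))) :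
        WithLp 2 (E × E)))
    (fun k => (WithLp.measurable_toLp 2 _).comp ((hm1 k).prodMk (hm2 k)))
    (ν := (ν.prod ν).map (WithLp.toLp 2)) (fun t => ?_) f₂
  · refine key.trans (le_of_eq ?_)
    congr 1
    rw [integral_map (WithLp.measurable_toLp 2 _).aemeasurable
      f₂.continuous.aestronglyMeasurable, sq, ← integral_prod_mul]
    rfl
  · rw [charFun_prod, charFun_limitLaw hlam0 hga hgb, charFun_limitLaw hlam0 hga hgb]
    refine (tendsto_integral_exp_twoSampleBoot hQa hQb hna hnb hlam hlam0
      (measurable_linComb hgm _) (measurable_linComb hgm _) (memLp_linComb hga _)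
      (memLp_linComb hgb _) (memLp_linComb hga _) (memLp_linComb hgb _)).congr fun k => ?_
    refine integral_congr_ae (.of_forall fun p => ?_)
    dsimp only
    rw [twoSampleBoot_linComb, twoSampleBoot_linComb, WithLp.prod_inner_apply,
      PiLp.inner_apply, PiLp.inner_apply]
    rfl

end FiniteDimensional

/-! ### The stepdown procedure and its critical values -/

section Stepdown

variable {𝒴 : Type*} {R : ℕ} {α : ℝ} {tb : Fin R → (𝒴 → ℝ) → ℝ}

lemma critValue_mono {S T : Set (𝒴 → ℝ)} (h : S ⊆ T) :
    critValue α tb S ≤ critValue α tb T := by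
  refine sInf_le_sInf fun t ht => ?_
  simp only [Set.mem_ofPred_eq] at ht ⊢
  refine ht.trans (Nat.cast_le.2 (Set.ncard_le_ncard (fun r hr => ?_) (Set.toFinite _)))
  have hr' : ⨆ f ∈ T, (tb r f : EReal) ≤ t := hr
  exact (biSup_mono (f := fun f => (tb r f : EReal)) h).trans hr'

/-- A strict inequality provides a level below t that already satisfies the quantile condition, so
it is irrelevant whether the infimum is attained. -/
lemma le_ncard_of_critValue_lt {S : Set (𝒴 → ℝ)} {t : ℝ} (h : critValue α tb S < (t : EReal)) :
    (1 - α) * R ≤ (({r : Fin R | ∀ f ∈ S, tb r f ≤ t}.ncard : ℕ) : ℝ) := by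
  obtain ⟨x, hx, hxt⟩ := sInf_lt_iff.1 h
  refine le_trans hx (Nat.cast_le.2 (Set.ncard_le_ncard (fun r hr f hf => ?_) (Set.toFinite _)))
  have h1 : (tb r f : EReal) ≤ x := (le_iSup₂ (f := fun f _ => (tb r f : EReal)) f hf).trans hr
  exact EReal.coe_le_coe_iff.1 (h1.trans hxt.le)

/-- At the first iteration that removes a member of S, the set under test still contains S, so its
critical value is at least that of S. -/
lemma exists_critValue_lt_of_mem_stepdownRejects {F S : Set (𝒴 → ℝ)} (hS : S ⊆ F)
    {t : (𝒴 → ℝ) → ℝ} (h : ∃ f ∈ S, f ∈ stepdownRejects F α tb t) :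
    ∃ f ∈ S, critValue α tb S < (t f : EReal) := by
  classical
  have hex : ∃ i, ∃ f ∈ S, f ∉ notRejected F α tb t i := by
    obtain ⟨f, hf, -, i, hi⟩ := h
    exact ⟨i, f, hf, hi⟩
  obtain ⟨f, hf, hi⟩ := Nat.find_spec hex
  rcases hn : Nat.find hex with _ | n
  · rw [hn] at hi
    exact absurd (hS hf) hi
  · rw [hn] at hi
    have hsub : S ⊆ notRejected F α tb t n := fun g hg => by
      by_contra hc
      exact Nat.find_min hex (m := n) (by omega) ⟨g, hg, hc⟩
    refine ⟨f, hf, (critValue_mono hsub).trans_lt ?_⟩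
    by_contra hc
    exact hi ⟨hsub hf, hc⟩

/-- Passing to the representatives e_j only discards constraints on a replication. The three ε pay
for replacing σ̂ by σ at e_j, for replacing it at f, and for moving from f to the representative of
its cell. The ratio Z_f / σ̂_f is at most 2C / s and σ̂ / σ is within τ / s of 1, whence the
condition on 2Cτ / s². -/
lemma le_ncard_of_critValue_lt_div {S : Set (𝒴 → ℝ)} {σ σh Z : (𝒴 → ℝ) → ℝ}
    {B : Fin R → (𝒴 → ℝ) → ℝ} {s C τ ε : ℝ} (hs : 0 < s) (hσ : ∀ f ∈ S, s ≤ σ f)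
    (hτ : τ ≤ s / 2) (hσh : ∀ f ∈ S, |σh f - σ f| ≤ τ) (hZ : ∀ f ∈ S, |Z f| ≤ C)
    (hε : 2 * C * τ / s ^ 2 ≤ ε) {ι : Type*} {e : ι → 𝒴 → ℝ} (he : ∀ j, e j ∈ S) {φ : S → ι}
    (hφ : ∀ f : S, |(σ f)⁻¹ * Z f - (σ (e (φ f)))⁻¹ * Z (e (φ f))| ≤ ε) {t : (𝒴 → ℝ) → ℝ}
    (ht : ∀ f ∈ S, 0 < σh f → t f ≤ Z f / σh f) {f : 𝒴 → ℝ} (hf : f ∈ S)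
    (h : critValue α (fun r f => B r f / σh f) S < (t f : EReal)) :
    ∃ i, (1 - α) * R ≤ (({r : Fin R | ∀ j, (σ (e j))⁻¹ * B r (e j) ≤
      (σ (e i))⁻¹ * Z (e i) + 3 * ε}.ncard : ℕ) : ℝ) := by
  have hpos : ∀ g ∈ S, s / 2 ≤ σh g := fun g hg => by
    have := (abs_le.1 (hσh g hg)).1
    linarith [hσ g hg]
  have hC : 0 ≤ C := (abs_nonneg _).trans (hZ f hf)
  have hτ0 : 0 ≤ τ := (abs_nonneg _).trans (hσh f hf)
  have hσhf : 0 < σh f := by linarith [hpos f hf]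
  have hσf : 0 < σ f := by linarith [hσ f hf]
  have h1 := le_ncard_of_critValue_lt (h.trans_le (EReal.coe_le_coe_iff.2 (ht f hf hσhf)))
  refine ⟨φ ⟨f, hf⟩, h1.trans (Nat.cast_le.2 (Set.ncard_le_ncard (fun r hr j => ?_)
    (Set.toFinite _)))⟩
  have hej := he j
  have hσj : 0 < σ (e j) := by linarith [hσ _ hej]
  have hσhj : 0 < σh (e j) := by linarith [hpos _ hej]
  have h2 : B r (e j) ≤ Z f / σh f * σh (e j) := (div_le_iff₀ hσhj).1 (hr (e j) hej)
  have hquot : |Z f / σh f| ≤ 2 * C / s := by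
    rw [abs_div, abs_of_pos hσhf, div_le_div_iff₀ hσhf hs]
    have := hZ f hf
    have := hpos f hf
    nlinarith [abs_nonneg (Z f)]
  have hratio : ∀ g ∈ S, |σh g / σ g - 1| ≤ τ / s := fun g hg => by
    have hg0 : 0 < σ g := by linarith [hσ g hg]
    rw [div_sub_one hg0.ne', abs_div, abs_of_pos hg0]
    exact div_le_div₀ hτ0 (hσh g hg) hs (hσ g hg)
  have hprod : ∀ g ∈ S, |Z f / σh f * (σh g / σ g - 1)| ≤ ε := fun g hg => by
    rw [abs_mul]
    refine le_trans (mul_le_mul hquot (hratio g hg) (abs_nonneg _) (by positivity)) ?_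
    refine le_trans (le_of_eq ?_) hε
    field_simp
  have h3 : (σ (e j))⁻¹ * B r (e j) ≤ Z f / σh f + ε := by
    calc (σ (e j))⁻¹ * B r (e j) ≤ (σ (e j))⁻¹ * (Z f / σh f * σh (e j)) := by gcongr
      _ = Z f / σh f + Z f / σh f * (σh (e j) / σ (e j) - 1) := by field_simp; ring
      _ ≤ _ := by linarith [(abs_le.1 (hprod _ hej)).2]
  have h4 : Z f / σh f ≤ (σ f)⁻¹ * Z f + ε := by
    have : (σ f)⁻¹ * Z f = Z f / σh f + Z f / σh f * (σh f / σ f - 1) := by field_simp; ring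
    linarith [(abs_le.1 (hprod f hf)).1]
  linarith [(abs_le.1 (hφ ⟨f, hf⟩)).2]

end Stepdown

/-! ### Averages of weakly correlated variables -/

section Average

variable {Ω : Type*} [MeasurableSpace Ω] {μ : Measure Ω} [IsProbabilityMeasure μ]

/-- Chebyshev's inequality: in the second moment of the sum, the diagonal contributes at most R and
the rest at most R²|v|. -/
lemma measure_le_sum_le_of_integral_mul_eq {R : ℕ} (hR : 0 < R) {φ : Fin R → Ω → ℝ}
    (hφ : ∀ r, AEStronglyMeasurable (φ r) μ) (hφ1 : ∀ r ω, |φ r ω| ≤ 1) {v : ℝ}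
    (hv : ∀ r r', r ≠ r' → ∫ ω, φ r ω * φ r' ω ∂μ = v) {η : ℝ} (hη : 0 < η) :
    μ {ω | η * R ≤ ∑ r, φ r ω} ≤ ENNReal.ofReal ((1 / R + |v|) / η ^ 2) := by
  have hR' : (0 : ℝ) < R := by exact_mod_cast hR
  have hint : ∀ r r', Integrable (fun ω => φ r ω * φ r' ω) μ := fun r r' =>
    Integrable.of_bound ((hφ r).mul (hφ r')) 1 (.of_forall fun ω => by
      rw [Real.norm_eq_abs, abs_mul]
      exact mul_le_one₀ (hφ1 r ω) (abs_nonneg _) (hφ1 r' ω))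
  have hsq : ∀ ω, (∑ r, φ r ω) ^ 2 = ∑ r, ∑ r', φ r ω * φ r' ω := fun ω => by
    rw [sq, Finset.sum_mul_sum]
  have hsqint : Integrable (fun ω => (∑ r, φ r ω) ^ 2) μ := by
    simp_rw [hsq]
    exact integrable_finsetSum _ fun r _ => integrable_finsetSum _ fun r' _ => hint r r'
  have hle : ∫ ω, (∑ r, φ r ω) ^ 2 ∂μ ≤ R + R ^ 2 * |v| := by
    simp_rw [hsq]
    rw [integral_finsetSum _ fun r _ => integrable_finsetSum _ fun r' _ => hint r r']
    simp_rw [integral_finsetSum Finset.univ fun r' _ => hint _ r']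
    calc ∑ r, ∑ r', ∫ ω, φ r ω * φ r' ω ∂μ ≤ ∑ r : Fin R, ∑ r', ((if r = r' then 1 else 0) + |v|) := by
          refine Finset.sum_le_sum fun r _ => Finset.sum_le_sum fun r' _ => ?_
          by_cases h : r = r'
          · rw [if_pos h]
            have : ∫ ω, φ r ω * φ r' ω ∂μ ≤ ∫ _, (1 : ℝ) ∂μ :=
              integral_mono (hint r r') (integrable_const _) fun ω =>
                (le_abs_self _).trans (by
                  rw [abs_mul]; exact mul_le_one₀ (hφ1 r ω) (abs_nonneg _) (hφ1 r' ω))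
            simp only [integral_const, probReal_univ, smul_eq_mul, mul_one] at this
            linarith [abs_nonneg v]
          · rw [if_neg h, hv r r' h, zero_add]
            exact le_abs_self v
      _ = R + R ^ 2 * |v| := by
          simp only [Finset.sum_add_distrib, Finset.sum_ite_eq, Finset.mem_univ, if_true,
            Finset.sum_const, Finset.card_univ, Fintype.card_fin, nsmul_eq_mul]
          ring
  have hm := (mul_meas_ge_le_integral_of_nonneg (.of_forall fun ω => sq_nonneg (∑ r, φ r ω))
    hsqint ((η * R) ^ 2)).trans hle
  calc μ {ω | η * R ≤ ∑ r, φ r ω} ≤ μ {ω | (η * R) ^ 2 ≤ (∑ r, φ r ω) ^ 2} :=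
        measure_mono fun ω hω => pow_le_pow_left₀ (by positivity) hω 2
    _ = ENNReal.ofReal (μ.real {ω | (η * R) ^ 2 ≤ (∑ r, φ r ω) ^ 2}) := by
        rw [ofReal_measureReal]
    _ ≤ _ := by
        refine ENNReal.ofReal_le_ofReal ?_
        rw [le_div_iff₀ (by positivity), div_add' _ _ _ hR'.ne', le_div_iff₀ hR']
        have : 0 < (R : ℝ) := hR'
        refine le_of_mul_le_mul_left ?_ hR'
        nlinarith

end Average

/-! ### A continuous approximation of the distribution function of the maximum -/

section Cutoff

variable {ι : Type*} [Fintype ι]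

/-- The cut-off function equal to `1` on `(-∞, a]` and to `0` on `[a + ε, ∞)`. -/
noncomputable def cutoff (a ε : ℝ) (x : ℝ) : ℝ := max 0 (min 1 ((a + ε - x) / ε))

lemma cutoff_nonneg (a ε x : ℝ) : 0 ≤ cutoff a ε x := le_max_left _ _

lemma cutoff_le_one (a ε x : ℝ) : cutoff a ε x ≤ 1 := max_le zero_le_one (min_le_left _ _)

/-- A continuous function between the indicators of `max_j x_j ≤ a` and `max_j x_j ≤ a + ε`. -/
noncomputable def maxCutoff (a ε : ℝ) : EuclideanSpace ℝ ι →ᵇ ℝ :=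
  BoundedContinuousFunction.ofNormedAddCommGroup (fun x => ∏ j, cutoff a ε (x j))
    (by unfold cutoff; fun_prop) 1 fun x => by
      rw [Real.norm_eq_abs, Finset.abs_prod]
      exact Finset.prod_le_one (fun _ _ => abs_nonneg _) fun j _ => by
        rw [abs_of_nonneg (cutoff_nonneg _ _ _)]; exact cutoff_le_one _ _ _

lemma maxCutoff_nonneg (a ε : ℝ) (x : EuclideanSpace ℝ ι) : 0 ≤ maxCutoff a ε x :=
  Finset.prod_nonneg fun _ _ => cutoff_nonneg _ _ _

lemma maxCutoff_le_one (a ε : ℝ) (x : EuclideanSpace ℝ ι) : maxCutoff a ε x ≤ 1 :=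
  Finset.prod_le_one (fun _ _ => cutoff_nonneg _ _ _) fun _ _ => cutoff_le_one _ _ _

lemma maxCutoff_eq_one {a ε : ℝ} (hε : 0 < ε) {x : EuclideanSpace ℝ ι} (h : ∀ j, x j ≤ a) :
    maxCutoff a ε x = 1 := by
  refine Finset.prod_eq_one fun j _ => ?_
  have : 1 ≤ (a + ε - x j) / ε := by rw [le_div_iff₀ hε]; linarith [h j]
  rw [cutoff, min_eq_left this, max_eq_right zero_le_one]

lemma maxCutoff_eq_zero {a ε : ℝ} (hε : 0 < ε) {x : EuclideanSpace ℝ ι} {j : ι}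
    (h : a + ε < x j) : maxCutoff a ε x = 0 := by
  refine Finset.prod_eq_zero (Finset.mem_univ j) ?_
  have : (a + ε - x j) / ε ≤ 0 := div_nonpos_of_nonpos_of_nonneg (by linarith) hε.le
  rw [cutoff, max_eq_left ((min_le_right _ _).trans this)]

lemma measurableSet_forall_le (a : ℝ) : MeasurableSet {x : EuclideanSpace ℝ ι | ∀ j, x j ≤ a} := by
  have : {x : EuclideanSpace ℝ ι | ∀ j, x j ≤ a} = ⋂ j, {x | x j ≤ a} := by ext; simp
  rw [this]
  exact .iInter fun j => measurableSet_le (by fun_prop) measurable_const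

lemma maxCutoff_le_indicator {a ε : ℝ} (hε : 0 < ε) (x : EuclideanSpace ℝ ι) :
    maxCutoff a ε x ≤ {x : EuclideanSpace ℝ ι | ∀ j, x j ≤ a + ε}.indicator (fun _ => (1 : ℝ)) x := by
  by_cases h : ∀ j, x j ≤ a + ε
  · rw [Set.indicator_of_mem (by exact h)]
    exact maxCutoff_le_one _ _ _
  · rw [Set.indicator_of_notMem (by exact h)]
    push Not at h
    obtain ⟨j, hj⟩ := h
    exact (maxCutoff_eq_zero hε hj).le

lemma indicator_le_maxCutoff {a ε : ℝ} (hε : 0 < ε) (x : EuclideanSpace ℝ ι) :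
    {x : EuclideanSpace ℝ ι | ∀ j, x j ≤ a}.indicator (fun _ => (1 : ℝ)) x ≤ maxCutoff a ε x := by
  by_cases h : ∀ j, x j ≤ a
  · rw [Set.indicator_of_mem (by exact h), maxCutoff_eq_one hε h]
  · rw [Set.indicator_of_notMem (by exact h)]
    exact maxCutoff_nonneg _ _ _

variable {Ω : Type*} [MeasurableSpace Ω] {m : Measure Ω} [IsProbabilityMeasure m]

lemma integrable_maxCutoff {X : Ω → EuclideanSpace ℝ ι} (hX : AEMeasurable X m) (a ε : ℝ) :
    Integrable (fun ω => maxCutoff a ε (X ω)) m :=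
  Integrable.of_bound ((maxCutoff a ε).continuous.measurable.comp_aemeasurable hX).aestronglyMeasurable
    1 (.of_forall fun ω => by
      rw [Real.norm_eq_abs, abs_of_nonneg (maxCutoff_nonneg _ _ _)]
      exact maxCutoff_le_one _ _ _)

lemma integral_maxCutoff_le {X : Ω → EuclideanSpace ℝ ι} (hX : AEMeasurable X m) {a ε : ℝ}
    (hε : 0 < ε) : ∫ ω, maxCutoff a ε (X ω) ∂m ≤ m.real {ω | ∀ j, X ω j ≤ a + ε} := by
  have hm := hX.nullMeasurableSet_preimage (measurableSet_forall_le (ι := ι) (a + ε))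
  calc ∫ ω, maxCutoff a ε (X ω) ∂m ≤
        ∫ ω, (X ⁻¹' {x | ∀ j, x j ≤ a + ε}).indicator (fun _ => (1 : ℝ)) ω ∂m :=
        integral_mono (integrable_maxCutoff hX a ε) ((integrable_const _).indicator₀ hm)
          fun ω => maxCutoff_le_indicator hε (X ω)
    _ = _ := by
        rw [integral_indicator₀ hm]; simp

lemma le_integral_maxCutoff {X : Ω → EuclideanSpace ℝ ι} (hX : AEMeasurable X m) {a ε : ℝ}
    (hε : 0 < ε) : m.real {ω | ∀ j, X ω j ≤ a} ≤ ∫ ω, maxCutoff a ε (X ω) ∂m := by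
  have hm := hX.nullMeasurableSet_preimage (measurableSet_forall_le (ι := ι) a)
  calc m.real {ω | ∀ j, X ω j ≤ a} =
        ∫ ω, (X ⁻¹' {x | ∀ j, x j ≤ a}).indicator (fun _ => (1 : ℝ)) ω ∂m := by
        rw [integral_indicator₀ hm]; simp
    _ ≤ _ := integral_mono ((integrable_const _).indicator₀ hm) (integrable_maxCutoff hX a ε)
          fun ω => indicator_le_maxCutoff hε (X ω)

end Cutoff

/-! ### Stability of the quantiles of a Gaussian maximum -/

section Quantile

variable {ι : Type*} [Fintype ι] [LinearOrder ι]

lemma gaussianReal_real_Ioi_pos (a : ℝ) : 0 < (gaussianReal 0 1).real (Set.Ioi a) := by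
  refine ENNReal.toReal_pos (fun h => ?_) (measure_ne_top _ _)
  have := gaussianReal_absolutelyContinuous' 0 one_ne_zero h
  simp at this

/-- An approximate quantile q, with distribution function at most p at q and above p at q + ε, makes
continuity of the distribution function unnecessary. The window from q − 5ε to q + ε has length 6ε,
and anti-concentration bounds its mass. The 5ε are used up later: ε for each of two cut-off
functions and 3ε for the comparison in `le_ncard_of_critValue_lt_div`. -/
lemma exists_quantile_max [Nonempty ι] {S : Matrix ι ι ℝ} (hS : S.PosSemidef)
    (hS1 : ∀ i, S i i = 1) {p C ε : ℝ} (hp : 0 < p) (hε : 0 < ε) (hε1 : ε ≤ 1)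
    (hC : p < (multivariateGaussian 0 S).real {x | ∀ j, x j ≤ C}) :
    ∃ q, (multivariateGaussian 0 S).real {x | ∀ j, x j ≤ q} ≤ p ∧
      p ≤ (multivariateGaussian 0 S).real {x | ∀ j, x j ≤ q - 5 * ε} +
        6 * ε / (gaussianReal 0 1).real (Set.Ioi (C + 1)) := by
  set ν := multivariateGaussian (0 : EuclideanSpace ℝ ι) S with hν
  let T : Set ℝ := {q | ν.real {x | ∀ j, x j ≤ q} ≤ p}
  obtain ⟨j₀⟩ := ‹Nonempty ι›
  have hTne : T.Nonempty := by
    have hm : Measurable fun x : EuclideanSpace ℝ ι => x j₀ := by fun_prop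
    have := Measure.isProbabilityMeasure_map (μ := ν) hm.aemeasurable
    obtain ⟨q, hq⟩ := ((tendsto_cdf_atBot (ν.map fun x => x j₀)).eventually
      (gt_mem_nhds hp)).exists
    rw [cdf_eq_real, map_measureReal_apply hm measurableSet_Iic] at hq
    have hsub : {x : EuclideanSpace ℝ ι | ∀ j, x j ≤ q} ⊆ (fun x => x j₀) ⁻¹' Set.Iic q :=
      fun x hx => hx j₀
    exact ⟨q, (measureReal_mono hsub).trans hq.le⟩
  have hTC : ∀ q ∈ T, q ≤ C := fun q hq => by
    by_contra hc
    -- Monotonicity of the distribution function: beyond C it exceeds p.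
    exact absurd ((measureReal_mono (μ := ν)
      (fun x (hx : ∀ j, x j ≤ C) j => (hx j).trans (not_le.1 hc).le)).trans hq) (not_le.2 hC)
  have hbdd : BddAbove T := ⟨C, hTC⟩
  obtain ⟨q, hq, hlt⟩ := exists_lt_of_lt_csSup hTne (sub_lt_self (sSup T) hε)
  have hq' : p < ν.real {x | ∀ j, x j ≤ q + ε} := by
    by_contra hc
    have := le_csSup hbdd (show q + ε ∈ T from not_lt.1 hc)
    linarith
  refine ⟨q, hq, ?_⟩
  set κ := (gaussianReal 0 1).real (Set.Ioi (C + 1)) with hκ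
  have hκ0 : 0 < κ := gaussianReal_real_Ioi_pos _
  let D : Set (EuclideanSpace ℝ ι) := {x | (∀ j, x j ≤ q + ε) ∧ ∃ j, q - 5 * ε < x j}
  have hD : ν.real D ≤ 6 * ε / κ := by
    rw [le_div_iff₀ hκ0]
    have h1 := multivariateGaussian_max_mem_Ioc_mul_le hS hS1 (q - 5 * ε) (q + ε)
    have h2 : q + ε - (q - 5 * ε) = 6 * ε := by ring
    rw [h2] at h1
    have h3 := ENNReal.toReal_mono ENNReal.ofReal_ne_top h1
    rw [ENNReal.toReal_mul, ENNReal.toReal_ofReal (by positivity)] at h3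
    refine le_trans (mul_le_mul_of_nonneg_left ?_ measureReal_nonneg) h3
    exact measureReal_mono (Set.Ioi_subset_Ioi (by linarith [hTC q hq]))
  have hsub : {x : EuclideanSpace ℝ ι | ∀ j, x j ≤ q + ε} ⊆
      {x | ∀ j, x j ≤ q - 5 * ε} ∪ D := fun x hx => by
    by_cases h : ∀ j, x j ≤ q - 5 * ε
    · exact Or.inl h
    · push Not at h
      exact Or.inr ⟨hx, h⟩
  linarith [(measureReal_mono (μ := ν) hsub).trans (measureReal_union_le _ _)]

end Quantile

/-! ### Tightness and equicontinuity of the standardized two-sample empirical process -/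

section Tightness

variable {𝒴 : Type*} [MeasurableSpace 𝒴]

/-- On each cell of a partition with oscillation at most 1, the process is within 1 of its value at
a representative, and Chebyshev's inequality bounds the finitely many representatives. -/
lemma IsDonsker.exists_bound {F : Set (𝒴 → ℝ)} {P : Measure 𝒴} [IsProbabilityMeasure P]
    (hF : IsDonsker F P) {η : ℝ} (hη : 0 < η) :
    ∃ C : ℝ, 0 < C ∧ ∀ᶠ n in atTop, Measure.pi (fun _ => P)
      {x : Fin n → 𝒴 | ∃ f ∈ F, C < |empDeviation P n x f|} ≤ ENNReal.ofReal η := by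
  classical
  obtain ⟨N, π, hπ⟩ := hF.exists_coloring (ε := 1) (η := η / 2) one_pos (by positivity)
  rcases isEmpty_or_nonempty F with hemp | hne
  · refine ⟨1, one_pos, .of_forall fun n => ?_⟩
    have : {x : Fin n → 𝒴 | ∃ f ∈ F, 1 < |empDeviation P n x f|} = ∅ := by
      ext x
      simp only [Set.mem_ofPred_eq, Set.mem_empty_iff_false, iff_false]
      rintro ⟨f, hf, -⟩
      exact hemp.elim ⟨f, hf⟩
    simp [this]
  let e : Fin N → F := fun i => Function.invFun π i
  have he : ∀ f : F, π (e (π f)) = π f := fun f => Function.invFun_eq ⟨f, rfl⟩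
  let V : ℝ := ∑ i, stdDev P (e i) ^ 2
  have hV : 0 ≤ V := Finset.sum_nonneg fun _ _ => sq_nonneg _
  let C : ℝ := √(2 * (V + 1) * N / η) + 1
  have hC1 : 1 ≤ C := le_add_of_nonneg_left (Real.sqrt_nonneg _)
  have hC2 : 2 * V * N / η ≤ C ^ 2 := by
    calc 2 * V * N / η ≤ 2 * (V + 1) * N / η := by gcongr; linarith
      _ = √(2 * (V + 1) * N / η) ^ 2 := (Real.sq_sqrt (by positivity)).symm
      _ ≤ C ^ 2 := pow_le_pow_left₀ (Real.sqrt_nonneg _) (by simp [C]) 2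
  refine ⟨C + 1, by linarith, ?_⟩
  filter_upwards [hπ, eventually_gt_atTop 0] with n hn hn0
  have hsub : {x : Fin n → 𝒴 | ∃ f ∈ F, C + 1 < |empDeviation P n x f|} ⊆
      {x | ∃ f g : F, π f = π g ∧ 1 < |empDeviation P n x f - empDeviation P n x g|} ∪
        ⋃ i, {x | C < |empDeviation P n x (e i)|} := by
    rintro x ⟨f, hf, hlt⟩
    by_contra hc
    simp only [Set.mem_union, Set.mem_iUnion, not_or, Set.mem_ofPred_eq, not_exists, not_and,
      not_lt] at hc
    have h1 := hc.1 ⟨f, hf⟩ (e (π ⟨f, hf⟩)) (he _).symm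
    have h2 := hc.2 (π ⟨f, hf⟩)
    have h3 := abs_sub_abs_le_abs_sub (empDeviation P n x f) (empDeviation P n x (e (π ⟨f, hf⟩)))
    simp only at h1
    linarith
  refine (measure_mono hsub).trans ((measure_union_le _ _).trans ?_)
  refine (add_le_add hn ((measure_iUnion_fintype_le _ _).trans (Finset.sum_le_sum fun i _ =>
    measure_lt_abs_empDeviation_le (hF.memLp (e i).2) hn0 (by linarith)))).trans ?_
  rw [← ENNReal.ofReal_sum_of_nonneg fun _ _ => by positivity,
    ← ENNReal.ofReal_add (by positivity) (Finset.sum_nonneg fun _ _ => by positivity),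
    ← Finset.sum_div]
  refine ENNReal.ofReal_le_ofReal ?_
  have hN : (1 : ℝ) ≤ N := by
    obtain ⟨f⟩ := hne
    exact_mod_cast (π f).pos
  have : V / C ^ 2 ≤ η / 2 := by
    rw [div_le_iff₀ (by positivity)]
    have h1 : 2 * V * N ≤ C ^ 2 * η := (div_le_iff₀ hη).1 hC2
    nlinarith
  linarith

variable {Pa Pb : Measure 𝒴} [IsProbabilityMeasure Pa] [IsProbabilityMeasure Pb]
  {F : Set (𝒴 → ℝ)} {na nb : ℕ → ℕ} {lam : ℝ}

lemma eventually_sqrt_ratio_le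
    (hlam : Tendsto (fun k => (na k : ℝ) / (nb k : ℝ)) atTop (𝓝 lam)) :
    ∀ᶠ k in atTop, √((na k : ℝ) / nb k) ≤ √lam + 1 :=
  (hlam.sqrt.eventually (gt_mem_nhds (lt_add_one _))).mono fun _ h => le_of_lt h

lemma exists_bound_twoSampleEmp (hFa : IsDonsker F Pa) (hFb : IsDonsker F Pb)
    (hna : Tendsto na atTop atTop) (hnb : Tendsto nb atTop atTop)
    (hlam : Tendsto (fun k => (na k : ℝ) / (nb k : ℝ)) atTop (𝓝 lam)) {η : ℝ} (hη : 0 < η) :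
    ∃ C : ℝ, 0 < C ∧ ∀ᶠ k in atTop, ((Measure.pi fun _ => Pa).prod (Measure.pi fun _ => Pb))
      {p : (Fin (na k) → 𝒴) × (Fin (nb k) → 𝒴) | ∃ f ∈ F,
        C < |twoSampleEmp Pa Pb p.1 p.2 f|} ≤ ENNReal.ofReal η := by
  obtain ⟨Ca, hCa, ha⟩ := hFa.exists_bound (η := η / 2) (by positivity)
  obtain ⟨Cb, hCb, hb⟩ := hFb.exists_bound (η := η / 2) (by positivity)
  refine ⟨Ca + (√lam + 1) * Cb, by positivity, ?_⟩
  filter_upwards [hna.eventually ha, hnb.eventually hb, eventually_sqrt_ratio_le hlam]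
    with k hka hkb hρ
  have hsub : {p : (Fin (na k) → 𝒴) × (Fin (nb k) → 𝒴) | ∃ f ∈ F,
      Ca + (√lam + 1) * Cb < |twoSampleEmp Pa Pb p.1 p.2 f|} ⊆
      (Prod.fst ⁻¹' {x | ∃ f ∈ F, Ca < |empDeviation Pa (na k) x f|}) ∪
      (Prod.snd ⁻¹' {x | ∃ f ∈ F, Cb < |empDeviation Pb (nb k) x f|}) := by
    rintro p ⟨f, hf, hlt⟩
    by_contra hc
    simp only [Set.mem_union, Set.mem_preimage, Set.mem_ofPred_eq, not_or, not_exists, not_and,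
      not_lt] at hc
    have h1 := hc.1 f hf
    have h2 := hc.2 f hf
    have h3 : |twoSampleEmp Pa Pb p.1 p.2 f| ≤ |empDeviation Pa (na k) p.1 f| +
        √((na k : ℝ) / nb k) * |empDeviation Pb (nb k) p.2 f| := by
      rw [twoSampleEmp]
      refine (abs_sub _ _).trans (le_of_eq ?_)
      rw [abs_mul, abs_of_nonneg (Real.sqrt_nonneg _)]
    have h4 : √((na k : ℝ) / nb k) * |empDeviation Pb (nb k) p.2 f| ≤ (√lam + 1) * Cb :=
      mul_le_mul hρ h2 (abs_nonneg _) (by positivity)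
    linarith
  refine (measure_mono hsub).trans ((measure_union_le _ _).trans ((add_le_add
    ((prod_measure_preimage_fst_le _ _ _).trans hka)
    ((prod_measure_preimage_snd_le _ _ _).trans hkb)).trans (le_of_eq ?_)))
  rw [← ENNReal.ofReal_add (by positivity) (by positivity)]
  congr 1
  ring

/-- The cells are common refinements of those for the two samples and of level sets of u on a grid.
In u_f Z_f − u_g Z_g, half of ε is spent on the increment of Z and half on that of u, for which Z
has to be bounded. -/
lemma exists_coloring_twoSampleEmp (hFa : IsDonsker F Pa) (hFb : IsDonsker F Pb)
    (hna : Tendsto na atTop atTop) (hnb : Tendsto nb atTop atTop)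
    (hlam : Tendsto (fun k => (na k : ℝ) / (nb k : ℝ)) atTop (𝓝 lam)) {u : (𝒴 → ℝ) → ℝ} {K : ℝ}
    (hK : 0 < K) (hu0 : ∀ f ∈ F, 0 ≤ u f) (hu : ∀ f ∈ F, u f ≤ K) {ε η : ℝ} (hε : 0 < ε)
    (hη : 0 < η) :
    ∃ (N : ℕ) (π : F → Fin N), ∀ᶠ k in atTop,
      ((Measure.pi fun _ => Pa).prod (Measure.pi fun _ => Pb))
      {p : (Fin (na k) → 𝒴) × (Fin (nb k) → 𝒴) | ∃ f g : F, π f = π g ∧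
        ε < |u f * twoSampleEmp Pa Pb p.1 p.2 f - u g * twoSampleEmp Pa Pb p.1 p.2 g|} ≤
      ENNReal.ofReal η := by
  obtain ⟨C, hC, hbd⟩ := exists_bound_twoSampleEmp hFa hFb hna hnb hlam (η := η / 3) (by positivity)
  let L : ℝ := √lam + 1
  have hL : 0 < L := by positivity
  obtain ⟨Na, πa, ha⟩ := hFa.exists_coloring (ε := ε / (4 * K)) (η := η / 3) (by positivity)
    (by positivity)
  obtain ⟨Nb, πb, hb⟩ := hFb.exists_coloring (ε := ε / (4 * K * L)) (η := η / 3) (by positivity)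
    (by positivity)
  -- On a cell u varies by at most δ, and |Z| ≤ C turns this into ε / 2.
  let δ : ℝ := ε / (2 * C)
  have hδ : 0 < δ := by positivity
  let φ : F → Fin Na × Fin Nb × ℤ := fun f => (πa f, πb f, ⌊u f / δ⌋)
  have hfin : (Set.range φ).Finite := by
    refine ((Set.finite_univ (α := Fin Na)).prod ((Set.finite_univ (α := Fin Nb)).prod
      (Set.finite_Icc 0 ⌊K / δ⌋))).subset ?_
    rintro _ ⟨f, rfl⟩
    refine ⟨trivial, trivial, Int.floor_nonneg.2 (div_nonneg (hu0 f f.2) hδ.le),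
      Int.floor_le_floor ?_⟩
    have := hu f f.2
    gcongr
  obtain ⟨N, π, -, hπ⟩ := exists_fin_coloring φ hfin
  refine ⟨N, π, ?_⟩
  filter_upwards [hbd, hna.eventually ha, hnb.eventually hb, eventually_sqrt_ratio_le hlam]
    with k hk hka hkb hρ
  have hsub : {p : (Fin (na k) → 𝒴) × (Fin (nb k) → 𝒴) | ∃ f g : F, π f = π g ∧
      ε < |u f * twoSampleEmp Pa Pb p.1 p.2 f - u g * twoSampleEmp Pa Pb p.1 p.2 g|} ⊆
      {p | ∃ f ∈ F, C < |twoSampleEmp Pa Pb p.1 p.2 f|} ∪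
      ((Prod.fst ⁻¹' {x | ∃ f g : F, πa f = πa g ∧
        ε / (4 * K) < |empDeviation Pa (na k) x f - empDeviation Pa (na k) x g|}) ∪
      (Prod.snd ⁻¹' {x | ∃ f g : F, πb f = πb g ∧
        ε / (4 * K * L) < |empDeviation Pb (nb k) x f - empDeviation Pb (nb k) x g|})) := by
    rintro p ⟨f, g, hfg, hlt⟩
    by_contra hc
    simp only [Set.mem_union, Set.mem_preimage, Set.mem_ofPred_eq, not_or, not_exists, not_and,
      not_lt] at hc
    obtain ⟨hc1, hc2, hc3⟩ := hc
    have hφ := hπ f g hfg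
    simp only [φ, Prod.mk.injEq] at hφ
    have h1 := hc1 g g.2
    have h2 := hc2 f g hφ.1
    have h3 := hc3 f g hφ.2.1
    have h4 : |u f - u g| ≤ δ := by
      have := Int.abs_sub_lt_one_of_floor_eq_floor hφ.2.2
      rw [← sub_div, abs_div, abs_of_pos hδ, div_lt_one hδ] at this
      exact this.le
    set Zf := twoSampleEmp Pa Pb p.1 p.2 f
    set Zg := twoSampleEmp Pa Pb p.1 p.2 g
    set Ea := empDeviation Pa (na k) p.1 f - empDeviation Pa (na k) p.1 g
    set Eb := empDeviation Pb (nb k) p.2 f - empDeviation Pb (nb k) p.2 g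
    have h5 : Zf - Zg = Ea - √((na k : ℝ) / nb k) * Eb := by
      simp only [Zf, Zg, Ea, Eb, twoSampleEmp]; ring
    have h6 : |Zf - Zg| ≤ ε / (2 * K) := by
      rw [h5]
      refine (abs_sub _ _).trans ?_
      rw [abs_mul, abs_of_nonneg (Real.sqrt_nonneg _)]
      have : √((na k : ℝ) / nb k) * |Eb| ≤ L * (ε / (4 * K * L)) :=
        mul_le_mul hρ h3 (abs_nonneg _) hL.le
      calc |Ea| + √((na k : ℝ) / nb k) * |Eb| ≤ ε / (4 * K) + L * (ε / (4 * K * L)) :=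
            add_le_add h2 this
        _ = ε / (2 * K) := by field_simp; ring
    have h7 : u f * Zf - u g * Zg = u f * (Zf - Zg) + (u f - u g) * Zg := by ring
    rw [h7] at hlt
    have h8 : |u f * (Zf - Zg)| ≤ ε / 2 := by
      rw [abs_mul, abs_of_nonneg (hu0 f f.2)]
      calc _ ≤ K * (ε / (2 * K)) := mul_le_mul (hu f f.2) h6 (abs_nonneg _) hK.le
        _ = ε / 2 := by field_simp
    have h9 : |(u f - u g) * Zg| ≤ ε / 2 := by
      rw [abs_mul]
      calc _ ≤ δ * C := mul_le_mul h4 h1 (abs_nonneg _) hδ.le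
        _ = ε / 2 := by simp only [δ]; field_simp
    linarith [abs_add_le (u f * (Zf - Zg)) ((u f - u g) * Zg)]
  refine (measure_mono hsub).trans ((measure_union_le _ _).trans ((add_le_add hk
    ((measure_union_le _ _).trans (add_le_add
    ((prod_measure_preimage_fst_le _ _ _).trans hka)
    ((prod_measure_preimage_snd_le _ _ _).trans hkb)))).trans (le_of_eq ?_)))
  rw [← ENNReal.ofReal_add (by positivity) (by positivity),
    ← ENNReal.ofReal_add (by positivity) (by positivity)]
  congr 1
  ring

end Tightness

/-! ### Laws of the data and of pairs of bootstrap draws -/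

section Laws

variable {𝒴 Ω : Type*} [MeasurableSpace 𝒴] [MeasurableSpace Ω] {μ : Measure Ω}
  [IsProbabilityMeasure μ] {Pa Pb : Measure 𝒴} [IsProbabilityMeasure Pa] [IsProbabilityMeasure Pb]
  {Ya Yb : ℕ → Ω → 𝒴}

omit [IsProbabilityMeasure μ] in
lemma ProbabilityTheory.HasLaw.measure_preimage_le {X : Type*} [MeasurableSpace X] {D : Ω → X} {ν : Measure X}
    (hD : HasLaw D ν μ) (s : Set X) : μ {ω | D ω ∈ s} ≤ ν s := by
  rw [← hD.map_eq]
  exact Measure.le_map_apply hD.aemeasurable s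

omit [IsProbabilityMeasure Pa] [IsProbabilityMeasure Pb] in
lemma hasLaw_twoSample (hYa : ∀ i, HasLaw (Ya i) Pa μ) (hYb : ∀ i, HasLaw (Yb i) Pb μ)
    (hYa_indep : iIndepFun Ya μ) (hYb_indep : iIndepFun Yb μ)
    (hYab : IndepFun (fun ω i => Ya i ω) (fun ω i => Yb i ω) μ) (na nb : ℕ) :
    HasLaw (fun ω => ((fun i : Fin na => Ya i ω), (fun i : Fin nb => Yb i ω)))
      ((Measure.pi fun _ => Pa).prod (Measure.pi fun _ => Pb)) μ := by
  have ha : HasLaw (fun ω (i : Fin na) => Ya i ω) (Measure.pi fun _ => Pa) μ :=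
    iIndepFun.hasLaw_pi (X := fun (i : Fin na) ω => Ya i ω) (fun i => hYa i)
      (hYa_indep.precomp Fin.val_injective)
  have hb : HasLaw (fun ω (i : Fin nb) => Yb i ω) (Measure.pi fun _ => Pb) μ :=
    iIndepFun.hasLaw_pi (X := fun (i : Fin nb) ω => Yb i ω) (fun i => hYb i)
      (hYb_indep.precomp Fin.val_injective)
  have h : IndepFun (fun ω (i : Fin na) => Ya i ω) (fun ω (i : Fin nb) => Yb i ω) μ :=
    hYab.comp (φ := fun (y : ℕ → 𝒴) (i : Fin na) => y i)
      (ψ := fun (y : ℕ → 𝒴) (i : Fin nb) => y i) (by fun_prop) (by fun_prop)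
  exact h.hasLaw_prod ha hb

omit [IsProbabilityMeasure Pa] [IsProbabilityMeasure Pb] in
lemma hasLaw_bootModel (hYa : ∀ i, HasLaw (Ya i) Pa μ) (hYb : ∀ i, HasLaw (Yb i) Pb μ)
    (hYa_indep : iIndepFun Ya μ) (hYb_indep : iIndepFun Yb μ)
    (hYab : IndepFun (fun ω i => Ya i ω) (fun ω i => Yb i ω) μ) {na nb R : ℕ}
    {Qa : Measure (Fin na → ℝ)} {Qb : Measure (Fin nb → ℝ)} [IsProbabilityMeasure Qa]
    [IsProbabilityMeasure Qb] {Wa : Fin R → Ω → Fin na → ℝ} {Wb : Fin R → Ω → Fin nb → ℝ}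
    (hWa : ∀ r, HasLaw (Wa r) Qa μ) (hWb : ∀ r, HasLaw (Wb r) Qb μ)
    (hWa_indep : iIndepFun Wa μ) (hWb_indep : iIndepFun Wb μ)
    (hWab : IndepFun (fun ω r => Wa r ω) (fun ω r => Wb r ω) μ)
    (hYW : IndepFun (fun ω => ((fun i => Ya i ω), (fun i => Yb i ω)))
      (fun ω => ((fun r => Wa r ω), (fun r => Wb r ω))) μ) {r r' : Fin R} (hr : r ≠ r') :
    HasLaw (fun ω => (((Wa r ω, Wa r' ω), (Wb r ω, Wb r' ω)),
      ((fun i : Fin na => Ya i ω), (fun i : Fin nb => Yb i ω)))) (bootModel Pa Pb Qa Qb) μ := by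
  have ha := (hWa_indep.indepFun hr).hasLaw_prod (hWa r) (hWa r')
  have hb := (hWb_indep.indepFun hr).hasLaw_prod (hWb r) (hWb r')
  have hab : IndepFun (fun ω => (Wa r ω, Wa r' ω)) (fun ω => (Wb r ω, Wb r' ω)) μ :=
    hWab.comp (φ := fun w : Fin R → Fin na → ℝ => (w r, w r'))
      (ψ := fun w : Fin R → Fin nb → ℝ => (w r, w r')) (by fun_prop) (by fun_prop)
  have hW := hab.hasLaw_prod ha hb
  have hY := hasLaw_twoSample hYa hYb hYa_indep hYb_indep hYab na nb
  have hWY : IndepFun (fun ω => ((Wa r ω, Wa r' ω), (Wb r ω, Wb r' ω)))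
      (fun ω => ((fun i : Fin na => Ya i ω), (fun i : Fin nb => Yb i ω))) μ :=
    hYW.symm.comp
      (φ := fun w : (Fin R → Fin na → ℝ) × (Fin R → Fin nb → ℝ) =>
        ((w.1 r, w.1 r'), (w.2 r, w.2 r')))
      (ψ := fun y : (ℕ → 𝒴) × (ℕ → 𝒴) => ((fun i : Fin na => y.1 i), (fun i : Fin nb => y.2 i)))
      (by fun_prop) (by fun_prop)
  exact hWY.hasLaw_prod hW hY

end Laws

/-! ### Homogeneity of the processes and of the limit variance -/

section Scaling

variable {𝒴 : Type*}

lemma twoSampleBoot_const_mul {na nb : ℕ} (c : ℝ) (xa : Fin na → 𝒴) (xb : Fin nb → 𝒴)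
    (wa : Fin na → ℝ) (wb : Fin nb → ℝ) (a : ℝ) (g : 𝒴 → ℝ) :
    twoSampleBoot c xa xb wa wb (fun y => a * g y) = a * twoSampleBoot c xa xb wa wb g := by
  have h : ∀ {n : ℕ} (w : Fin n → ℝ) (x : Fin n → 𝒴),
      bootSum w x (fun y => a * g y) = a * bootSum w x g := fun w x => by
    simp only [bootSum, mul_left_comm _ a, ← Finset.mul_sum]
  rw [twoSampleBoot, twoSampleBoot, h, h]
  ring

variable [MeasurableSpace 𝒴] (Pa Pb : Measure 𝒴)

lemma twoSampleEmp_const_mul {na nb : ℕ} (xa : Fin na → 𝒴) (xb : Fin nb → 𝒴) (a : ℝ)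
    (g : 𝒴 → ℝ) :
    twoSampleEmp Pa Pb xa xb (fun y => a * g y) = a * twoSampleEmp Pa Pb xa xb g := by
  have h : ∀ (P : Measure 𝒴) (n : ℕ) (x : Fin n → 𝒴),
      empDeviation P n x (fun y => a * g y) = a * empDeviation P n x g := fun P n x => by
    simp only [empDeviation, integral_const_mul, ← Finset.mul_sum]
    ring
  rw [twoSampleEmp, twoSampleEmp, h, h]
  ring

lemma limitVar_const_mul (lam a : ℝ) (g : 𝒴 → ℝ) :
    limitVar Pa Pb lam (fun y => a * g y) = a ^ 2 * limitVar Pa Pb lam g := by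
  have h : ∀ P : Measure 𝒴, stdDev P (fun y => a * g y) ^ 2 = a ^ 2 * stdDev P g ^ 2 := fun P => by
    rw [sq_stdDev, sq_stdDev, ← integral_const_mul]
    simp only [integral_const_mul, ← mul_sub, mul_pow]
  rw [limitVar, limitVar, h, h]
  ring

end Scaling

/-! ### The familywise error rate -/

section FiniteNet

variable {𝒴 Ω : Type*} [MeasurableSpace 𝒴] [MeasurableSpace Ω] {μ : Measure Ω}
  [IsProbabilityMeasure μ] {Pa Pb : Measure 𝒴} [IsProbabilityMeasure Pa] [IsProbabilityMeasure Pb]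
  {ι : Type*} [Fintype ι] [DecidableEq ι]

/-- The joint law of two distinct replications and the data does not depend on the pair, so all
correlations equal one number v_k. It tends to (∫ f dν)² = 0, and the variance of the average over
replications is of order 1 / R_k + |v_k|. -/
lemma tendsto_measure_le_sum_twoSampleBoot
    (Ya Yb : ℕ → Ω → 𝒴)
    (hYa : ∀ i, HasLaw (Ya i) Pa μ) (hYb : ∀ i, HasLaw (Yb i) Pb μ)
    (hYa_indep : iIndepFun Ya μ) (hYb_indep : iIndepFun Yb μ)
    (hYab : IndepFun (fun ω i => Ya i ω) (fun ω i => Yb i ω) μ)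
    (na nb : ℕ → ℕ) (lam : ℝ) (hna : Tendsto na atTop atTop) (hnb : Tendsto nb atTop atTop)
    (hlam : Tendsto (fun k => (na k : ℝ) / (nb k : ℝ)) atTop (𝓝 lam)) (hlam0 : 0 ≤ lam)
    (Qa Qb : ∀ n : ℕ, Measure (Fin n → ℝ)) (c : ℝ)
    (hQa : IsBootstrapWeightLaw Qa c) (hQb : IsBootstrapWeightLaw Qb c)
    (R : ℕ → ℕ) (hR : Tendsto R atTop atTop)
    (Wa : ∀ k, Fin (R k) → Ω → Fin (na k) → ℝ) (Wb : ∀ k, Fin (R k) → Ω → Fin (nb k) → ℝ)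
    (hWa : ∀ k r, HasLaw (Wa k r) (Qa (na k)) μ) (hWb : ∀ k r, HasLaw (Wb k r) (Qb (nb k)) μ)
    (hWa_indep : ∀ k, iIndepFun (Wa k) μ) (hWb_indep : ∀ k, iIndepFun (Wb k) μ)
    (hWab : ∀ k, IndepFun (fun ω r => Wa k r ω) (fun ω r => Wb k r ω) μ)
    (hYW : ∀ k, IndepFun (fun ω => ((fun i => Ya i ω), (fun i => Yb i ω)))
      (fun ω => ((fun r => Wa k r ω), (fun r => Wb k r ω))) μ)
    {g : ι → 𝒴 → ℝ} (hgm : ∀ j, Measurable (g j)) (hga : ∀ j, MemLp (g j) 2 Pa)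
    (hgb : ∀ j, MemLp (g j) 2 Pb) {f : EuclideanSpace ℝ ι →ᵇ ℝ} (hf1 : ∀ x, |f x| ≤ 1)
    (hf0 : ∫ x, f x ∂(limitLaw Pa Pb lam g) = 0) {η : ℝ} (hη : 0 < η) :
    Tendsto (fun k => μ {ω | η * R k ≤ ∑ r, f (WithLp.toLp 2 fun j =>
      twoSampleBoot c (fun i : Fin (na k) => Ya i ω) (fun i : Fin (nb k) => Yb i ω)
        (Wa k r ω) (Wb k r ω) (g j))}) atTop (𝓝 0) := by
  have := hQa.isProbability
  have := hQb.isProbability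
  have hlim := tendsto_integral_twoSampleBoot hQa hQb hna hnb hlam hlam0 hgm hga hgb f
  rw [hf0, zero_pow two_ne_zero] at hlim
  set v : ℕ → ℝ := fun k => ∫ p,
      f (WithLp.toLp 2 fun j => twoSampleBoot c p.2.1 p.2.2 p.1.1.1 p.1.2.1 (g j)) *
      f (WithLp.toLp 2 fun j => twoSampleBoot c p.2.1 p.2.2 p.1.1.2 p.1.2.2 (g j))
        ∂(bootModel Pa Pb (Qa (na k)) (Qb (nb k))) with hv
  have hbound : Tendsto (fun k => ENNReal.ofReal ((1 / (R k : ℝ) + |v k|) / η ^ 2)) atTop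
      (𝓝 0) := by
    have h1 : Tendsto (fun k => 1 / (R k : ℝ)) atTop (𝓝 0) :=
      tendsto_one_div_atTop_nhds_zero_nat.comp hR
    have h2 := ENNReal.tendsto_ofReal ((h1.add hlim.abs).div_const (η ^ 2))
    simpa using h2
  refine tendsto_of_tendsto_of_tendsto_of_le_of_le' tendsto_const_nhds hbound
    (.of_forall fun _ => zero_le) ?_
  filter_upwards [hR.eventually_gt_atTop 0] with k hk
  have hm1 : Measurable fun p : (((Fin (na k) → ℝ) × (Fin (na k) → ℝ)) ×
      ((Fin (nb k) → ℝ) × (Fin (nb k) → ℝ))) × ((Fin (na k) → 𝒴) × (Fin (nb k) → 𝒴)) =>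
      f (WithLp.toLp 2 fun j => twoSampleBoot c p.2.1 p.2.2 p.1.1.1 p.1.2.1 (g j)) :=
    f.continuous.measurable.comp ((WithLp.measurable_toLp 2 _).comp
      (measurable_pi_lambda _ fun j => measurable_twoSampleBoot_fst c (hgm j)))
  have hm2 : Measurable fun p : (((Fin (na k) → ℝ) × (Fin (na k) → ℝ)) ×
      ((Fin (nb k) → ℝ) × (Fin (nb k) → ℝ))) × ((Fin (na k) → 𝒴) × (Fin (nb k) → 𝒴)) =>
      f (WithLp.toLp 2 fun j => twoSampleBoot c p.2.1 p.2.2 p.1.1.2 p.1.2.2 (g j)) :=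
    f.continuous.measurable.comp ((WithLp.measurable_toLp 2 _).comp
      (measurable_pi_lambda _ fun j => measurable_twoSampleBoot_snd c (hgm j)))
  refine measure_le_sum_le_of_integral_mul_eq hk (fun r => ?_) (fun r ω => hf1 _)
    (fun r r' hrr => ?_) hη
  · have hY := (hasLaw_twoSample hYa hYb hYa_indep hYb_indep hYab (na k) (nb k)).aemeasurable
    have hW : AEMeasurable (fun ω => ((Wa k r ω, Wa k r ω), (Wb k r ω, Wb k r ω))) μ :=
      ((hWa k r).aemeasurable.prodMk (hWa k r).aemeasurable).prodMk
        ((hWb k r).aemeasurable.prodMk (hWb k r).aemeasurable)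
    exact (hm1.comp_aemeasurable (hW.prodMk hY)).aestronglyMeasurable
  · have hlaw := hasLaw_bootModel hYa hYb hYa_indep hYb_indep hYab (hWa k) (hWb k) (hWa_indep k)
      (hWb_indep k) (hWab k) (hYW k) hrr
    exact hlaw.integral_comp (hm1.mul hm2).aestronglyMeasurable

lemma eventually_measure_exists_lt_twoSampleEmp_le {na nb : ℕ → ℕ} {lam : ℝ}
    (hna : Tendsto na atTop atTop) (hnb : Tendsto nb atTop atTop)
    (hlam : Tendsto (fun k => (na k : ℝ) / (nb k : ℝ)) atTop (𝓝 lam)) (hlam0 : 0 ≤ lam)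
    {g : ι → 𝒴 → ℝ} (hgm : ∀ j, Measurable (g j)) (hga : ∀ j, MemLp (g j) 2 Pa)
    (hgb : ∀ j, MemLp (g j) 2 Pb) {a ε β : ℝ} (hε : 0 < ε)
    (hβ : 1 - β < (limitLaw Pa Pb lam g).real {x | ∀ j, x j ≤ a}) :
    ∀ᶠ k in atTop, ((Measure.pi fun _ => Pa).prod (Measure.pi fun _ => Pb))
      {p : (Fin (na k) → 𝒴) × (Fin (nb k) → 𝒴) | ∃ j,
        a + ε < twoSampleEmp Pa Pb p.1 p.2 (g j)} ≤ ENNReal.ofReal β := by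
  have hlim := tendsto_integral_twoSampleEmp hna hnb hlam hlam0 hgm hga hgb (maxCutoff a ε)
  have h1 := hβ.trans_le (le_integral_maxCutoff (m := limitLaw Pa Pb lam g)
    (X := fun x => x) aemeasurable_id hε)
  filter_upwards [hlim.eventually (lt_mem_nhds h1)] with k hk
  set M := (Measure.pi fun _ : Fin (na k) => Pa).prod (Measure.pi fun _ : Fin (nb k) => Pb)
  have hX : Measurable fun p : (Fin (na k) → 𝒴) × (Fin (nb k) → 𝒴) =>
      (WithLp.toLp 2 fun j => twoSampleEmp Pa Pb p.1 p.2 (g j) : EuclideanSpace ℝ ι) :=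
    (WithLp.measurable_toLp 2 _).comp
      (measurable_pi_lambda _ fun j => measurable_twoSampleEmp Pa Pb (hgm j))
  have h2 := hk.trans_le (integral_maxCutoff_le hX.aemeasurable hε)
  have hset : {p : (Fin (na k) → 𝒴) × (Fin (nb k) → 𝒴) | ∃ j,
      a + ε < twoSampleEmp Pa Pb p.1 p.2 (g j)} =
      {p | ∀ j, twoSampleEmp Pa Pb p.1 p.2 (g j) ≤ a + ε}ᶜ := by
    ext p; simp
  have hmeas : MeasurableSet {p : (Fin (na k) → 𝒴) × (Fin (nb k) → 𝒴) |
      ∀ j, twoSampleEmp Pa Pb p.1 p.2 (g j) ≤ a + ε} := hX (measurableSet_forall_le (a + ε))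
  rw [hset, ← ofReal_measureReal, probReal_compl_eq_one_sub hmeas]
  exact ENNReal.ofReal_le_ofReal (by linarith [h2])

end FiniteNet

/-! ### Control of the error over an arbitrary subfamily S -/

section FamilywiseError

variable {𝒴 Ω : Type*} [MeasurableSpace 𝒴] [MeasurableSpace Ω]

/-- An upper bound on the statistics over S is all that is required of them, so that both centrings
are covered at once. -/
theorem limsup_measure_stepdownRejects_le
    (μ : Measure Ω) [IsProbabilityMeasure μ]
    (Pa Pb : Measure 𝒴) [IsProbabilityMeasure Pa] [IsProbabilityMeasure Pb]
    (F : Set (𝒴 → ℝ)) (hFa : IsDonsker F Pa) (hFb : IsDonsker F Pb)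
    (Ya Yb : ℕ → Ω → 𝒴)
    (hYa : ∀ i, HasLaw (Ya i) Pa μ) (hYb : ∀ i, HasLaw (Yb i) Pb μ)
    (hYa_indep : iIndepFun Ya μ) (hYb_indep : iIndepFun Yb μ)
    (hYab : IndepFun (fun ω i => Ya i ω) (fun ω i => Yb i ω) μ)
    (na nb : ℕ → ℕ) (lam : ℝ) (hna : Tendsto na atTop atTop) (hnb : Tendsto nb atTop atTop)
    (hlam : Tendsto (fun k => (na k : ℝ) / (nb k : ℝ)) atTop (𝓝 lam))
    (Qa Qb : ∀ n : ℕ, Measure (Fin n → ℝ)) (c : ℝ)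
    (hQa : IsBootstrapWeightLaw Qa c) (hQb : IsBootstrapWeightLaw Qb c)
    (R : ℕ → ℕ) (hR : Tendsto R atTop atTop)
    (Wa : ∀ k, Fin (R k) → Ω → Fin (na k) → ℝ) (Wb : ∀ k, Fin (R k) → Ω → Fin (nb k) → ℝ)
    (hWa : ∀ k r, HasLaw (Wa k r) (Qa (na k)) μ) (hWb : ∀ k r, HasLaw (Wb k r) (Qb (nb k)) μ)
    (hWa_indep : ∀ k, iIndepFun (Wa k) μ) (hWb_indep : ∀ k, iIndepFun (Wb k) μ)
    (hWab : ∀ k, IndepFun (fun ω r => Wa k r ω) (fun ω r => Wb k r ω) μ)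
    (hYW : ∀ k, IndepFun (fun ω => ((fun i => Ya i ω), (fun i => Yb i ω)))
      (fun ω => ((fun r => Wa k r ω), (fun r => Wb k r ω))) μ)
    (hσ : ∃ s : ℝ, 0 < s ∧ ∀ f ∈ F, s ≤ limitSD Pa Pb lam f ^ 2)
    (σhat : ℕ → Ω → (𝒴 → ℝ) → ℝ)
    (hσhat : ∀ ε : ℝ, 0 < ε → Tendsto
      (fun k => μ {ω | ∃ f ∈ F, ε < |σhat k ω f - limitSD Pa Pb lam f|}) atTop (𝓝 0))
    (α : ℝ) (hα0 : 0 < α) (hα1 : α < 1) {S : Set (𝒴 → ℝ)} (hSF : S ⊆ F)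
    (t : ℕ → Ω → (𝒴 → ℝ) → ℝ)
    (ht : ∀ k ω, 0 < nb k → ∀ f ∈ S, 0 < σhat k ω f → t k ω f ≤
      twoSampleEmp Pa Pb (fun i : Fin (na k) => Ya i ω) (fun i : Fin (nb k) => Yb i ω) f /
        σhat k ω f) :
    limsup (fun k => μ {ω | ∃ f ∈ S, f ∈ stepdownRejects F α
      (fun (r : Fin (R k)) f => bootProcess c (fun i => Ya i ω) (fun i => Yb i ω)
        (Wa k r ω) (Wb k r ω) f / σhat k ω f) (t k ω)}) atTop ≤ ENNReal.ofReal α := by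
  classical
  have hlam0 : 0 ≤ lam := ge_of_tendsto' hlam fun k => by positivity
  suffices H : ∀ ϑ : ℝ, 0 < ϑ → ∀ᶠ k in atTop, μ {ω | ∃ f ∈ S, f ∈ stepdownRejects F α
      (fun (r : Fin (R k)) f => bootProcess c (fun i => Ya i ω) (fun i => Yb i ω)
        (Wa k r ω) (Wb k r ω) f / σhat k ω f) (t k ω)} ≤ ENNReal.ofReal (α + ϑ) by
    have hlim : Tendsto (fun ϑ : ℝ => ENNReal.ofReal (α + ϑ)) (𝓝[>] 0) (𝓝 (ENNReal.ofReal α)) := by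
      refine ENNReal.tendsto_ofReal ?_
      have : Tendsto (fun ϑ : ℝ => α + ϑ) (𝓝 0) (𝓝 (α + 0)) := tendsto_const_nhds.add tendsto_id
      rw [add_zero] at this
      exact this.mono_left nhdsWithin_le_nhds
    refine ge_of_tendsto hlim ?_
    filter_upwards [self_mem_nhdsWithin] with ϑ hϑ
    exact limsup_le_of_le (by isBoundedDefault) (H ϑ hϑ)
  intro ϑ hϑ
  rcases S.eq_empty_or_nonempty with hSe | ⟨f₀, hf₀⟩
  · refine .of_forall fun k => ?_
    subst hSe
    simp
  obtain ⟨s₀, hs₀, hs₀F⟩ := hσ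
  set σ : (𝒴 → ℝ) → ℝ := limitSD Pa Pb lam with hσdef
  let s : ℝ := √s₀
  have hs : 0 < s := Real.sqrt_pos.2 hs₀
  have hσs : ∀ f ∈ F, s ≤ σ f := fun f hf =>
    Real.sqrt_le_iff.2 ⟨Real.sqrt_nonneg _, hs₀F f hf⟩
  have hu0 : ∀ f ∈ F, 0 ≤ (σ f)⁻¹ := fun f hf => inv_nonneg.2 (hs.le.trans (hσs f hf))
  have hu : ∀ f ∈ F, (σ f)⁻¹ ≤ s⁻¹ := fun f hf => inv_anti₀ hs (hσs f hf)
  -- Seven errors of size η are spent: one each for the bound on Z, the oscillation, the bootstrap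
  -- average and σ̂, and three in the Gaussian comparison. The bound (1 − α) / 2 keeps p positive.
  let η : ℝ := min (ϑ / 7) ((1 - α) / 2) ⊓ (α / 4)
  have hη : 0 < η := by
    have : 0 < 1 - α := by linarith
    positivity
  have hη1 : η ≤ ϑ / 7 := (min_le_left _ _).trans (min_le_left _ _)
  have hη2 : η ≤ (1 - α) / 2 := (min_le_left _ _).trans (min_le_right _ _)
  let p : ℝ := 1 - α - η
  have hp : 0 < p := by simp only [p]; linarith
  obtain ⟨C₁, hC₁, hbd₁⟩ := exists_bound_twoSampleEmp hFa hFb hna hnb hlam (η := α / 2)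
    (by positivity)
  obtain ⟨C₂, hC₂, hbd₂⟩ := exists_bound_twoSampleEmp hFa hFb hna hnb hlam hη
  let C : ℝ := s⁻¹ * C₁ + 1
  set κ : ℝ := (gaussianReal 0 1).real (Set.Ioi (C + 1)) with hκ
  have hκ0 : 0 < κ := gaussianReal_real_Ioi_pos _
  -- Chosen before the partition; this is legitimate because κ depends on C only and C on the
  -- supremum of |Z| over all of F.
  let ε : ℝ := min 1 (η * κ / 6)
  have hε : 0 < ε := by positivity
  have hε1 : ε ≤ 1 := min_le_left _ _
  have hεκ : 6 * ε / κ ≤ η := by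
    rw [div_le_iff₀ hκ0]
    have : ε ≤ η * κ / 6 := min_le_right _ _
    linarith
  obtain ⟨N, π, hcol⟩ := exists_coloring_twoSampleEmp hFa hFb hna hnb hlam (inv_pos.2 hs) hu0 hu
    hε hη
  -- Only the cells that meet S are kept, so representatives can be taken in S and the bootstrap
  -- maximum over them is at most the supremum over S.
  obtain ⟨n, π', hπ's, hπ'⟩ := exists_fin_coloring (fun f : S => π ⟨f, hSF f.2⟩)
    (Set.toFinite _)
  let e : Fin n → 𝒴 → ℝ := fun j => (Function.surjInv hπ's j : S)
  have heS : ∀ j, e j ∈ S := fun j => (Function.surjInv hπ's j).2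
  have heF : ∀ j, e j ∈ F := fun j => hSF (heS j)
  have heπ : ∀ f : S, π ⟨e (π' f), heF _⟩ = π ⟨f, hSF f.2⟩ := fun f =>
    hπ' _ _ (Function.surjInv_eq hπ's (π' f))
  have hne : Nonempty (Fin n) := ⟨π' ⟨f₀, hf₀⟩⟩
  let g : Fin n → 𝒴 → ℝ := fun j y => (σ (e j))⁻¹ * e j y
  have hgm : ∀ j, Measurable (g j) := fun j => (hFa.1 _ (heF j)).1.const_mul _
  have hga : ∀ j, MemLp (g j) 2 Pa := fun j => (hFa.memLp (heF j)).const_mul _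
  have hgb : ∀ j, MemLp (g j) 2 Pb := fun j => (hFb.memLp (heF j)).const_mul _
  have hcov : (limitCov Pa Pb lam g).PosSemidef := posSemidef_limitCov hlam0 hga hgb
  -- Division by σ makes the limit variances equal to 1, as anti-concentration requires.
  have hcov1 : ∀ j, limitCov Pa Pb lam g j j = 1 := fun j => by
    rw [limitCov_apply_self hga hgb, limitVar_const_mul,
      ← sq_limitSD hlam0 (hFa.memLp (heF j)) (hFb.memLp (heF j)), ← hσdef, ← mul_pow,
      inv_mul_cancel₀ (hs.trans_le (hσs _ (heF j))).ne', one_pow]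
  have hX : ∀ k, Measurable fun p : (Fin (na k) → 𝒴) × (Fin (nb k) → 𝒴) =>
      (WithLp.toLp 2 fun j => twoSampleEmp Pa Pb p.1 p.2 (g j) : EuclideanSpace ℝ (Fin n)) :=
    fun k => (WithLp.measurable_toLp 2 _).comp
      (measurable_pi_lambda _ fun j => measurable_twoSampleEmp Pa Pb (hgm j))
  set ν := limitLaw Pa Pb lam g with hν
  -- The bound on Z over F passes to the limit law, whatever the number of representatives: ν gives
  -- mass at least 1 − α / 2 > p to a maximum of at most C.
  have hνC : p < ν.real {x | ∀ j, x j ≤ C} := by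
    have h1 : 1 - α / 2 ≤ ∫ x, maxCutoff (s⁻¹ * C₁) 1 x ∂ν := by
      refine ge_of_tendsto (tendsto_integral_twoSampleEmp hna hnb hlam hlam0 hgm hga hgb
        (maxCutoff (s⁻¹ * C₁) 1)) ?_
      filter_upwards [hbd₁] with k hk
      refine le_trans ?_ (le_integral_maxCutoff (hX k).aemeasurable one_pos)
      have hmeas := hX k (measurableSet_forall_le (ι := Fin n) (s⁻¹ * C₁))
      have h2 := probReal_compl_eq_one_sub (μ := (Measure.pi fun _ : Fin (na k) => Pa).prod
        (Measure.pi fun _ : Fin (nb k) => Pb)) hmeas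
      have h3 : ((Measure.pi fun _ : Fin (na k) => Pa).prod
          (Measure.pi fun _ : Fin (nb k) => Pb)).real
          ((fun p : (Fin (na k) → 𝒴) × (Fin (nb k) → 𝒴) => (WithLp.toLp 2 fun j =>
            twoSampleEmp Pa Pb p.1 p.2 (g j) : EuclideanSpace ℝ (Fin n))) ⁻¹'
            {x | ∀ j, x j ≤ s⁻¹ * C₁})ᶜ ≤ α / 2 := by
        refine ENNReal.toReal_le_of_le_ofReal (by positivity) ((measure_mono fun p hp => ?_).trans hk)
        simp only [Set.mem_compl_iff, Set.mem_preimage, Set.mem_ofPred_eq, not_forall, not_le] at hp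
        obtain ⟨j, hj⟩ := hp
        refine ⟨e j, heF j, ?_⟩
        rw [twoSampleEmp_const_mul] at hj
        by_contra hc
        refine absurd hj (not_lt.2 ?_)
        calc _ ≤ (σ (e j))⁻¹ * |twoSampleEmp Pa Pb p.1 p.2 (e j)| :=
              mul_le_mul_of_nonneg_left (le_abs_self _) (hu0 _ (heF j))
          _ ≤ s⁻¹ * C₁ := mul_le_mul (hu _ (heF j)) (not_lt.1 hc) (abs_nonneg _) (by positivity)
      have h4 : 1 - α / 2 ≤ ((Measure.pi fun _ : Fin (na k) => Pa).prod
          (Measure.pi fun _ : Fin (nb k) => Pb)).real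
          ((fun p : (Fin (na k) → 𝒴) × (Fin (nb k) → 𝒴) => (WithLp.toLp 2 fun j =>
            twoSampleEmp Pa Pb p.1 p.2 (g j) : EuclideanSpace ℝ (Fin n))) ⁻¹'
            {x | ∀ j, x j ≤ s⁻¹ * C₁}) := by linarith
      exact h4
    have h4 := integral_maxCutoff_le (m := ν) (X := fun x => x) aemeasurable_id
      (a := s⁻¹ * C₁) one_pos
    have h5 := h1.trans h4
    simp only [p, C]
    linarith
  obtain ⟨q, hq1, hq2⟩ := exists_quantile_max hcov hcov1 hp hε hε1 hνC
  rw [← limitLaw, ← hν] at hq1 hq2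
  -- By the choice of q and ε, a maximum of at most q − 5ε has ν-probability at least p − η = 1 − α
  -- − 2η.
  have hsecond := eventually_measure_exists_lt_twoSampleEmp_le hna hnb hlam hlam0 hgm hga hgb
    (a := q - 5 * ε) hε (β := α + 3 * η) (by
      rw [← hν]
      have : p = 1 - α - η := rfl
      linarith)
  -- It is 1 when the maximum is at most q − ε and 0 when it exceeds q, so its mean m is at most p =
  -- 1 − α − η.
  set h : EuclideanSpace ℝ (Fin n) →ᵇ ℝ := maxCutoff (q - ε) ε with hh
  let m : ℝ := ∫ x, h x ∂ν
  have hint : Integrable (fun x => h x) ν := integrable_maxCutoff (m := ν) (X := fun x => x)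
    aemeasurable_id _ _
  have hm0 : 0 ≤ m := integral_nonneg fun x => maxCutoff_nonneg _ _ x
  have hmp : m ≤ p := by
    refine (integral_maxCutoff_le (m := ν) (X := fun x => x) aemeasurable_id hε).trans
      ((measureReal_mono fun x hx j => (hx j).trans ?_).trans hq1)
    linarith
  have hthird := tendsto_measure_le_sum_twoSampleBoot Ya Yb hYa hYb hYa_indep hYb_indep hYab na nb
    lam hna hnb hlam hlam0 Qa Qb c hQa hQb R hR Wa Wb hWa hWb hWa_indep hWb_indep hWab hYW hgm hga
    hgb (f := h - BoundedContinuousFunction.const _ m) (fun x => by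
      have h1 := maxCutoff_nonneg (q - ε) ε x
      have h2 := maxCutoff_le_one (q - ε) ε x
      have h3 : m ≤ 1 := by simp only [p] at hmp; linarith
      simp only [BoundedContinuousFunction.coe_sub, Pi.sub_apply,
        BoundedContinuousFunction.const_apply, abs_le]
      constructor <;> linarith) (by
      simp only [BoundedContinuousFunction.coe_sub, Pi.sub_apply,
        BoundedContinuousFunction.const_apply]
      rw [integral_sub hint (integrable_const _)]
      simp [m, hν]) hη
  let τ : ℝ := min (s / 2) (ε * s ^ 2 / (2 * C₂))
  have hτ : 0 < τ := by positivity
  have hτε : 2 * C₂ * τ / s ^ 2 ≤ ε := by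
    rw [div_le_iff₀ (by positivity)]
    have : τ ≤ ε * s ^ 2 / (2 * C₂) := min_le_right _ _
    rw [le_div_iff₀ (by positivity)] at this
    linarith
  have hηpos : (0 : ℝ≥0∞) < ENNReal.ofReal η := by simpa using hη
  filter_upwards [hbd₂, hcol, hsecond, hthird.eventually (gt_mem_nhds hηpos),
    (hσhat τ hτ).eventually (gt_mem_nhds hηpos), hna.eventually_gt_atTop 0,
    hnb.eventually_gt_atTop 0] with k hk1 hk2 hk3 hk4 hk5 hk6 hk7
  have hlaw := hasLaw_twoSample hYa hYb hYa_indep hYb_indep hYab (na k) (nb k)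
  let D : Ω → (Fin (na k) → 𝒴) × (Fin (nb k) → 𝒴) := fun ω => (fun i => Ya i ω, fun i => Yb i ω)
  let A₁ : Set ((Fin (na k) → 𝒴) × (Fin (nb k) → 𝒴)) :=
    {p | ∃ f ∈ F, C₂ < |twoSampleEmp Pa Pb p.1 p.2 f|}
  let A₂ : Set ((Fin (na k) → 𝒴) × (Fin (nb k) → 𝒴)) := {p | ∃ f g : F, π f = π g ∧
    ε < |(σ f)⁻¹ * twoSampleEmp Pa Pb p.1 p.2 f - (σ g)⁻¹ * twoSampleEmp Pa Pb p.1 p.2 g|}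
  let A₃ : Set ((Fin (na k) → 𝒴) × (Fin (nb k) → 𝒴)) :=
    {p | ∃ j, q - 5 * ε + ε < twoSampleEmp Pa Pb p.1 p.2 (g j)}
  have hA : μ {ω | D ω ∈ A₁ ∪ (A₂ ∪ A₃)} ≤ ENNReal.ofReal (η + (η + (α + 3 * η))) := by
    refine (hlaw.measure_preimage_le _).trans ((measure_union_le _ _).trans
      ((add_le_add hk1 ((measure_union_le _ _).trans (add_le_add hk2 hk3))).trans (le_of_eq ?_)))
    rw [← ENNReal.ofReal_add (by positivity) (by positivity),
      ← ENNReal.ofReal_add (by positivity) (by positivity)]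
  refine (measure_mono fun ω hω => ?_).trans ((measure_union_le _ _).trans ((add_le_add
    ((measure_union_le _ _).trans (add_le_add hk4.le hk5.le)) hA).trans ?_))
  -- Off the bad events, a false rejection gives at least (1 − α)R replications with maximum at most
  -- Z(g_i) + 3ε ≤ q − ε. On these h equals 1, so the sum of h − m is at least (1 − α)R − pR = ηR,
  -- which is itself one of the bad events.
  · by_contra hc
    simp only [Set.mem_union, not_or] at hc
    obtain ⟨⟨hc4, hc5⟩, hcA⟩ := hc
    simp only [A₁, A₂, A₃, D, Set.mem_ofPred_eq, not_or, not_exists, not_and,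
      not_lt] at hcA hc5
    obtain ⟨hc1, hc2, hc3⟩ := hcA
    obtain ⟨f, hf, hlt⟩ := exists_critValue_lt_of_mem_stepdownRejects hSF hω
    obtain ⟨i, hi⟩ := le_ncard_of_critValue_lt_div (σ := σ) (σh := σhat k ω)
      (Z := fun f => twoSampleEmp Pa Pb (fun i : Fin (na k) => Ya i ω)
        (fun i : Fin (nb k) => Yb i ω) f) hs (fun f hf => hσs f (hSF hf)) (min_le_left _ _)
      (fun f hf => hc5 f (hSF hf)) (fun f hf => hc1 f (hSF hf)) hτε heS (φ := π')
      (fun f => hc2 ⟨f, hSF f.2⟩ ⟨e (π' f), heF _⟩ (heπ f).symm) (ht k ω hk7) hf hlt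
    refine hc4 ?_
    let B : Fin (R k) → EuclideanSpace ℝ (Fin n) := fun r => WithLp.toLp 2 fun j =>
      twoSampleBoot c (fun i : Fin (na k) => Ya i ω) (fun i : Fin (nb k) => Yb i ω)
        (Wa k r ω) (Wb k r ω) (g j)
    let G : Finset (Fin (R k)) := Finset.univ.filter fun r => ∀ j, B r j ≤ q - ε
    have hG : (1 - α) * R k ≤ (G.card : ℝ) := by
      refine hi.trans ?_
      rw [← Set.ncard_coe_finset G]
      refine Nat.cast_le.2 (Set.ncard_le_ncard (fun r hr => ?_) (Set.toFinite _))
      simp only [G, Finset.coe_filter, Finset.mem_univ, true_and, Set.mem_ofPred_eq] at hr ⊢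
      intro j
      have h1 := hr j
      have h2 := hc3 i
      simp only [B, g]
      rw [bootProcess_eq_twoSampleBoot hk6 hk7] at h1
      rw [twoSampleEmp_const_mul] at h2
      rw [twoSampleBoot_const_mul]
      linarith
    have hsum : (G.card : ℝ) ≤ ∑ r, h (B r) := by
      calc (G.card : ℝ) = ∑ r ∈ G, h (B r) := by
            rw [Finset.sum_congr rfl fun r hr =>
              maxCutoff_eq_one hε (Finset.mem_filter.1 hr).2, Finset.sum_const, nsmul_eq_mul,
              mul_one]
        _ ≤ ∑ r, h (B r) := Finset.sum_le_sum_of_subset_of_nonneg (Finset.subset_univ _)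
            fun r _ _ => maxCutoff_nonneg _ _ _
    show η * R k ≤ ∑ r, (h (B r) - m)
    rw [Finset.sum_sub_distrib, Finset.sum_const, Finset.card_univ, Fintype.card_fin, nsmul_eq_mul]
    have h1 : (R k : ℝ) * m ≤ R k * p := mul_le_mul_of_nonneg_left hmp (Nat.cast_nonneg _)
    have h2 : (1 - α) * R k - R k * p = η * R k := by simp only [p]; ring
    linarith
  · rw [← ENNReal.ofReal_add hη.le hη.le, ← ENNReal.ofReal_add (by positivity) (by positivity)]
    refine ENNReal.ofReal_le_ofReal ?_
    linarith

end FamilywiseError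

theorem mainTheorem8 {𝒴 Ω : Type*} [MeasurableSpace 𝒴] [MeasurableSpace Ω]
    (μ : Measure Ω) [IsProbabilityMeasure μ]
    (Pa Pb : Measure 𝒴) [IsProbabilityMeasure Pa] [IsProbabilityMeasure Pb]
    -- the class of utility functions
    (F : Set (𝒴 → ℝ)) (hFa : IsDonsker F Pa) (hFb : IsDonsker F Pb)
    (hMa : ∀ δ : ℝ, 0 < δ → IsMeasurableClass (smallDifferences F Pa δ) Pa)
    (hMb : ∀ δ : ℝ, 0 < δ → IsMeasurableClass (smallDifferences F Pb δ) Pb)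
    -- two independent iid samples
    (Ya Yb : ℕ → Ω → 𝒴)
    (hYa : ∀ i, HasLaw (Ya i) Pa μ) (hYb : ∀ i, HasLaw (Yb i) Pb μ)
    (hYa_indep : iIndepFun Ya μ) (hYb_indep : iIndepFun Yb μ)
    (hYab : IndepFun (fun ω i => Ya i ω) (fun ω i => Yb i ω) μ)
    -- sample sizes
    (na nb : ℕ → ℕ) (lam : ℝ) (hna : Tendsto na atTop atTop) (hnb : Tendsto nb atTop atTop)
    (hlam : Tendsto (fun k => (na k : ℝ) / (nb k : ℝ)) atTop (𝓝 lam))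
    -- bootstrap weights: `R k` independent draws for each sample, independent of the data
    (Qa Qb : ∀ n : ℕ, Measure (Fin n → ℝ)) (c : ℝ)
    (hQa : IsBootstrapWeightLaw Qa c) (hQb : IsBootstrapWeightLaw Qb c)
    (R : ℕ → ℕ) (hR : Tendsto R atTop atTop)
    (Wa : ∀ k, Fin (R k) → Ω → Fin (na k) → ℝ) (Wb : ∀ k, Fin (R k) → Ω → Fin (nb k) → ℝ)
    (hWa : ∀ k r, HasLaw (Wa k r) (Qa (na k)) μ) (hWb : ∀ k r, HasLaw (Wb k r) (Qb (nb k)) μ)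
    (hWa_indep : ∀ k, iIndepFun (Wa k) μ) (hWb_indep : ∀ k, iIndepFun (Wb k) μ)
    (hWab : ∀ k, IndepFun (fun ω r => Wa k r ω) (fun ω r => Wb k r ω) μ)
    (hYW : ∀ k, IndepFun (fun ω => ((fun i => Ya i ω), (fun i => Yb i ω)))
      (fun ω => ((fun r => Wa k r ω), (fun r => Wb k r ω))) μ)
    -- variances bounded away from zero, and uniformly consistent estimators `σhat k ω f` of `σ_f`,
    -- which may depend on the data and on the bootstrap draws
    (hσ : ∃ s : ℝ, 0 < s ∧ ∀ f ∈ F, s ≤ limitSD Pa Pb lam f ^ 2)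
    (σhat : ℕ → Ω → (𝒴 → ℝ) → ℝ)
    (hσhat : ∀ ε : ℝ, 0 < ε → Tendsto
      (fun k => μ {ω | ∃ f ∈ F, ε < |σhat k ω f - limitSD Pa Pb lam f|}) atTop (𝓝 0))
    -- nominal level
    (α : ℝ) (hα0 : 0 < α) (hα1 : α < 1) :
    -- the bootstrap `t`-statistics of replication `r`
    let tBoot : ∀ k, Ω → Fin (R k) → (𝒴 → ℝ) → ℝ := fun k ω r f =>
      bootProcess c (fun i => Ya i ω) (fun i => Yb i ω) (Wa k r ω) (Wb k r ω) f / σhat k ω f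
    -- asymptotic control of the familywise error rate, with either centring of the statistics
    limsup (fun k => μ {ω | ∃ f ∈ trueNulls F Pa Pb, f ∈ stepdownRejects F α (tBoot k ω)
      (centeredTStat Pa Pb (na k) (nb k) (fun i => Ya i ω) (fun i => Yb i ω) (σhat k ω))}) atTop
      ≤ ENNReal.ofReal α ∧
    limsup (fun k => μ {ω | ∃ f ∈ trueNulls F Pa Pb, f ∈ stepdownRejects F α (tBoot k ω)
      (tStat (na k) (nb k) (fun i => Ya i ω) (fun i => Yb i ω) (σhat k ω))}) atTop
      ≤ ENNReal.ofReal α := by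
  intro tBoot
  have hlim : ∀ t : ℕ → Ω → (𝒴 → ℝ) → ℝ, (∀ k ω, 0 < nb k → ∀ f ∈ trueNulls F Pa Pb,
      0 < σhat k ω f → t k ω f ≤ twoSampleEmp Pa Pb (fun i : Fin (na k) => Ya i ω)
        (fun i : Fin (nb k) => Yb i ω) f / σhat k ω f) →
      limsup (fun k => μ {ω | ∃ f ∈ trueNulls F Pa Pb,
        f ∈ stepdownRejects F α (tBoot k ω) (t k ω)}) atTop ≤ ENNReal.ofReal α := fun t ht =>
    limsup_measure_stepdownRejects_le μ Pa Pb F hFa hFb Ya Yb hYa hYb hYa_indep hYb_indep hYab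
      na nb lam hna hnb hlam Qa Qb c hQa hQb R hR Wa Wb hWa hWb hWa_indep hWb_indep hWab hYW hσ
      σhat hσhat α hα0 hα1 (fun f hf => hf.1) t ht
  refine ⟨hlim (fun k ω => centeredTStat Pa Pb (na k) (nb k) (fun i => Ya i ω) (fun i => Yb i ω)
    (σhat k ω)) fun k ω hk f _ _ => ?_, hlim (fun k ω => tStat (na k) (nb k) (fun i => Ya i ω)
    (fun i => Yb i ω) (σhat k ω)) fun k ω hk f hf hpos => ?_⟩
  · exact (centeredTStat_eq_twoSampleEmp Pa Pb hk _ _ _ _).le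
  -- Under the null hypothesis, subtracting the true difference, which is nonpositive, can only
  -- increase the statistic.
  · rw [← centeredTStat_eq_twoSampleEmp Pa Pb hk (fun i => Ya i ω) (fun i => Yb i ω)]
    have hnull : ∫ y, f y ∂Pa ≤ ∫ y, f y ∂Pb := hf.2
    unfold tStat centeredTStat
    exact div_le_div_of_nonneg_right
      (mul_le_mul_of_nonneg_left (by linarith) (Real.sqrt_nonneg _)) hpos.le
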